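/- Let $\mathbb{P}^n$ be complex projective space. For a closed subscheme $X\subset\mathbb{P}^n$ with ideal sheaf $\mathcal{I}_X$ and an integer $m$, say that $X$ is $m$-regular if $H^i(\mathbb{P}^n,\mathcal{I}_X(m-i))=0$ for all $i>0$; the least such $m$ is the regularity $\operatorname{reg}X$. The Loewy length of a local Artinian ring $(A,\mathfrak{m})$ is $\mu_A:=\max\{i\ge 0 : \mathfrak{m}^i\neq 0\}$ (so $\mu_A=0$ if $A$ is a field). Theorem 1.1. Let $X\subset\mathbb{P}^n$ be a zero-dimensional closed subscheme supported at distinct closed points $p_1,\dots,p_t$, and let $\mu_i$ be the Loewy length of the local ring $\mathcal{O}_{X,p_i}$. Then $$H^1(\mathbb{P}^n,\mathcal{I}_X(k))=0\quad\text{for all } k\ge \mu_1+\cdots+\mu_t+t-1,$$ and $X$ is $(\mu_1+\cdots+\mu_t+t)$-regular. The bound is sharp: for all integers $n\ge 1$, $t\ge 1$ and $\mu_1,\dots,\mu_t\ge 0$ there is a closed subscheme $X\subset\mathbb{P}^n$ supported at $t$ distinct closed points $p_1,\dots,p_t$ such that $\mathcal{O}_{X,p_i}$ has Loewy length $\mu_i$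 for each $i$, $H^1(\mathbb{P}^n,\mathcal{I}_X(\mu_1+\cdots+\mu_t+t-2))\neq 0$, and $\operatorname{reg}X=\mu_1+\cdots+\mu_t+t$. -/

import Mathlib

open CategoryTheory AlgebraicGeometry TopologicalSpace Opposite

attribute [local instance] MvPolynomial.gradedAlgebra

noncomputable section

/-- The Loewy length of an Artinian local ring `(A, 𝔪)`: the largest `i` with `𝔪 ^ i ≠ 0`.
(For an Artinian local ring the set is finite, and it contains `0` because `𝔪 ^ 0 = A ≠ 0`.) -/
def loewyLength (A : Type*) [CommRing A] [IsLocalRing A] : ℕ :=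
  sSup {i : ℕ | IsLocalRing.maximalIdeal A ^ i ≠ ⊥}

namespace ProjSp

/-- The grading of `ℂ[x₀, …, xₙ]` by degree. -/
abbrev grading (n : ℕ) : ℕ → Submodule ℂ (MvPolynomial (Fin (n + 1)) ℂ) :=
  MvPolynomial.homogeneousSubmodule (Fin (n + 1)) ℂ

end ProjSp

/-- Complex projective `n`-space, as the scheme `Proj ℂ[x₀, …, xₙ]`. -/
abbrev ProjSp (n : ℕ) : Scheme.{0} := Proj (ProjSp.grading n)

namespace ProjSp

variable {n : ℕ}

/-- The standard affine open set `D₊(xᵢ)` of projective space. -/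
def chart (i : Fin (n + 1)) : (ProjSp n).Opens :=
  Proj.basicOpen (grading n) (MvPolynomial.X i)

/-- The regular function `xⱼ / xᵢ` on `D₊(xᵢ)`. -/
def ratio (i j : Fin (n + 1)) : Γ(ProjSp n, chart i) :=
  (Proj.awayToSection (grading n) (MvPolynomial.X i)).hom
    (HomogeneousLocalization.Away.mk (grading n) (d := 1)
      (MvPolynomial.isHomogeneous_X ℂ i) 1 (MvPolynomial.X j)
      (MvPolynomial.isHomogeneous_X ℂ j))

/-- The transition function `(xⱼ / xᵢ) ^ k` of `𝒪(k)` on `U ∩ D₊(xᵢ) ∩ D₊(xⱼ)`, for any integer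
`k`; when `k < 0` it is written `(xᵢ / xⱼ) ^ (-k)`. -/
def transition (k : ℤ) (U : (ProjSp n).Opens) (i j : Fin (n + 1)) :
    Γ(ProjSp n, U ⊓ chart i ⊓ chart j) :=
  (ProjSp n).presheaf.map (homOfLE (inf_le_left.trans inf_le_right)).op (ratio i j) ^ k.toNat *
    (ProjSp n).presheaf.map (homOfLE inf_le_right).op (ratio j i) ^ (-k).toNat

variable {X : Scheme.{0}}

/-- The sections over `U` of `ℐ_X(k)`, the ideal sheaf of `ι : X ⟶ ℙⁿ` twisted by `𝒪(k)`. The line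
bundle `𝒪(k)` is trivial on each `D₊(xᵢ)`, with transition functions `(xⱼ / xᵢ) ^ k`, so a section
is a family of functions `sᵢ` on `U ∩ D₊(xᵢ)` (think of `s / xᵢ ^ k`) such that
`sᵢ = (xⱼ / xᵢ) ^ k * sⱼ` on overlaps and such that each `sᵢ` lies in the ideal sheaf
`ℐ_X = ker (𝒪 ⟶ ι_* 𝒪_X)`. -/
def twistedIdealSections (ι : X ⟶ ProjSp n) (k : ℤ) (U : (ProjSp n).Opens) :
    AddSubgroup (∀ i : Fin (n + 1), Γ(ProjSp n, U ⊓ chart i)) where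
  carrier := {s | (∀ i, (ι.app (U ⊓ chart i)).hom (s i) = 0) ∧
    ∀ i j, (ProjSp n).presheaf.map (homOfLE inf_le_left).op (s i) =
      transition k U i j *
        (ProjSp n).presheaf.map (homOfLE (inf_le_inf_right _ inf_le_left)).op (s j)}
  zero_mem' := by simp
  add_mem' := by
    rintro a b ⟨ha, ha'⟩ ⟨hb, hb'⟩
    refine ⟨fun i ↦ ?_, fun i j ↦ ?_⟩
    · simp [ha i, hb i]
    · simp [ha' i j, hb' i j, mul_add]
  neg_mem' := by
    rintro a ⟨ha, ha'⟩
    refine ⟨fun i ↦ ?_, fun i j ↦ ?_⟩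
    · simp [ha i]
    · simp [ha' i j]

lemma map_map_apply {U V W : (ProjSp n).Opens} (f : W ⟶ V) (g : V ⟶ U) (s : Γ(ProjSp n, U)) :
    (ProjSp n).presheaf.map f.op ((ProjSp n).presheaf.map g.op s) =
      (ProjSp n).presheaf.map (f ≫ g).op s := by
  simp

lemma map_transition (k : ℤ) {U V : (ProjSp n).Opens} (h : V ≤ U) (i j : Fin (n + 1)) :
    (ProjSp n).presheaf.map
        (homOfLE (inf_le_inf_right _ (inf_le_inf_right _ h))).op (transition k U i j) =
      transition k V i j := by
  simp only [transition, map_mul, map_pow, map_map_apply]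
  rfl

lemma app_map_apply (ι : X ⟶ ProjSp n) {U V : (ProjSp n).Opens} (f : V ⟶ U)
    (s : Γ(ProjSp n, U)) :
    ι.app V ((ProjSp n).presheaf.map f.op s) =
      X.presheaf.map ((Opens.map ι.base).map f).op (ι.app U s) := by
  have := ι.naturality f.op
  exact congr($this s)

/-- Restriction of sections of `ℐ_X(k)`. -/
def twistedIdealRestrict (ι : X ⟶ ProjSp n) (k : ℤ) {U V : (ProjSp n).Opens} (h : V ≤ U) :
    twistedIdealSections ι k U →+ twistedIdealSections ι k V where
  toFun s := ⟨fun i ↦ (ProjSp n).presheaf.map (homOfLE (inf_le_inf_right _ h)).op (s.1 i), by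
    obtain ⟨s, hs, hs'⟩ := s
    refine ⟨fun i ↦ ?_, fun i j ↦ ?_⟩
    · refine (app_map_apply ι (homOfLE (inf_le_inf_right (chart i) h)) (s i)).trans ?_
      refine (congrArg _ (hs i)).trans ?_
      simp
    · have := congrArg ((ProjSp n).presheaf.map
        (homOfLE (inf_le_inf_right (chart j) (inf_le_inf_right (chart i) h))).op) (hs' i j)
      rw [map_mul, map_transition k h i j, map_map_apply, map_map_apply] at this
      rw [map_map_apply, map_map_apply]
      exact this⟩
  map_zero' := by
    ext i; simp
  map_add' a b := by
    ext i; simp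

/-- The presheaf of abelian groups `ℐ_X(k)` on projective space. -/
def twistedIdealPresheaf (ι : X ⟶ ProjSp n) (k : ℤ) :
    TopCat.Presheaf AddCommGrpCat.{0} (ProjSp n) where
  obj U := AddCommGrpCat.of (twistedIdealSections ι k U.unop)
  map f := AddCommGrpCat.ofHom (twistedIdealRestrict ι k f.unop.le)
  map_id U := by
    refine AddCommGrpCat.hom_ext (AddMonoidHom.ext fun s ↦ Subtype.ext (funext fun i ↦ ?_))
    exact congr($((ProjSp n).presheaf.map_id (op (U.unop ⊓ chart i))) (s.1 i))
  map_comp f g := by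
    refine AddCommGrpCat.hom_ext (AddMonoidHom.ext fun s ↦ Subtype.ext (funext fun i ↦ ?_))
    exact (map_map_apply _ _ (s.1 i)).symm

lemma twistedIdealPresheaf_isSheaf (ι : X ⟶ ProjSp n) (k : ℤ) :
    (twistedIdealPresheaf ι k).IsSheaf := by
  rw [TopCat.Presheaf.isSheaf_iff_isSheafUniqueGluing]
  intro α U sf hsf
  -- glue the components chart by chart
  have hcov (i : Fin (n + 1)) : iSup U ⊓ chart i ≤ ⨆ a, U a ⊓ chart i :=
    (iSup_inf_eq U (chart i)).le
  have key (i : Fin (n + 1)) : ∃ s : Γ(ProjSp n, iSup U ⊓ chart i),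
      (∀ a, (ProjSp n).presheaf.map (homOfLE (inf_le_inf_right _ (le_iSup U a))).op s =
        (sf a).1 i) ∧
      ∀ t : Γ(ProjSp n, iSup U ⊓ chart i),
        (∀ a, (ProjSp n).presheaf.map (homOfLE (inf_le_inf_right _ (le_iSup U a))).op t =
          (sf a).1 i) → t = s := (ProjSp n).sheaf.existsUnique_gluing' (fun a ↦ U a ⊓ chart i)
    (iSup U ⊓ chart i) (fun a ↦ homOfLE (inf_le_inf_right _ (le_iSup U a))) (hcov i)
    (fun a ↦ (sf a).1 i) (by
      intro a b
      have h1 := congrFun (congrArg Subtype.val (hsf a b)) i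
      have h2 := congrArg ((ProjSp n).presheaf.map
        (homOfLE (show (U a ⊓ chart i) ⊓ (U b ⊓ chart i) ≤ (U a ⊓ U b) ⊓ chart i from
          le_inf (inf_le_inf inf_le_left inf_le_left) (inf_le_left.trans inf_le_right))).op) h1
      exact (map_map_apply _ _ _).symm.trans (h2.trans (map_map_apply _ _ _)))
  choose s hs hu using key
  refine ⟨⟨s, fun i ↦ ?_, fun i j ↦ ?_⟩, fun a ↦ ?_, fun t ht ↦ ?_⟩
  · refine X.sheaf.eq_of_locally_eq' (fun a ↦ ι ⁻¹ᵁ (U a ⊓ chart i)) _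
      (fun a ↦ (Opens.map ι.base).map (homOfLE (inf_le_inf_right _ (le_iSup U a)))) ?_ _ _ ?_
    · intro x hx
      have := hcov i hx
      simpa [Opens.mem_iSup] using this
    · intro a
      refine (app_map_apply ι (homOfLE (inf_le_inf_right _ (le_iSup U a))) (s i)).symm.trans ?_
      refine (congrArg _ (hs i a)).trans (((sf a).2.1 i).trans ?_)
      exact (map_zero _).symm
  · refine (ProjSp n).sheaf.eq_of_locally_eq' (fun a ↦ U a ⊓ chart i ⊓ chart j) _
      (fun a ↦ homOfLE (inf_le_inf_right _ (inf_le_inf_right _ (le_iSup U a)))) ?_ _ _ ?_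
    · rw [← iSup_inf_eq, ← iSup_inf_eq]
    · intro a
      have h := (sf a).2.2 i j
      rw [← hs i a, ← hs j a] at h
      refine ((map_map_apply _ _ (s i)).trans
        ((map_map_apply _ _ (s i)).symm.trans (h.trans ?_))).trans (map_mul _ _ _).symm
      refine congrArg₂ (· * ·) (map_transition k (le_iSup U a) i j).symm ?_
      exact (map_map_apply _ _ (s j)).trans (map_map_apply _ _ (s j)).symm
  · apply Subtype.ext
    funext i
    exact hs i a
  · apply Subtype.ext
    funext i
    exact hu i (t.1 i) fun a ↦ congrFun (congrArg Subtype.val (ht a)) i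

/-- The sheaf of abelian groups `ℐ_X(k)` on projective space, where `ℐ_X` is the ideal sheaf of
the closed immersion `ι : X ⟶ ℙⁿ`. -/
def twistedIdealSheaf (ι : X ⟶ ProjSp n) (k : ℤ) : TopCat.Sheaf AddCommGrpCat.{0} (ProjSp n) :=
  ⟨twistedIdealPresheaf ι k, twistedIdealPresheaf_isSheaf ι k⟩

/-- The sheaf cohomology group `Hⁱ(ℙⁿ, ℐ_X(k))`. -/
abbrev idealCohomology (ι : X ⟶ ProjSp n) (i : ℕ) (k : ℤ) : Type :=
  Sheaf.H (twistedIdealSheaf ι k) i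

/-- `X ⊆ ℙⁿ` is `m`-regular if `Hⁱ(ℙⁿ, ℐ_X(m - i)) = 0` for all `i > 0`. -/
def IsRegular (ι : X ⟶ ProjSp n) (m : ℤ) : Prop :=
  ∀ i : ℕ, 0 < i → Subsingleton (idealCohomology ι i (m - i))

end ProjSp

end

/-!
Let `X ⊆ ℙⁿ` be finite, with local rings of Loewy lengths `μᵢ` at its points `pᵢ`.

Since `X` is finite and its local rings are divisible groups, `𝒪_X` pushed forward to `ℙⁿ` is a
finite sum of injective skyscraper sheaves. The exact sequence `0 → ℐ_X(k) → 𝒪(k) → 𝒪_X → 0`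
(`idealComplex_shortExact`) thus reduces the vanishing of `Hⁱ(ℐ_X(k))` to that of `Hⁱ(𝒪(k))` when
`i ≥ 2`, and, as soon as `H¹(𝒪(k)) = 0`, to the surjectivity of `H⁰(𝒪(k)) → H⁰(𝒪_X)` when `i = 1`.

*Interpolation.* If `𝔪 ^ (μ + 1) = 0` in the local ring at a point, then every germ there is given
by a form of any degree `≥ μ`: it is a polynomial of degree `≤ μ` in linear forms vanishing at the
point (`exists_isHomogeneous_eq`). Multiplying by `∏_{j ≠ i} Lⱼ ^ (μⱼ + 1)`, where the linear form
`Lⱼ` vanishes at `pⱼ` but not at `pᵢ`, one obtains all functions supported at `pᵢ` from forms of any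
degree `≥ μᵢ + ∑_{j ≠ i} (μⱼ + 1)`; see `exists_germO_eq_of_le`.

*Cohomology of `𝒪(k)`.* Only vanishing is needed: in degrees `> n` (`eq_zero_of_lt`, by
Mayer–Vietoris for the standard cover), and in positive degrees for `k ≥ -n` (`eq_zero_of_neg_le`).
For the latter, differential operators take the place of the Čech complex. The operators
`θᵢ = xᵢ ∂/∂xᵢ` on `𝒪(k)` commute and satisfy Euler's identity `∑ θᵢ = k`. A class of positive
degree is killed by a power of each `xᵢ`, hence, as `∂ᵢ xᵢ = θᵢ + 1`, by a product of operators
`θᵢ + j` with `j ≥ 1`. So it is a generalized eigenvector of `∑ θᵢ` with eigenvalues `≤ -(n + 1)`,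
while `∑ θᵢ = k > -(n + 1)`; therefore it is torsion, and it vanishes because `𝒪(k)` is a sheaf of
`ℂ`-vector spaces. To let operators which are not linear over functions act on sections, a section
of `𝒪(k)` is described by its values in `ℂ(x₀, …, xₙ)` (`IsSec`, `tval`). Vanishing on affine open
sets, on which all of this rests, is `eq_zero_of_isAffineOpen`.

*Sharpness.* Let `X` be the subscheme `∏ᵢ (x - aᵢ) ^ (μᵢ + 1) = 0` of a line, of degree
`D = ∑ (μᵢ + 1)`. Sections of `𝒪(k)` restrict to polynomials of degree `≤ k` on the line
(`lineHom_eq_zero_or_natDegree_le`), so for `k ≤ D - 2` the class of `x ^ (D - 1)` is not in the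
image of `H⁰(𝒪(k))`, and `H¹(ℐ_X(k)) ≠ 0` (`not_subsingleton_idealCohomology_fatLine`).
-/

noncomputable section

/-! ### Cohomology of open sets and the Mayer–Vietoris sequence -/

namespace OpenCohomology

open Abelian Limits

variable {X : TopCat.{0}}

/-- Abelian sheaves on the space `X`. -/
abbrev AbSheaf (X : TopCat.{0}) := Sheaf (Opens.grothendieckTopology X) AddCommGrpCat.{0}

/-- The free abelian sheaf `ℤ_U` on an open set `U`; it corepresents `F ↦ F(U)`. -/
abbrev freeOpen (U : Opens X) : AbSheaf X :=
  (presheafToSheaf (Opens.grothendieckTopology X) AddCommGrpCat.{0}).obj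
    (yoneda.obj U ⋙ AddCommGrpCat.free)

/-- The map `ℤ_V ⟶ ℤ_U` for `V ≤ U`. -/
abbrev freeOpenMap {V U : Opens X} (h : V ≤ U) : freeOpen V ⟶ freeOpen U :=
  (presheafToSheaf (Opens.grothendieckTopology X) AddCommGrpCat.{0}).map
    (Functor.whiskerRight (yoneda.map (homOfLE h)) _)

/-- Homomorphisms from `ℤ_U` to `F` are sections of `F` over `U`. -/
def homEquivSection (U : Opens X) (F : AbSheaf X) : (freeOpen U ⟶ F) ≃ F.obj.obj (op U) :=
  ((sheafificationAdjunction (Opens.grothendieckTopology X) AddCommGrpCat.{0}).homEquiv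
      (yoneda.obj U ⋙ AddCommGrpCat.free) F).trans
    (((AddCommGrpCat.adj.whiskerRight (Opens X)ᵒᵖ).homEquiv (yoneda.obj U) F.obj).trans
      yonedaEquiv)

lemma homEquivSection_comp {U : Opens X} {F G : AbSheaf X} (φ : freeOpen U ⟶ F) (f : F ⟶ G) :
    homEquivSection U G (φ ≫ f) = f.hom.app (op U) (homEquivSection U F φ) := by
  simp only [homEquivSection, Equiv.trans_apply, Adjunction.homEquiv_naturality_right]
  rfl

lemma homEquivSection_map_comp {U V : Opens X} (h : V ≤ U) {F : AbSheaf X}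
    (φ : freeOpen U ⟶ F) :
    homEquivSection V F (freeOpenMap h ≫ φ) =
      F.obj.map (homOfLE h).op (homEquivSection U F φ) := by
  simp only [homEquivSection, Equiv.trans_apply, freeOpenMap]
  rw [Adjunction.homEquiv_naturality_left]
  erw [Adjunction.homEquiv_naturality_left]
  exact (yonedaEquiv_naturality _ _).symm

lemma homEquivSection_add {U : Opens X} {F : AbSheaf X} (φ ψ : freeOpen U ⟶ F) :
    homEquivSection U F (φ + ψ) = homEquivSection U F φ + homEquivSection U F ψ := by
  have h (χ : freeOpen U ⟶ F) : homEquivSection U F χ =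
      χ.hom.app (op U) (homEquivSection U _ (𝟙 (freeOpen U))) := by
    rw [← homEquivSection_comp, Category.id_comp]
  rw [h φ, h ψ, h (φ + ψ)]
  rfl

/-- The cohomology group `Hᵖ(U, F)`, as `Ext` from `ℤ_U`. -/
abbrev HU (F : AbSheaf X) (p : ℕ) (U : Opens X) : Type := Ext (freeOpen U) F p

/-- Restriction of cohomology classes. -/
def res (F : AbSheaf X) (p : ℕ) {V U : Opens X} (h : V ≤ U) : HU F p U →+ HU F p V :=
  (Ext.mk₀ (freeOpenMap h)).precomp F (zero_add p)

/-- Functoriality of `Hᵖ(U, -)`. -/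
def HU.map {F G : AbSheaf X} (f : F ⟶ G) (p : ℕ) (U : Opens X) : HU F p U →+ HU G p U :=
  (Ext.mk₀ f).postcomp (freeOpen U) (add_zero p)

section Functoriality

variable {F G K : AbSheaf X} {p : ℕ}

lemma HU.map_apply (f : F ⟶ G) {U : Opens X} (a : HU F p U) :
    HU.map f p U a = a.comp (Ext.mk₀ f) (add_zero p) := rfl

lemma res_apply {V U : Opens X} (h : V ≤ U) (a : HU F p U) :
    res F p h a = (Ext.mk₀ (freeOpenMap h)).comp a (zero_add p) := rfl

lemma HU.map_comp (f : F ⟶ G) (g : G ⟶ K) {U : Opens X} (a : HU F p U) :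
    HU.map (f ≫ g) p U a = HU.map g p U (HU.map f p U a) := by
  simp [HU.map_apply]

lemma HU.map_id {U : Opens X} (a : HU F p U) : HU.map (𝟙 F) p U a = a := by
  simp [HU.map_apply]

lemma HU.map_add (f g : F ⟶ G) {U : Opens X} (a : HU F p U) :
    HU.map (f + g) p U a = HU.map f p U a + HU.map g p U a := by
  simp [HU.map_apply, Ext.mk₀_add]

lemma freeOpenMap_comp {W V U : Opens X} (h : W ≤ V) (h' : V ≤ U) :
    freeOpenMap h ≫ freeOpenMap h' = freeOpenMap (h.trans h') := by
  rw [freeOpenMap, freeOpenMap, ← Functor.map_comp, ← Functor.whiskerRight_comp,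
    ← Functor.map_comp]
  rfl

lemma freeOpenMap_refl (U : Opens X) : freeOpenMap (le_refl U) = 𝟙 (freeOpen U) := by
  apply (homEquivSection U _).injective
  rw [← Category.comp_id (freeOpenMap _), homEquivSection_map_comp]
  exact congr($((freeOpen U).obj.map_id (op U)) _)

lemma res_res {W V U : Opens X} (h : W ≤ V) (h' : V ≤ U) (a : HU F p U) :
    res F p h (res F p h' a) = res F p (h.trans h') a := by
  simp only [res_apply]
  rw [Ext.mk₀_comp_mk₀_assoc, freeOpenMap_comp]

lemma res_refl {U : Opens X} (a : HU F p U) : res F p (le_refl U) a = a := by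
  rw [res_apply, freeOpenMap_refl, Ext.mk₀_id_comp]

lemma map_res (f : F ⟶ G) {V U : Opens X} (h : V ≤ U) (a : HU F p U) :
    HU.map f p V (res F p h a) = res G p h (HU.map f p U a) := by
  simp only [res_apply, HU.map_apply]
  rw [Ext.comp_assoc_of_third_deg_zero]

/-- `H⁰(U, F)` is the group of sections of `F` over `U`. -/
def H0 (F : AbSheaf X) (U : Opens X) : HU F 0 U ≃+ F.obj.obj (op U) :=
  Ext.addEquiv₀.trans ⟨homEquivSection U F, homEquivSection_add⟩

lemma H0_mk₀ {U : Opens X} (φ : freeOpen U ⟶ F) :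
    H0 F U (Ext.mk₀ φ) = homEquivSection U F φ := by
  have : Ext.addEquiv₀ (Ext.mk₀ φ) = φ := by
    apply (Ext.mk₀_bijective _ _).1
    simp
  exact congrArg (homEquivSection U F) this

lemma H0_map (f : F ⟶ G) {U : Opens X} (a : HU F 0 U) :
    H0 G U (HU.map f 0 U a) = f.hom.app (op U) (H0 F U a) := by
  obtain ⟨φ, rfl⟩ := (Ext.mk₀_bijective _ _).2 a
  rw [HU.map_apply, Ext.mk₀_comp_mk₀, H0_mk₀, H0_mk₀, homEquivSection_comp]

lemma H0_res {V U : Opens X} (h : V ≤ U) (a : HU F 0 U) :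
    H0 F V (res F 0 h a) = F.obj.map (homOfLE h).op (H0 F U a) := by
  obtain ⟨φ, rfl⟩ := (Ext.mk₀_bijective _ _).2 a
  rw [res_apply, Ext.mk₀_comp_mk₀, H0_mk₀, H0_mk₀, homEquivSection_map_comp]

end Functoriality

/-- The free abelian sheaf on the whole space is the constant sheaf `ℤ`: both corepresent global
sections. -/
def constantIsoFreeTop (X : TopCat.{0}) :
    (constantSheaf (Opens.grothendieckTopology X) AddCommGrpCat.{0}).obj
      (AddCommGrpCat.of (ULift ℤ)) ≅ freeOpen (⊤ : Opens X) :=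
  let e (F : AbSheaf X) := Ext.addEquiv₀.symm.toEquiv.trans
    (Sheaf.H.equiv₀ F (T := (⊤ : Opens X)) isTerminalTop).toEquiv
  have he {F G : AbSheaf X} (φ) (f : F ⟶ G) : e G (φ ≫ f) = f.hom.app (op ⊤) (e F φ) := by
    refine Eq.trans ?_ (Sheaf.H.equiv₀_naturality isTerminalTop f _).symm
    refine congrArg (Sheaf.H.equiv₀ G (T := (⊤ : Opens X)) isTerminalTop) ?_
    apply Ext.addEquiv₀.injective
    rw [Sheaf.H.addEquiv₀_map]
    exact (Ext.addEquiv₀.apply_symm_apply (φ ≫ f)).trans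
      (congrArg (· ≫ f) (Ext.addEquiv₀.apply_symm_apply φ)).symm
  { hom := (e _).symm (homEquivSection ⊤ _ (𝟙 _))
    inv := (homEquivSection ⊤ _).symm (e _ (𝟙 _))
    hom_inv_id := by
      apply (e _).injective
      rw [he, Equiv.apply_symm_apply, ← homEquivSection_comp, Category.id_comp,
        Equiv.apply_symm_apply]
    inv_hom_id := by
      apply (homEquivSection ⊤ _).injective
      rw [homEquivSection_comp, Equiv.apply_symm_apply, ← he, Category.id_comp,
        Equiv.apply_symm_apply] }

/-- Cohomology of the whole space, as defined through the constant sheaf, is `Hᵖ(⊤, F)`. -/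
def HTop (F : AbSheaf X) (p : ℕ) : HU F p ⊤ ≃+ Sheaf.H F p where
  toFun a := (Ext.mk₀ (constantIsoFreeTop X).hom).comp a (zero_add p)
  invFun a := (Ext.mk₀ (constantIsoFreeTop X).inv).comp a (zero_add p)
  left_inv a := by simp
  right_inv a := by simp
  map_add' a b := by simp

lemma subsingleton_H_iff {F : AbSheaf X} {p : ℕ} :
    Subsingleton (Sheaf.H F p) ↔ ∀ a : HU F p ⊤, a = 0 := by
  rw [← (HTop F p).toEquiv.subsingleton_congr, subsingleton_iff_forall_eq 0]

lemma HU_bot {F : AbSheaf X} {p : ℕ} (a : HU F p ⊥) : a = 0 := by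
  have h : 𝟙 (freeOpen (⊥ : Opens X)) = 0 := by
    apply (homEquivSection ⊥ _).injective
    have : Subsingleton ((freeOpen (⊥ : Opens X)).obj.obj (op ⊥)) :=
      AddCommGrpCat.subsingleton_of_isZero
        (TopCat.Sheaf.isTerminalOfEmpty (X := X) (freeOpen (⊥ : Opens X))).isZero
    exact Subsingleton.elim _ _
  rw [← Ext.mk₀_id_comp a, h, Ext.mk₀_zero, Ext.zero_comp]

/-- A cohomology class of positive degree is locally zero. Embed `F` in an injective sheaf; a class
of degree one comes from a section of the quotient, which lifts locally, and in higher degrees one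
shifts dimension. -/
lemma exists_res_eq_zero (p : ℕ) : ∀ (F : AbSheaf X) {U : Opens X} (a : HU F (p + 1) U),
    ∀ x ∈ U, ∃ (V : Opens X) (h : V ≤ U), x ∈ V ∧ res F (p + 1) h a = 0 := by
  induction p with
  | zero =>
    intro F U a x hx
    let S : ShortComplex (AbSheaf X) := ShortComplex.mk (Injective.ι F)
      (cokernel.π (Injective.ι F)) (by simp)
    have hS : S.ShortExact := { exact := ShortComplex.exact_cokernel _ }
    obtain ⟨c, hc⟩ := Ext.covariant_sequence_exact₁ _ hS a (Ext.eq_zero_of_injective _) (zero_add 1)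
    obtain ⟨φ, rfl⟩ := (Ext.mk₀_bijective _ _).2 c
    have hsurj : TopCat.Presheaf.IsLocallySurjective S.g.hom :=
      (TopCat.Sheaf.isLocallySurjective_iff_epi S.g).2 hS.epi_g
    obtain ⟨V, hV, ⟨t, ht⟩, hxV⟩ := hsurj.imageSieve_mem (homEquivSection U _ φ) x hx
    refine ⟨V, hV.le, hxV, ?_⟩
    have key : freeOpenMap hV.le ≫ φ = (homEquivSection V _).symm t ≫ S.g := by
      apply (homEquivSection V _).injective
      rw [homEquivSection_map_comp]
      refine ht.symm.trans ?_
      rw [homEquivSection_comp, Equiv.apply_symm_apply]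
    rw [res_apply, ← hc, Ext.mk₀_comp_mk₀_assoc, key, ← Ext.mk₀_comp_mk₀_assoc]
    simp
  | succ p ih =>
    intro F U a x hx
    let S : ShortComplex (AbSheaf X) := ShortComplex.mk (Injective.ι F)
      (cokernel.π (Injective.ι F)) (by simp)
    have hS : S.ShortExact := { exact := ShortComplex.exact_cokernel _ }
    obtain ⟨c, hc⟩ := Ext.covariant_sequence_exact₁ _ hS a (Ext.eq_zero_of_injective _) rfl
    obtain ⟨V, hV, hxV, h⟩ := ih _ c x hx
    refine ⟨V, hV, hxV, ?_⟩
    rw [res_apply, ← hc, ← Ext.comp_assoc (h₁₂ := zero_add _) (h₂₃ := rfl) (h := by omega),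
      ← res_apply, h, Ext.zero_comp]

section MayerVietoris

variable {F : AbSheaf X}

/-- The short exact sequence `0 → ℤ_{U ∩ V} → ℤ_U ⊞ ℤ_V → ℤ_{U ∪ V} → 0`. -/
abbrev mvComplex (U V : Opens X) : ShortComplex (AbSheaf X) :=
  ShortComplex.mk
    (biprod.lift (freeOpenMap (inf_le_left : U ⊓ V ≤ U)) (-freeOpenMap (inf_le_right : U ⊓ V ≤ V)))
    (biprod.desc (freeOpenMap (le_sup_left : U ≤ U ⊔ V)) (freeOpenMap (le_sup_right : V ≤ U ⊔ V)))
    (by simp [biprod.lift_desc, freeOpenMap_comp])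

lemma mvComplex_shortExact (U V : Opens X) : (mvComplex U V).ShortExact :=
  (Opens.mayerVietorisSquare U V).shortComplex_shortExact

/-- The connecting map `Hᵖ(U ∩ V, F) → Hᵖ⁺¹(U ∪ V, F)` of the Mayer–Vietoris sequence. -/
def mvδ (F : AbSheaf X) (p : ℕ) (U V : Opens X) : HU F p (U ⊓ V) →+ HU F (p + 1) (U ⊔ V) :=
  (mvComplex_shortExact U V).extClass.precomp F (add_comm 1 p)

lemma mvδ_apply {p : ℕ} {U V : Opens X} (b : HU F p (U ⊓ V)) :
    mvδ F p U V b = (mvComplex_shortExact U V).extClass.comp b (add_comm 1 p) := rfl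

lemma mvδ_map {G : AbSheaf X} (f : F ⟶ G) {p : ℕ} {U V : Opens X} (b : HU F p (U ⊓ V)) :
    HU.map f (p + 1) (U ⊔ V) (mvδ F p U V b) = mvδ G p U V (HU.map f p _ b) := by
  rw [HU.map_apply, HU.map_apply, mvδ_apply, mvδ_apply,
    Ext.comp_assoc_of_third_deg_zero]

lemma exists_mvδ_eq {p : ℕ} {U V : Opens X} (a : HU F (p + 1) (U ⊔ V))
    (hU : res F (p + 1) le_sup_left a = 0) (hV : res F (p + 1) le_sup_right a = 0) :
    ∃ b, mvδ F p U V b = a := by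
  refine Ext.contravariant_sequence_exact₃ (mvComplex_shortExact U V) F a ?_ (add_comm 1 p)
  dsimp only [mvComplex]
  apply Ext.biprod_ext
  · rw [Ext.mk₀_comp_mk₀_assoc, biprod.inl_desc]
    exact hU.trans (by simp)
  · rw [Ext.mk₀_comp_mk₀_assoc, biprod.inr_desc]
    exact hV.trans (by simp)

lemma mvδ_res_left {p : ℕ} {U V : Opens X} (b : HU F p U) :
    mvδ F p U V (res F p inf_le_left b) = 0 := by
  have h : freeOpenMap (inf_le_left : U ⊓ V ≤ U) = (mvComplex U V).f ≫ biprod.fst :=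
    (biprod.lift_fst _ _).symm
  have h' := (mvComplex_shortExact U V).extClass_comp_assoc
    ((Ext.mk₀ biprod.fst).comp b (zero_add p)) (h := add_comm 1 p)
  rw [mvδ_apply, res_apply, h]
  rwa [Ext.mk₀_comp_mk₀_assoc] at h'

lemma mvδ_res_right {p : ℕ} {U V : Opens X} (b : HU F p V) :
    mvδ F p U V (res F p inf_le_right b) = 0 := by
  -- the second component of the first map of `mvComplex` carries a sign
  have h : freeOpenMap (inf_le_right : U ⊓ V ≤ V) = (mvComplex U V).f ≫ (-biprod.snd) := by
    dsimp only [mvComplex]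
    rw [Preadditive.comp_neg, biprod.lift_snd, neg_neg]
  have h' := (mvComplex_shortExact U V).extClass_comp_assoc
    ((Ext.mk₀ (-biprod.snd)).comp b (zero_add p)) (h := add_comm 1 p)
  rw [mvδ_apply, res_apply, h]
  rwa [Ext.mk₀_comp_mk₀_assoc] at h'

end MayerVietoris

end OpenCohomology

/-! ### Vanishing on affine open sets -/

namespace OpenCohomology

open Abelian Limits

lemma eq_zero_of_res_eq {X : TopCat.{0}} {F : AbSheaf X} {p : ℕ} {U V : Opens X} (h : U = V)
    {a : HU F p U} (ha : res F p h.ge a = 0) : a = 0 := by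
  subst h
  rwa [res_refl] at ha

/-- Mayer–Vietoris: a class on `W = U ∪ V` which vanishes on `U` and on `V` is zero if all classes
one degree below on `U ∩ V` are sums of restrictions from `U` and from `V`. -/
lemma eq_zero_of_mayerVietoris {X : TopCat.{0}} {F : AbSheaf X} {p : ℕ} {U V W : Opens X}
    (hW : W = U ⊔ V) (hU : U ≤ W) (hV : V ≤ W) (a : HU F (p + 1) W)
    (haU : res F (p + 1) hU a = 0) (haV : res F (p + 1) hV a = 0)
    (h : ∀ b : HU F p (U ⊓ V), ∃ b₁ b₂, b = res F p inf_le_left b₁ + res F p inf_le_right b₂) :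
    a = 0 := by
  subst hW
  obtain ⟨b, rfl⟩ := exists_mvδ_eq a haU haV
  obtain ⟨b₁, b₂, rfl⟩ := h b
  rw [map_add, mvδ_res_left, mvδ_res_right, add_zero]

section Affine

variable {Y : Scheme.{0}}

lemma exists_map_basicOpen {V : Y.Opens} (hV : IsAffineOpen V) (g : Γ(Y, V)) {W : Y.Opens}
    (hW : W = Y.basicOpen g) (hWV : W ≤ V) (s : Γ(Y, W)) :
    ∃ (N : ℕ) (y : Γ(Y, V)), Y.presheaf.map (homOfLE hWV).op y =
      Y.presheaf.map (homOfLE hWV).op g ^ N * s := by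
  subst hW
  obtain ⟨N, y, h⟩ := exists_eq_pow_mul_of_isAffineOpen Y V hV g s
  exact ⟨N, y, h⟩

lemma presheaf_map_map {U V W : Y.Opens} (h : W ≤ V) (h' : V ≤ U) (s : Γ(Y, U)) :
    Y.presheaf.map (homOfLE h).op (Y.presheaf.map (homOfLE h').op s) =
      Y.presheaf.map (homOfLE (h.trans h')).op s := by
  rw [← ConcreteCategory.comp_apply, ← Functor.map_comp]
  rfl

/-- A regular function on `D(f) ∩ D(g)`, where `f + g = 1` on an affine open set, is the sum of a
function on `D(f)` and a function on `D(g)`. -/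
lemma exists_add_of_add_eq_one {V : Y.Opens} (hV : IsAffineOpen V) {f g : Γ(Y, V)}
    (hfg : f + g = 1) (s : Γ(Y, Y.basicOpen f ⊓ Y.basicOpen g)) :
    ∃ (s₁ : Γ(Y, Y.basicOpen f)) (s₂ : Γ(Y, Y.basicOpen g)),
      s = Y.presheaf.map (homOfLE inf_le_left).op s₁ +
        Y.presheaf.map (homOfLE inf_le_right).op s₂ := by
  obtain ⟨N, y₁, h₁⟩ := exists_map_basicOpen (hV.basicOpen f)
    (Y.presheaf.map (homOfLE (Y.basicOpen_le f)).op g)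
    (W := Y.basicOpen f ⊓ Y.basicOpen g) (by rw [Scheme.basicOpen_res]) inf_le_left s
  obtain ⟨M, y₂, h₂⟩ := exists_map_basicOpen (hV.basicOpen g)
    (Y.presheaf.map (homOfLE (Y.basicOpen_le g)).op f)
    (W := Y.basicOpen f ⊓ Y.basicOpen g) (by rw [Scheme.basicOpen_res, inf_comm]) inf_le_right s
  rw [presheaf_map_map] at h₁ h₂
  obtain ⟨a, b, hab⟩ : IsCoprime (f ^ M) (g ^ N) := IsCoprime.pow ⟨1, 1, by simpa using hfg⟩
  refine ⟨Y.presheaf.map (homOfLE (Y.basicOpen_le f)).op b * y₁,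
    Y.presheaf.map (homOfLE (Y.basicOpen_le g)).op a * y₂, ?_⟩
  have := congrArg (Y.presheaf.map
    (homOfLE (inf_le_left.trans (Y.basicOpen_le f) : Y.basicOpen f ⊓ Y.basicOpen g ≤ V)).op) hab
  simp only [map_add, map_mul, map_pow, map_one] at this
  simp only [map_mul, presheaf_map_map, h₁, h₂]
  linear_combination (-s) * this

variable {F : AbSheaf Y} {V₀ : Y.Opens} (e : ∀ V ≤ V₀, F.obj.obj (op V) ≃+ Γ(Y, V))
  (he : ∀ (V W : Y.Opens) (h : W ≤ V) (hV : V ≤ V₀) (s : F.obj.obj (op V)),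
    e W (h.trans hV) (F.obj.map (homOfLE h).op s) = Y.presheaf.map (homOfLE h).op (e V hV s))

include he in
/-- If `f + g = 1`, then a class which vanishes on `D(f)` and `D(g)` vanishes. On `D(f) ∩ D(g)` use
the splitting of functions in degree zero, and the induction hypothesis in higher degrees. -/
lemma eq_zero_of_add_eq_one {p : ℕ}
    (ih : ∀ q < p, ∀ V : Y.Opens, IsAffineOpen V → V ≤ V₀ → ∀ a : HU F (q + 1) V, a = 0)
    {V : Y.Opens} (hV : IsAffineOpen V) (hV₀ : V ≤ V₀) {f g : Γ(Y, V)} (hfg : f + g = 1)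
    (a : HU F (p + 1) V) (hf : res F (p + 1) (Y.basicOpen_le f) a = 0)
    (hg : res F (p + 1) (Y.basicOpen_le g) a = 0) : a = 0 := by
  have hsup : V = Y.basicOpen f ⊔ Y.basicOpen g := by
    refine ((hV.iSup_basicOpen_eq_self_iff (s := {f, g})).2 ?_).symm.trans ?_
    · rw [Ideal.eq_top_iff_one, ← hfg]
      exact add_mem (Ideal.subset_span (by simp)) (Ideal.subset_span (by simp))
    · apply le_antisymm
      · refine iSup_le ?_
        rintro ⟨i, rfl | rfl⟩
        exacts [le_sup_left, le_sup_right]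
      · exact sup_le (le_iSup (fun i : ({f, g} : Set _) ↦ Y.basicOpen i.1) ⟨f, by simp⟩)
          (le_iSup (fun i : ({f, g} : Set _) ↦ Y.basicOpen i.1) ⟨g, by simp⟩)
  refine eq_zero_of_mayerVietoris hsup _ _ a hf hg fun b ↦ ?_
  have hle : Y.basicOpen f ⊓ Y.basicOpen g ≤ V₀ := inf_le_left.trans ((Y.basicOpen_le f).trans hV₀)
  rcases p with _ | p
  · obtain ⟨s₁, s₂, hs⟩ := exists_add_of_add_eq_one hV hfg (e _ hle (H0 F _ b))
    refine ⟨(H0 F _).symm ((e _ ((Y.basicOpen_le f).trans hV₀)).symm s₁),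
      (H0 F _).symm ((e _ ((Y.basicOpen_le g).trans hV₀)).symm s₂), ?_⟩
    apply (H0 F _).injective
    apply (e _ hle).injective
    rw [hs, map_add, H0_res, H0_res, map_add, he _ _ _ ((Y.basicOpen_le f).trans hV₀),
      he _ _ _ ((Y.basicOpen_le g).trans hV₀)]
    simp
  · refine ⟨0, 0, ?_⟩
    rw [map_zero, map_zero, add_zero]
    refine ih p (by omega) _ ?_ hle b
    rw [← Scheme.basicOpen_mul]
    exact hV.basicOpen _

include he in
/-- A class which vanishes on the members of a finite cover by basic open sets vanishes: split off
the first member, and cover the rest `D(f')`, `f' = ∑_{j > 0} hⱼ gⱼ`, by the others. -/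
lemma eq_zero_of_sum_eq_one {p : ℕ}
    (ih : ∀ q < p, ∀ V : Y.Opens, IsAffineOpen V → V ≤ V₀ → ∀ a : HU F (q + 1) V, a = 0)
    (r : ℕ) : ∀ {V : Y.Opens} (_ : IsAffineOpen V) (_ : V ≤ V₀) (h g : Fin r → Γ(Y, V))
      (_ : ∑ j, h j * g j = 1) (a : HU F (p + 1) V)
      (_ : ∀ j, res F (p + 1) (Y.basicOpen_le (g j)) a = 0), a = 0 := by
  induction r with
  | zero =>
    intro V hV hV₀ h g hg a ha
    have : V = ⊥ := by
      have h1 : Y.basicOpen (1 : Γ(Y, V)) = V := Scheme.basicOpen_of_isUnit _ isUnit_one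
      rw [← hg] at h1
      simpa using h1.symm
    exact eq_zero_of_res_eq this (HU_bot _)
  | succ r ihr =>
    intro V hV hV₀ h g hg a ha
    rw [Fin.sum_univ_succ] at hg
    refine eq_zero_of_add_eq_one e he ih hV hV₀ hg a ?_ ?_
    · have hle : Y.basicOpen (h 0 * g 0) ≤ Y.basicOpen (g 0) := by
        rw [Scheme.basicOpen_mul]; exact inf_le_right
      rw [← res_res hle (Y.basicOpen_le (g 0)), ha 0, map_zero]
    · set f' := ∑ j : Fin r, h j.succ * g j.succ with hf'
      let ρ := (Y.presheaf.map (homOfLE (Y.basicOpen_le f')).op).hom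
      have hu : IsUnit (ρ f') := RingedSpace.isUnit_res_basicOpen _ f'
      obtain ⟨u, hu⟩ := hu
      refine ihr (hV.basicOpen f') ((Y.basicOpen_le f').trans hV₀)
        (fun j ↦ (↑u⁻¹ : Γ(Y, Y.basicOpen f')) * ρ (h j.succ)) (fun j ↦ ρ (g j.succ)) ?_ _ ?_
      · simp_rw [mul_assoc, ← Finset.mul_sum, ← map_mul, ← map_sum, ← hf', ← hu, Units.inv_mul]
      · intro j
        have hle : Y.basicOpen (ρ (g j.succ)) ≤ Y.basicOpen (g j.succ) := by
          refine (Scheme.basicOpen_res _ _ (homOfLE (Y.basicOpen_le f')).op).le.trans inf_le_right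
        rw [res_res, ← res_res hle (Y.basicOpen_le (g j.succ)), ha j.succ, map_zero]

include he in
/-- Serre's vanishing theorem on affine open sets, for a sheaf which is isomorphic to the structure
sheaf on `V₀`. A class of positive degree vanishes on the members of a finite cover by basic open
sets; by Mayer–Vietoris and induction on the number of basic open sets it vanishes. -/
theorem eq_zero_of_isAffineOpen (p : ℕ) : ∀ V : Y.Opens, IsAffineOpen V → V ≤ V₀ →
    ∀ a : HU F (p + 1) V, a = 0 := by
  induction p using Nat.strong_induction_on with
  | _ p ih =>
    intro V hV hV₀ a
    let S : Set Γ(Y, V) := {g | res F (p + 1) (Y.basicOpen_le g) a = 0}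
    have hS : Ideal.span S = ⊤ := by
      rw [← hV.iSup_basicOpen_eq_self_iff]
      refine le_antisymm (iSup_le fun g ↦ Y.basicOpen_le g.1) fun x hx ↦ ?_
      obtain ⟨W, hW, hxW, haW⟩ := exists_res_eq_zero p F a x hx
      obtain ⟨g, hgW, hxg⟩ := hV.exists_basicOpen_le (V := W) ⟨x, hxW⟩ hx
      refine Opens.mem_iSup.2 ⟨⟨g, ?_⟩, hxg⟩
      change res F (p + 1) (Y.basicOpen_le g) a = 0
      rw [← res_res hgW hW, haW, map_zero]
    have h1 : (1 : Γ(Y, V)) ∈ Ideal.span S := hS ▸ Submodule.mem_top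
    rw [Ideal.span, Submodule.mem_span_set'] at h1
    obtain ⟨r, h, g, hsum⟩ := h1
    exact eq_zero_of_sum_eq_one e he ih r hV hV₀ h (fun j ↦ (g j).1) hsum a fun j ↦ (g j).2

end Affine

end OpenCohomology

/-! ### Regular functions on projective space as rational functions -/

namespace ProjSp

variable {n : ℕ}

/-- The homogeneous coordinate ring `ℂ[x₀, …, xₙ]`. -/
abbrev CoordRing (n : ℕ) := MvPolynomial (Fin (n + 1)) ℂ

/-- The field of rational functions `ℂ(x₀, …, xₙ)`. -/
abbrev RatField (n : ℕ) := FractionRing (CoordRing n)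

instance isPrime_asHomogeneousIdeal (x : ProjSp n) : x.asHomogeneousIdeal.toIdeal.IsPrime :=
  x.isPrime

/-- The embedding of the homogeneous local ring at a point into `ℂ(x₀, …, xₙ)`. -/
def localToRatField (x : ProjSp n) :
    HomogeneousLocalization.AtPrime (grading n) x.asHomogeneousIdeal.toIdeal →+* RatField n :=
  (IsLocalization.lift (M := x.asHomogeneousIdeal.toIdeal.primeCompl)
    (S := Localization.AtPrime x.asHomogeneousIdeal.toIdeal)
    (g := algebraMap (CoordRing n) (RatField n)) (by
      intro y
      refine IsUnit.mk0 _ ?_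
      rw [Ne, FaithfulSMul.algebraMap_eq_zero_iff]
      rintro h
      exact y.2 (h ▸ zero_mem _))).comp
    (algebraMap _ (Localization.AtPrime x.asHomogeneousIdeal.toIdeal))

lemma ne_zero_of_notMem {x : ProjSp n} {b : CoordRing n} (hb : b ∉ x.asHomogeneousIdeal) :
    algebraMap (CoordRing n) (RatField n) b ≠ 0 := by
  rw [Ne, FaithfulSMul.algebraMap_eq_zero_iff]
  rintro rfl
  exact hb (zero_mem _)

lemma localToRatField_mk (x : ProjSp n) (d : ℕ) (a b : grading n d)
    (hb : b.1 ∉ x.asHomogeneousIdeal) :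
    localToRatField x (.mk ⟨d, a, b, hb⟩) =
      algebraMap _ (RatField n) a.1 / algebraMap _ (RatField n) b.1 := by
  rw [localToRatField, RingHom.comp_apply, HomogeneousLocalization.algebraMap_apply,
    HomogeneousLocalization.val_mk, Localization.mk_eq_mk', IsLocalization.lift_mk'_spec]
  simp only
  rw [mul_div_cancel₀]
  exact ne_zero_of_notMem hb

lemma localToRatField_injective (x : ProjSp n) : Function.Injective (localToRatField x) := by
  refine (injective_iff_map_eq_zero _).2 fun q hq ↦ ?_
  obtain ⟨⟨d, a, b, hb⟩, rfl⟩ := HomogeneousLocalization.mk_surjective q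
  replace hq := (localToRatField_mk x d a b hb).symm.trans hq
  rw [div_eq_zero_iff, FaithfulSMul.algebraMap_eq_zero_iff] at hq
  rcases hq with h | h
  · have : a = 0 := Subtype.ext h
    subst this
    exact HomogeneousLocalization.mk_eq_zero_of_num _ rfl
  · exact absurd h (ne_zero_of_notMem hb)

/-- The value at `x ∈ U` of a regular function on `U`, as a rational function on affine space. -/
def ev {U : (ProjSp n).Opens} (x : ProjSp n) (hx : x ∈ U) : Γ(ProjSp n, U) →+* RatField n :=
  (localToRatField x).comp
    { toFun := fun s ↦ s.1 ⟨x, hx⟩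
      map_one' := rfl
      map_mul' := fun _ _ ↦ rfl
      map_zero' := rfl
      map_add' := fun _ _ ↦ rfl }

lemma ev_apply {U : (ProjSp n).Opens} (x : ProjSp n) (hx : x ∈ U) (s : Γ(ProjSp n, U)) :
    ev x hx s = localToRatField x (s.1 ⟨x, hx⟩) := rfl

lemma ev_map {U V : (ProjSp n).Opens} (h : V ≤ U) (x : ProjSp n) (hx : x ∈ V)
    (s : Γ(ProjSp n, U)) :
    ev x hx ((ProjSp n).presheaf.map (homOfLE h).op s) = ev x (h hx) s := rfl

lemma ev_ext {U : (ProjSp n).Opens} {s t : Γ(ProjSp n, U)}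
    (h : ∀ x (hx : x ∈ U), ev x hx s = ev x hx t) : s = t :=
  Subtype.ext (funext fun x ↦ localToRatField_injective _ (h x.1 x.2))

/-- A function on an open set with values in `ℂ(x₀, …, xₙ)` which is locally of the form `a / b`
with `a`, `b` homogeneous, `deg a - deg b = k` and `b` without zeros. These functions are the
sections of `𝒪(k)`. The values outside `U` do not matter. -/
def IsSec (k : ℤ) (U : (ProjSp n).Opens) (σ : ProjSp n → RatField n) : Prop :=
  ∀ x ∈ U, ∃ (V : (ProjSp n).Opens) (d e : ℕ) (a b : CoordRing n), V ≤ U ∧ x ∈ V ∧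
    a.IsHomogeneous d ∧ b.IsHomogeneous e ∧ (d : ℤ) = e + k ∧
    ∀ y ∈ V, b ∉ y.asHomogeneousIdeal ∧
      σ y = algebraMap _ (RatField n) a / algebraMap _ (RatField n) b

lemma isSec_ev {U : (ProjSp n).Opens} (s : Γ(ProjSp n, U)) {σ : ProjSp n → RatField n}
    (hσ : ∀ x (hx : x ∈ U), σ x = ev x hx s) : IsSec 0 U σ := by
  intro x hx
  obtain ⟨V, hxV, i, d, a, b, hb, h⟩ := s.2 ⟨x, hx⟩
  refine ⟨V, d, d, a, b, i.le, hxV, a.2, b.2, by simp, fun y hy ↦ ⟨hb ⟨y, hy⟩, ?_⟩⟩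
  rw [hσ y (i.le hy), ev_apply]
  refine (congrArg (localToRatField y) (h ⟨y, hy⟩)).trans ?_
  exact localToRatField_mk _ _ _ _ _

/-- The functions of weight zero are the regular functions. -/
lemma exists_ev_eq {U : (ProjSp n).Opens} {σ : ProjSp n → RatField n} (h : IsSec 0 U σ) :
    ∃ s : Γ(ProjSp n, U), ∀ x (hx : x ∈ U), ev x hx s = σ x := by
  have key (x : ProjSp n) (hx : x ∈ U) : ∃ q, localToRatField x q = σ x := by
    obtain ⟨V, d, e, a, b, hV, hxV, ha, hb, hde, hy⟩ := h x hx
    obtain rfl : d = e := by omega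
    exact ⟨.mk ⟨d, ⟨a, ha⟩, ⟨b, hb⟩, (hy x hxV).1⟩,
      (localToRatField_mk _ _ _ _ _).trans (hy x hxV).2.symm⟩
  choose q hq using key
  have hloc : (ProjectiveSpectrum.StructureSheaf.isLocallyFraction (grading n)).pred
      (fun x : U ↦ q x.1 x.2) := by
    intro x
    obtain ⟨V, d, e, a, b, hV, hxV, ha, hb, hde, hy⟩ := h x.1 x.2
    obtain rfl : d = e := by omega
    refine ⟨V, hxV, homOfLE hV, d, ⟨a, ha⟩, ⟨b, hb⟩, fun y ↦ (hy y.1 y.2).1, fun y ↦ ?_⟩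
    refine localToRatField_injective y.1 ((hq y.1 (hV y.2)).trans ((hy y.1 y.2).2.trans ?_))
    exact (localToRatField_mk y.1 d ⟨a, ha⟩ ⟨b, hb⟩ (hy y.1 y.2).1).symm
  let s : (ProjectiveSpectrum.Proj.structureSheaf (grading n)).1.obj (op U) := ⟨_, hloc⟩
  exact ⟨s, fun x hx ↦ hq x hx⟩

/-- The coordinate `xᵢ` as a rational function. -/
def coord (i : Fin (n + 1)) : RatField n := algebraMap (CoordRing n) _ (MvPolynomial.X i)

lemma coord_ne_zero (i : Fin (n + 1)) : coord i ≠ 0 := by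
  rw [coord, Ne, FaithfulSMul.algebraMap_eq_zero_iff]
  exact MvPolynomial.X_ne_zero i

lemma exists_mem_chart (x : ProjSp n) : ∃ i, x ∈ chart i := by
  have h := Proj.iSup_basicOpen_eq_top' (grading n) (fun i : Fin (n + 1) ↦ MvPolynomial.X i)
    (fun i ↦ ⟨1, MvPolynomial.isHomogeneous_X ℂ i⟩) (by
      refine top_le_iff.1 fun f _ ↦ ?_
      have hf : f ∈ Algebra.adjoin ℂ (Set.range (MvPolynomial.X (R := ℂ) (σ := Fin (n + 1)))) :=
        MvPolynomial.adjoin_range_X (R := ℂ) (σ := Fin (n + 1)) ▸ Algebra.mem_top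
      induction hf using Algebra.adjoin_induction with
      | mem x hx => exact Algebra.subset_adjoin hx
      | algebraMap r =>
        exact (Algebra.adjoin (grading n 0) _).algebraMap_mem
          ⟨MvPolynomial.C r, MvPolynomial.isHomogeneous_C _ _⟩
      | add f g _ _ hf hg => exact add_mem (hf trivial) (hg trivial)
      | mul f g _ _ hf hg => exact mul_mem (hf trivial) (hg trivial))
  have hx : x ∈ (⊤ : (ProjSp n).Opens) := trivial
  rw [← h] at hx
  exact Opens.mem_iSup.1 hx

/-- The regular function `a / xᵢ ^ d` on `D₊(xᵢ)`, for a form `a` of degree `d`. -/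
def formRatio (i : Fin (n + 1)) {d : ℕ} {a : CoordRing n} (ha : a.IsHomogeneous d) :
    Γ(ProjSp n, chart i) :=
  (Proj.awayToSection (grading n) (MvPolynomial.X i)).hom
    (HomogeneousLocalization.Away.mk (grading n) (d := 1)
      (MvPolynomial.isHomogeneous_X ℂ i) d a (by simpa using ha))

lemma ev_formRatio {i : Fin (n + 1)} {d : ℕ} {a : CoordRing n} (ha : a.IsHomogeneous d)
    (x : ProjSp n) (hx : x ∈ chart i) :
    ev x hx (formRatio i ha) = algebraMap _ _ a / coord i ^ d := by
  rw [coord, ← map_pow]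
  exact localToRatField_mk x (d • 1) ⟨a, by simpa using ha⟩
    ⟨MvPolynomial.X i ^ d, SetLike.pow_mem_graded d (MvPolynomial.isHomogeneous_X ℂ i)⟩
    fun h ↦ hx (x.isPrime.mem_of_pow_mem _ h)

lemma ev_ratio (i j : Fin (n + 1)) (x : ProjSp n) (hx : x ∈ chart i) :
    ev x hx (ratio i j) = coord j / coord i := by
  refine (ev_formRatio (MvPolynomial.isHomogeneous_X ℂ j) x hx).trans ?_
  rw [pow_one]
  rfl

lemma ev_transition (k : ℤ) (U : (ProjSp n).Opens) (i j : Fin (n + 1)) (x : ProjSp n)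
    (hx : x ∈ U ⊓ chart i ⊓ chart j) :
    ev x hx (transition k U i j) = (coord j / coord i) ^ k := by
  rw [transition, map_mul, map_pow, map_pow, ev_map, ev_map, ev_ratio, ev_ratio]
  obtain ⟨m, rfl | rfl⟩ := k.eq_nat_or_neg
  · simp
  · simp [← inv_pow]

end ProjSp

/-! ### Sections of `𝒪(k)` as rational functions -/

namespace ProjSp

variable {n : ℕ}

open OpenCohomology

section IsSec

variable {k l : ℤ} {U V : (ProjSp n).Opens} {σ τ : ProjSp n → RatField n}

lemma IsSec.mono (h : IsSec k U σ) (hV : V ≤ U) : IsSec k V σ := by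
  intro x hx
  obtain ⟨W, d, e, a, b, hW, hxW, ha, hb, hde, hy⟩ := h x (hV hx)
  exact ⟨W ⊓ V, d, e, a, b, inf_le_right, ⟨hxW, hx⟩, ha, hb, hde, fun y hyV ↦ hy y hyV.1⟩

lemma IsSec.congr (h : IsSec k U σ) (hστ : ∀ x ∈ U, τ x = σ x) : IsSec k U τ := by
  intro x hx
  obtain ⟨W, d, e, a, b, hW, hxW, ha, hb, hde, hy⟩ := h x hx
  exact ⟨W, d, e, a, b, hW, hxW, ha, hb, hde, fun y hyV ↦
    ⟨(hy y hyV).1, (hστ y (hW hyV)).trans (hy y hyV).2⟩⟩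

lemma isSec_of_forall (h : ∀ x ∈ U, ∃ V, x ∈ V ∧ IsSec k V σ) : IsSec k U σ := by
  intro x hx
  obtain ⟨V, hxV, hV⟩ := h x hx
  obtain ⟨W, d, e, a, b, hW, hxW, ha, hb, hde, hy⟩ := hV x hxV
  exact ⟨W ⊓ U, d, e, a, b, inf_le_right, ⟨hxW, hx⟩, ha, hb, hde, fun y hyV ↦ hy y hyV.1⟩

lemma IsSec.mul (h : IsSec k U σ) (h' : IsSec l U τ) : IsSec (k + l) U (σ * τ) := by
  intro x hx
  obtain ⟨W, d, e, a, b, hW, hxW, ha, hb, hde, hy⟩ := h x hx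
  obtain ⟨W', d', e', a', b', hW', hxW', ha', hb', hde', hy'⟩ := h' x hx
  refine ⟨W ⊓ W', d + d', e + e', a * a', b * b', inf_le_left.trans hW, ⟨hxW, hxW'⟩,
    ha.mul ha', hb.mul hb', by push_cast; omega, fun y hyV ↦ ⟨fun hmem ↦ ?_, ?_⟩⟩
  · exact (y.isPrime.mem_or_mem hmem).elim (hy y hyV.1).1 (hy' y hyV.2).1
  · rw [Pi.mul_apply, (hy y hyV.1).2, (hy' y hyV.2).2, map_mul, map_mul, div_mul_div_comm]

lemma one_notMem_point (y : ProjSp n) : (1 : CoordRing n) ∉ y.asHomogeneousIdeal :=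
  fun h ↦ y.isPrime.ne_top ((Ideal.eq_top_iff_one _).2 h)

lemma isSec_form {d : ℕ} {a : CoordRing n} (ha : a.IsHomogeneous d) :
    IsSec d U fun _ ↦ algebraMap _ _ a := by
  intro x hx
  exact ⟨U, d, 0, a, 1, le_rfl, hx, ha, MvPolynomial.isHomogeneous_one _ _, by simp,
    fun y _ ↦ ⟨one_notMem_point y, by simp⟩⟩

lemma isSec_coord_zpow {j : Fin (n + 1)} (hU : U ≤ chart j) (k : ℤ) :
    IsSec k U fun _ ↦ coord j ^ k := by
  intro x hx
  have hX (m : ℕ) : ((MvPolynomial.X j : CoordRing n) ^ m).IsHomogeneous m := by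
    simpa using (MvPolynomial.isHomogeneous_X ℂ j).pow m
  obtain ⟨m, rfl | rfl⟩ := k.eq_nat_or_neg
  · exact (isSec_form (hX m)).congr (fun x _ ↦ by simp [coord]) x hx
  · exact ⟨U, 0, m, 1, MvPolynomial.X j ^ m, le_rfl, hx, MvPolynomial.isHomogeneous_one _ _,
      hX m, by simp, fun y hy ↦ ⟨fun h ↦ hU hy (y.isPrime.mem_of_pow_mem _ h), by simp [coord]⟩⟩

end IsSec

section Values

variable {X : Scheme.{0}} {ι : X ⟶ ProjSp n} {k : ℤ} {U V : (ProjSp n).Opens}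

open Classical in
/-- The value at `x` of a section of `ℐ_X(k)`: the rational function `xⱼ ^ k * sⱼ`, for any chart
`D₊(xⱼ)` containing `x`. Outside the domain the value is `0`. -/
def tval (s : twistedIdealSections ι k U) (x : ProjSp n) : RatField n :=
  if hx : x ∈ U then
    coord (exists_mem_chart x).choose ^ k *
      ev x (Opens.mem_inf.2 ⟨hx, (exists_mem_chart x).choose_spec⟩) (s.1 (exists_mem_chart x).choose)
  else 0

lemma tval_eq (s : twistedIdealSections ι k U) {x : ProjSp n} {j : Fin (n + 1)}
    (hx : x ∈ U ⊓ chart j) : tval s x = coord j ^ k * ev x hx (s.1 j) := by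
  refine (dif_pos hx.1).trans ?_
  have h1 := exists_mem_chart x
  have hx' : x ∈ U ⊓ chart h1.choose ⊓ chart j := ⟨⟨hx.1, h1.choose_spec⟩, hx.2⟩
  have h := congrArg (ev x hx') (s.2.2 h1.choose j)
  rw [map_mul, ev_transition, ev_map, ev_map] at h
  rw [h, div_zpow, ← mul_assoc, mul_div_cancel₀]
  exact zpow_ne_zero _ (coord_ne_zero _)

lemma ev_eq_tval (s : twistedIdealSections ι k U) {x : ProjSp n} {j : Fin (n + 1)}
    (hx : x ∈ U ⊓ chart j) : ev x hx (s.1 j) = coord j ^ (-k) * tval s x := by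
  rw [tval_eq s hx, ← mul_assoc, ← zpow_add₀ (coord_ne_zero j), neg_add_cancel, zpow_zero, one_mul]

lemma tval_ext {s t : twistedIdealSections ι k U} (h : ∀ x ∈ U, tval s x = tval t x) : s = t := by
  refine Subtype.ext (funext fun j ↦ ev_ext fun x hx ↦ ?_)
  rw [ev_eq_tval, ev_eq_tval, h x hx.1]

lemma tval_of_notMem (s : twistedIdealSections ι k U) {x : ProjSp n} (hx : x ∉ U) :
    tval s x = 0 := dif_neg hx

lemma tval_add (s t : twistedIdealSections ι k U) (x : ProjSp n) :
    tval (s + t) x = tval s x + tval t x := by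
  by_cases hx : x ∈ U
  · obtain ⟨j, hj⟩ := exists_mem_chart x
    have hx' : x ∈ U ⊓ chart j := ⟨hx, hj⟩
    rw [tval_eq _ hx', tval_eq _ hx', tval_eq _ hx', ← mul_add, ← map_add]
    rfl
  · simp [tval_of_notMem _ hx]

lemma tval_zero (x : ProjSp n) : tval (0 : twistedIdealSections ι k U) x = 0 := by
  simpa using tval_add (0 : twistedIdealSections ι k U) 0 x

lemma tval_restrict (h : V ≤ U) (s : twistedIdealSections ι k U) {x : ProjSp n} (hx : x ∈ V) :
    tval (twistedIdealRestrict ι k h s) x = tval s x := by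
  obtain ⟨j, hj⟩ := exists_mem_chart x
  rw [tval_eq _ (show x ∈ V ⊓ chart j from ⟨hx, hj⟩),
    tval_eq s (show x ∈ U ⊓ chart j from ⟨h hx, hj⟩)]
  rfl

lemma isSec_tval (s : twistedIdealSections ι k U) : IsSec k U (tval s) := by
  refine isSec_of_forall fun x hx ↦ ?_
  obtain ⟨j, hj⟩ := exists_mem_chart x
  refine ⟨U ⊓ chart j, ⟨hx, hj⟩, ?_⟩
  have h := (isSec_coord_zpow (U := U ⊓ chart j) inf_le_right k).mul
    (isSec_ev (s.1 j) (σ := fun x ↦ coord j ^ (-k) * tval s x) fun x hx ↦ (ev_eq_tval s hx).symm)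
  rw [add_zero] at h
  refine h.congr fun y hy ↦ ?_
  rw [Pi.mul_apply, ← mul_assoc, ← zpow_add₀ (coord_ne_zero j), add_neg_cancel, zpow_zero, one_mul]

/-- A function with the local form required by `IsSec` is the family of values of a section of
`ℐ_X(k)`, provided that its components in the charts vanish on `X`. -/
lemma exists_tval_eq {σ : ProjSp n → RatField n} (h : IsSec k U σ)
    (hι : ∀ (j : Fin (n + 1)) (s : Γ(ProjSp n, U ⊓ chart j)),
      (∀ x hx, ev x hx s = coord j ^ (-k) * σ x) → ι.app (U ⊓ chart j) s = 0) :
    ∃ s : twistedIdealSections ι k U, ∀ x ∈ U, tval s x = σ x := by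
  have key (j : Fin (n + 1)) : ∃ s : Γ(ProjSp n, U ⊓ chart j),
      ∀ x hx, ev x hx s = coord j ^ (-k) * σ x := by
    refine exists_ev_eq ?_
    have := (isSec_coord_zpow (U := U ⊓ chart j) inf_le_right (-k)).mul (h.mono inf_le_left)
    rw [neg_add_cancel] at this
    exact this
  choose s hs using key
  refine ⟨⟨s, fun j ↦ hι j _ (hs j), fun i j ↦ ev_ext fun x hx ↦ ?_⟩, fun x hx ↦ ?_⟩
  · rw [map_mul, ev_map, ev_map, hs, hs, ev_transition, div_zpow, zpow_neg, zpow_neg]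
    have h1 := zpow_ne_zero k (coord_ne_zero i)
    have h2 := zpow_ne_zero k (coord_ne_zero j)
    field_simp
  · obtain ⟨j, hj⟩ := exists_mem_chart x
    rw [tval_eq _ (show x ∈ U ⊓ chart j from ⟨hx, hj⟩)]
    dsimp only
    rw [hs, ← mul_assoc, ← zpow_add₀ (coord_ne_zero j), add_neg_cancel, zpow_zero, one_mul]

end Values

/-- The sheaf `𝒪(k)`, defined as the twisted ideal sheaf of the empty subscheme: in that case the
condition on the ideal is void. -/
def O (n : ℕ) (k : ℤ) : AbSheaf (ProjSp n) := twistedIdealSheaf (Scheme.emptyTo (ProjSp n)) k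

/-- The sections of `𝒪(k)`. -/
abbrev OSec (k : ℤ) (U : (ProjSp n).Opens) := twistedIdealSections (Scheme.emptyTo (ProjSp n)) k U

lemma exists_OSec {k : ℤ} {U : (ProjSp n).Opens} {σ : ProjSp n → RatField n} (h : IsSec k U σ) :
    ∃ s : OSec k U, ∀ x ∈ U, tval s x = σ x := by
  refine exists_tval_eq h fun j s _ ↦ ?_
  refine (∅ : Scheme.{0}).sheaf.eq_of_locally_eq' (ι := PEmpty.{1}) (fun i ↦ i.elim) _
    (fun i ↦ i.elim) (fun x _ ↦ isEmptyElim x) _ _ fun i ↦ i.elim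

/-- The section of `𝒪(k)` with prescribed values. -/
def mkOSec {k : ℤ} {U : (ProjSp n).Opens} (σ : ProjSp n → RatField n) (h : IsSec k U σ) :
    OSec k U := (exists_OSec h).choose

lemma tval_mkOSec {k : ℤ} {U : (ProjSp n).Opens} {σ : ProjSp n → RatField n} (h : IsSec k U σ)
    {x : ProjSp n} (hx : x ∈ U) : tval (mkOSec σ h) x = σ x := (exists_OSec h).choose_spec x hx

/-- The homomorphism of sheaves `𝒪(k) ⟶ 𝒪(l)` induced by an additive endomorphism of
`ℂ(x₀, …, xₙ)` which maps sections to sections. -/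
def mapO {k l : ℤ} (φ : RatField n →+ RatField n)
    (hφ : ∀ (U : (ProjSp n).Opens) (σ : ProjSp n → RatField n), IsSec k U σ → IsSec l U (φ ∘ σ)) :
    O n k ⟶ O n l := ObjectProperty.homMk
  { app := fun U ↦ AddCommGrpCat.ofHom
      { toFun := fun s : OSec k U.unop ↦ mkOSec (φ ∘ tval s) (hφ _ _ (isSec_tval s))
        map_zero' := tval_ext fun x hx ↦ by
          rw [tval_mkOSec _ hx]
          simp [tval_zero]
        map_add' := fun s t ↦ tval_ext fun x hx ↦ by
          rw [tval_mkOSec _ hx, tval_add, tval_mkOSec _ hx, tval_mkOSec _ hx]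
          simp [tval_add] }
    naturality := fun U V f ↦ by
      refine AddCommGrpCat.hom_ext (AddMonoidHom.ext fun (s : OSec k U.unop) ↦
        tval_ext fun x hx ↦ ?_)
      refine (tval_mkOSec (hφ _ _ (isSec_tval (twistedIdealRestrict _ k f.unop.le s))) hx).trans ?_
      refine Eq.trans ?_ (tval_restrict f.unop.le
        (mkOSec (φ ∘ tval s) (hφ _ _ (isSec_tval s))) hx).symm
      rw [tval_mkOSec _ (f.unop.le hx), Function.comp_apply, Function.comp_apply,
        tval_restrict f.unop.le s hx] }

lemma tval_mapO {k l : ℤ} (φ : RatField n →+ RatField n)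
    (hφ : ∀ (U : (ProjSp n).Opens) (σ : ProjSp n → RatField n), IsSec k U σ → IsSec l U (φ ∘ σ))
    {U : (ProjSp n).Opens} (s : OSec k U) {x : ProjSp n} (hx : x ∈ U) :
    tval ((mapO φ hφ).hom.app (op U) s : OSec l U) x = φ (tval s x) :=
  tval_mkOSec (hφ _ _ (isSec_tval s)) hx

lemma hom_O_ext {k l : ℤ} {f g : O n k ⟶ O n l}
    (h : ∀ (U : (ProjSp n).Opens) (s : OSec k U), ∀ x ∈ U,
      tval (f.hom.app (op U) s : OSec l U) x = tval (g.hom.app (op U) s : OSec l U) x) : f = g := by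
  refine ObjectProperty.hom_ext _ (NatTrans.ext (funext fun U ↦ AddCommGrpCat.hom_ext
    (AddMonoidHom.ext fun s ↦ ?_)))
  exact tval_ext (h U.unop s)

end ProjSp

/-! ### Commuting operators with negative integral eigenvalues -/

section CommutativeAlgebra

/-- If `a` and `b` are roots modulo `I` of products of factors `X + j`, then so is `a + b`. -/
lemma exists_prod_add_mem {R : Type*} [CommRing R] (a b : R) (c d : ℕ) (B A : List ℕ) :
    ∀ I : Ideal R, (A.map fun j ↦ a + ((j + c : ℕ) : R)).prod ∈ I →
      (B.map fun j ↦ b + ((j + d : ℕ) : R)).prod ∈ I →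
      ∃ C : List ℕ, (C.map fun j ↦ a + b + ((j + (c + d) : ℕ) : R)).prod ∈ I := by
  induction A with
  | nil => exact fun I hA _ ↦ ⟨[], hA⟩
  | cons i A ih =>
    intro I hA hB
    set x := a + ((i + c : ℕ) : R) with hx
    -- split off the factor `x`, and apply induction to the ideal quotient `I : x`
    obtain ⟨C, hC⟩ := ih (Submodule.comap (LinearMap.mulLeft R x) I) (by simpa [hx] using hA)
      (Ideal.mul_mem_left I x hB)
    refine ⟨C ++ B.map (· + i), ?_⟩
    -- modulo `x`, the sum `a + b + (j + i) + (c + d)` is `b + j + d`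
    have key : ∃ q, ((B.map (· + i)).map fun j ↦ a + b + ((j + (c + d) : ℕ) : R)).prod =
        (B.map fun j ↦ b + ((j + d : ℕ) : R)).prod + x * q := by
      clear hB ih
      induction B with
      | nil => exact ⟨0, by simp⟩
      | cons j B ihB =>
        obtain ⟨q, hq⟩ := ihB
        refine ⟨(B.map fun j ↦ b + ((j + d : ℕ) : R)).prod +
          (x + (b + ((j + d : ℕ) : R))) * q, ?_⟩
        simp only [List.map_cons, List.prod_cons, hq, hx]
        push_cast
        ring
    obtain ⟨q, hq⟩ := key
    rw [List.map_append, List.prod_append, hq, mul_add]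
    refine add_mem (Ideal.mul_mem_left _ _ hB) ?_
    have : x * (C.map fun j ↦ a + b + ((j + (c + d) : ℕ) : R)).prod ∈ I := hC
    rw [mul_left_comm, ← mul_assoc]
    exact Ideal.mul_mem_right _ _ this

lemma exists_prod_sum_mem {R : Type*} [CommRing R] (I : Ideal R) {m : ℕ} (t : Fin m → R)
    (h : ∀ i, ∃ A : List ℕ, (A.map fun j ↦ t i + ((j + 1 : ℕ) : R)).prod ∈ I) :
    ∃ C : List ℕ, (C.map fun j ↦ ∑ i, t i + ((j + m : ℕ) : R)).prod ∈ I := by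
  induction m with
  | zero => exact ⟨[0], by simp⟩
  | succ m ih =>
    obtain ⟨A, hA⟩ := ih (fun i ↦ t i.castSucc) fun i ↦ h i.castSucc
    obtain ⟨B, hB⟩ := h (Fin.last m)
    obtain ⟨C, hC⟩ := exists_prod_add_mem _ _ m 1 B A I hA hB
    exact ⟨C, by simpa only [Fin.sum_univ_castSucc] using hC⟩

/-- Commuting endomorphisms `t₁, …, t_m` of an abelian group whose sum is the integer `k > -m` have
no common generalized eigenvector with negative integral eigenvalues, up to torsion. Indeed the
eigenvalues of the sum are then `≤ -m`. -/
lemma exists_nsmul_eq_zero {H : Type*} [AddCommGroup H] {m : ℕ} (t : Fin m → AddMonoid.End H)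
    (hcomm : ∀ i j, t i * t j = t j * t i) {k : ℤ} (hk : -(m : ℤ) < k)
    (hsum : ∀ α, ∑ i, t i α = k • α) (α : H)
    (h : ∀ i, ∃ A : List ℕ, (A.map fun j ↦ t i + ((j + 1 : ℕ) : AddMonoid.End H)).prod α = 0) :
    ∃ N : ℕ, N ≠ 0 ∧ N • α = 0 := by
  -- work modulo the annihilator of `α` in the commutative ring generated by the `tᵢ`
  let R := Algebra.adjoin ℤ (Set.range t)
  have hR : IsMulCommutative R := Algebra.isMulCommutative_adjoin ℤ (by
    rintro _ ⟨i, rfl⟩ _ ⟨j, rfl⟩; exact hcomm i j)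
  let _ : CommRing R := { (inferInstance : Ring R) with mul_comm := hR.is_comm.comm }
  let I : Ideal R :=
    { carrier := {r | r.1 α = 0}
      add_mem' := fun {a b} ha hb ↦ by
        change (a.1 + b.1) α = 0
        exact (congrArg₂ (· + ·) ha hb).trans (add_zero _)
      zero_mem' := rfl
      smul_mem' := fun c x hx ↦ by
        change c.1 (x.1 α) = 0
        rw [show x.1 α = 0 from hx, map_zero] }
  let t' (i : Fin m) : R := ⟨t i, Algebra.subset_adjoin ⟨i, rfl⟩⟩
  have hval (A : List ℕ) (s : R) (c : ℕ) : ((A.map fun j ↦ s + ((j + c : ℕ) : R)).prod).1 =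
      (A.map fun j ↦ s.1 + ((j + c : ℕ) : AddMonoid.End H)).prod := by
    induction A with
    | nil => rfl
    | cons i A ih =>
      rw [List.map_cons, List.prod_cons, List.map_cons, List.prod_cons, ← ih]
      rfl
  obtain ⟨C, hC⟩ := exists_prod_sum_mem I t' fun i ↦ by
    obtain ⟨A, hA⟩ := h i
    refine ⟨A, ?_⟩
    change ((A.map fun j ↦ t' i + ((j + 1 : ℕ) : R)).prod).1 α = 0
    rw [hval]
    exact hA
  replace hC : ((C.map fun j ↦ ∑ i, t' i + ((j + m : ℕ) : R)).prod).1 α = 0 := hC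
  rw [hval] at hC
  have hs : (∑ i, t' i).1 = ∑ i, t i := map_sum (Subalgebra.val R) t' Finset.univ
  rw [hs] at hC
  have key (C : List ℕ) : (C.map fun j ↦ ∑ i, t i + ((j + m : ℕ) : AddMonoid.End H)).prod α =
      (C.map fun j : ℕ ↦ (k + (j + m : ℕ)).toNat).prod • α := by
    induction C with
    | nil => simp
    | cons j C ih =>
      rw [List.map_cons, List.prod_cons, List.map_cons, List.prod_cons, AddMonoid.End.coe_mul,
        Function.comp_apply, ih, map_nsmul, mul_comm, mul_smul]
      congr 1
      have h1 : (∑ i, t i + ((j + m : ℕ) : AddMonoid.End H)) α =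
          (∑ i, t i : AddMonoid.End H) α + (j + m) • α := rfl
      have h2 : (∑ i, t i : AddMonoid.End H) α = ∑ i, t i α :=
        AddMonoidHom.finsetSum_apply _ _ _
      rw [h1, h2, hsum, ← natCast_zsmul, ← natCast_zsmul, ← add_smul,
        Int.toNat_of_nonneg (by push_cast; omega)]
  rw [key] at hC
  refine ⟨_, ?_, hC⟩
  rw [Ne, List.prod_eq_zero_iff, List.mem_map]
  rintro ⟨j, -, hj⟩
  push_cast at hj
  omega

end CommutativeAlgebra

/-! ### Differential operators on `𝒪(k)` -/

namespace ProjSp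
open OpenCohomology
variable {n : ℕ}

/-- The ring homomorphism `q ↦ q + ε ∂q/∂xᵢ` from `ℂ(x₀, …, xₙ)` to its dual numbers. -/
def taylorHom (i : Fin (n + 1)) : RatField n →+* TrivSqZeroExt (RatField n) (RatField n) :=
  let f : CoordRing n →+* TrivSqZeroExt (RatField n) (RatField n) :=
    { toFun := fun a ↦ TrivSqZeroExt.inl (algebraMap _ (RatField n) a) +
        TrivSqZeroExt.inr (algebraMap _ (RatField n) (MvPolynomial.pderiv i a))
      map_one' := by simp
      map_zero' := by simp
      map_add' := fun a b ↦ by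
        ext
        · simp
        · simp only [map_add, TrivSqZeroExt.snd_add, TrivSqZeroExt.snd_inl, TrivSqZeroExt.snd_inr]
          ring
      map_mul' := fun a b ↦ by
        ext
        · simp
        · simp only [Derivation.leibniz, smul_eq_mul, map_add, map_mul, TrivSqZeroExt.snd_add,
            TrivSqZeroExt.snd_inl, TrivSqZeroExt.snd_inr, TrivSqZeroExt.snd_mul,
            TrivSqZeroExt.fst_add, TrivSqZeroExt.fst_inl, TrivSqZeroExt.fst_inr]
          simp
          ring }
  IsLocalization.lift (M := nonZeroDivisors (CoordRing n)) (g := f) (by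
    intro y
    rw [TrivSqZeroExt.isUnit_iff_isUnit_fst]
    refine IsUnit.mk0 _ ?_
    simp [f])

lemma taylorHom_algebraMap (i : Fin (n + 1)) (a : CoordRing n) :
    taylorHom i (algebraMap _ _ a) = TrivSqZeroExt.inl (algebraMap _ (RatField n) a) +
        TrivSqZeroExt.inr (algebraMap _ (RatField n) (MvPolynomial.pderiv i a)) :=
  IsLocalization.lift_eq _ _

lemma fst_taylorHom (i : Fin (n + 1)) (q : RatField n) : (taylorHom i q).fst = q := by
  have : ((TrivSqZeroExt.fstHom (RatField n) (RatField n) (RatField n)).toRingHom.comp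
      (taylorHom i)) = RingHom.id _ := by
    refine IsLocalization.ringHom_ext (nonZeroDivisors (CoordRing n)) (RingHom.ext fun a ↦ ?_)
    simp [taylorHom_algebraMap]
  exact congr($this q)

/-- The partial derivative `∂/∂xᵢ` of rational functions. -/
def ratDeriv (i : Fin (n + 1)) : RatField n →+ RatField n where
  toFun q := (taylorHom i q).snd
  map_zero' := by simp
  map_add' := by simp

lemma ratDeriv_mul (i : Fin (n + 1)) (a b : RatField n) :
    ratDeriv i (a * b) = a * ratDeriv i b + b * ratDeriv i a := by
  change (taylorHom i (a * b)).snd = a * (taylorHom i b).snd + b * (taylorHom i a).snd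
  rw [map_mul, TrivSqZeroExt.snd_mul, fst_taylorHom, fst_taylorHom]
  simp [mul_comm]

lemma ratDeriv_algebraMap (i : Fin (n + 1)) (a : CoordRing n) :
    ratDeriv i (algebraMap _ _ a) = algebraMap _ _ (MvPolynomial.pderiv i a) := by
  change (taylorHom i _).snd = _
  rw [taylorHom_algebraMap, TrivSqZeroExt.snd_add, TrivSqZeroExt.snd_inl, TrivSqZeroExt.snd_inr,
    zero_add]

lemma ratDeriv_div (i : Fin (n + 1)) (a b : CoordRing n) (hb : b ≠ 0) :
    ratDeriv i (algebraMap _ _ a / algebraMap _ _ b) =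
      algebraMap _ _ (MvPolynomial.pderiv i a * b - a * MvPolynomial.pderiv i b) /
        algebraMap _ _ (b ^ 2) := by
  have hb' : algebraMap _ (RatField n) b ≠ 0 := by simpa using hb
  have h := ratDeriv_mul i (algebraMap _ (RatField n) a / algebraMap _ _ b) (algebraMap _ _ b)
  rw [div_mul_cancel₀ _ hb', ratDeriv_algebraMap, ratDeriv_algebraMap] at h
  rw [map_sub, map_mul, map_mul, map_pow, h]
  field_simp
  ring

/-- Partial derivatives commute: the commutator is a derivation which vanishes on polynomials. -/
lemma ratDeriv_comm (i j : Fin (n + 1)) (q : RatField n) :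
    ratDeriv i (ratDeriv j q) = ratDeriv j (ratDeriv i q) := by
  let D (q : RatField n) := ratDeriv i (ratDeriv j q) - ratDeriv j (ratDeriv i q)
  have hS (a : CoordRing n) : D (algebraMap _ (RatField n) a) = 0 := by
    simp only [D, ratDeriv_algebraMap]
    have h : ⁅(MvPolynomial.pderiv i : Derivation ℂ (CoordRing n) (CoordRing n)),
        (MvPolynomial.pderiv j : Derivation ℂ (CoordRing n) (CoordRing n))⁆ = 0 := by
      refine MvPolynomial.derivation_ext fun l ↦ ?_
      rw [Derivation.commutator_apply]
      classical
      simp [MvPolynomial.pderiv_X, Pi.single_apply, apply_ite]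
    rw [← map_sub, ← Derivation.commutator_apply, h, Derivation.zero_apply, map_zero]
  have hmul (q r : RatField n) : D (q * r) = q * D r + r * D q := by
    simp only [D, ratDeriv_mul, map_add]
    ring
  obtain ⟨a, b, hb, rfl⟩ := IsFractionRing.div_surjective (A := CoordRing n) q
  have hb' : algebraMap _ (RatField n) b ≠ 0 := by
    simpa using nonZeroDivisors.ne_zero hb
  have h := hmul (algebraMap _ (RatField n) a / algebraMap _ _ b) (algebraMap _ _ b)
  rw [div_mul_cancel₀ _ hb', hS, hS, mul_zero, zero_add] at h
  exact sub_eq_zero.1 ((mul_eq_zero.1 h.symm).resolve_left hb')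

section Operators

variable {k l : ℤ}

lemma IsSec.ratDeriv {U : (ProjSp n).Opens} {σ : ProjSp n → RatField n} (i : Fin (n + 1))
    (hl : k = l + 1) (h : IsSec k U σ) : IsSec l U (ratDeriv i ∘ σ) := by
  intro x hx
  obtain ⟨V, d, e, a, b, hV, hxV, ha, hb, hde, hy⟩ := h x hx
  obtain ⟨j, hj⟩ := exists_mem_chart x
  have hX {m : ℕ} {c : CoordRing n} (hc : c.IsHomogeneous m) :
      (MvPolynomial.X j * MvPolynomial.pderiv i c).IsHomogeneous m := by
    rcases m with _ | m
    · rw [← MvPolynomial.totalDegree_zero_iff_isHomogeneous,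
        MvPolynomial.totalDegree_eq_zero_iff_eq_C] at hc
      rw [hc, MvPolynomial.pderiv_C, mul_zero]
      exact MvPolynomial.isHomogeneous_zero _ _ _
    · have := (MvPolynomial.isHomogeneous_X ℂ j).mul (hc.pderiv (i := i))
      convert this using 1
      omega
  -- `∂a/∂xᵢ` need not have a natural degree when `a` is constant; the factor `xⱼ` repairs this
  refine ⟨V ⊓ chart j, d + e, 1 + (e + e),
    MvPolynomial.X j * MvPolynomial.pderiv i a * b - a * (MvPolynomial.X j *
      MvPolynomial.pderiv i b), MvPolynomial.X j * (b * b), inf_le_left.trans hV, ⟨hxV, hj⟩,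
    ((hX ha).mul hb).sub (ha.mul (hX hb)), (MvPolynomial.isHomogeneous_X ℂ j).mul (hb.mul hb),
    by push_cast; omega, fun y hyV ↦ ⟨fun hmem ↦ ?_, ?_⟩⟩
  · rcases y.isPrime.mem_or_mem hmem with h | h
    · exact hyV.2 h
    · exact (y.isPrime.mem_or_mem h).elim (hy y hyV.1).1 (hy y hyV.1).1
  · have hb0 : b ≠ 0 := by
      rintro rfl
      exact (hy y hyV.1).1 (zero_mem _)
    have hb' : algebraMap _ (RatField n) b ≠ 0 := by simpa using hb0
    have hXj := coord_ne_zero j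
    rw [coord] at hXj
    rw [Function.comp_apply, (hy y hyV.1).2, ratDeriv_div i a b hb0]
    simp only [map_sub, map_mul, map_pow]
    field_simp

/-- Multiplication by a form of degree `d`. -/
def mulO {d : ℕ} {a : CoordRing n} (ha : a.IsHomogeneous d) (hl : l = k + d) : O n k ⟶ O n l :=
  mapO (AddMonoidHom.mulLeft (algebraMap _ (RatField n) a)) fun _ _ h ↦ by
    have := (isSec_form ha).mul h
    rwa [add_comm, ← hl] at this

/-- The partial derivative `∂/∂xᵢ : 𝒪(k) ⟶ 𝒪(k - 1)`. -/
def derivO (i : Fin (n + 1)) (hl : k = l + 1) : O n k ⟶ O n l :=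
  mapO (ratDeriv i) fun _ _ h ↦ h.ratDeriv i hl

/-- The operator `xᵢ ∂/∂xᵢ` on `𝒪(k)`. -/
def thetaO (n : ℕ) (k : ℤ) (i : Fin (n + 1)) : O n k ⟶ O n k :=
  derivO i (sub_add_cancel k 1).symm ≫
    mulO (MvPolynomial.isHomogeneous_X ℂ i) (by simp)

/-- Multiplication by a complex number. -/
def scalarO (n : ℕ) (k : ℤ) (c : ℂ) : O n k ⟶ O n k :=
  mulO (MvPolynomial.isHomogeneous_C (Fin (n + 1)) c) (by simp)

section Values

variable {U : (ProjSp n).Opens} {x : ProjSp n}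

/-- The action of sheaf homomorphisms on sections. -/
def appO (n : ℕ) (k l : ℤ) (U : (ProjSp n).Opens) :
    (O n k ⟶ O n l) →+ (OSec k U →+ OSec l U) where
  toFun f := (f.hom.app (op U)).hom
  map_zero' := rfl
  map_add' _ _ := rfl

/-- The value of sections at a point. -/
def tvalHom (n : ℕ) (k : ℤ) (U : (ProjSp n).Opens) (x : ProjSp n) : OSec k U →+ RatField n where
  toFun s := tval s x
  map_zero' := tval_zero x
  map_add' s t := tval_add s t x

lemma hom_O_ext' {f g : O n k ⟶ O n l}
    (h : ∀ (U : (ProjSp n).Opens) (s : OSec k U), ∀ x ∈ U,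
      tval (appO n k l U f s) x = tval (appO n k l U g s) x) : f = g := hom_O_ext h

lemma tval_appO_mapO (φ : RatField n →+ RatField n)
    (hφ : ∀ (U : (ProjSp n).Opens) (σ : ProjSp n → RatField n), IsSec k U σ → IsSec l U (φ ∘ σ))
    (s : OSec k U) (hx : x ∈ U) : tval (appO n k l U (mapO φ hφ) s) x = φ (tval s x) :=
  tval_mapO φ hφ s hx

lemma tval_mulO {d : ℕ} {a : CoordRing n} (ha : a.IsHomogeneous d) (hl : l = k + d)
    (s : OSec k U) (hx : x ∈ U) :
    tval (appO n k l U (mulO ha hl) s) x = algebraMap _ (RatField n) a * tval s x :=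
  tval_appO_mapO (AddMonoidHom.mulLeft (algebraMap _ (RatField n) a)) _ s hx

lemma tval_derivO (i : Fin (n + 1)) (hl : k = l + 1) (s : OSec k U) (hx : x ∈ U) :
    tval (appO n k l U (derivO i hl) s) x = ratDeriv i (tval s x) :=
  tval_appO_mapO (ratDeriv i) _ s hx

lemma appO_comp {m : ℤ} (f : O n k ⟶ O n l) (g : O n l ⟶ O n m) (s : OSec k U) :
    appO n k m U (f ≫ g) s = appO n l m U g (appO n k l U f s) := rfl

lemma tval_add_hom (f g : O n k ⟶ O n l) (s : OSec k U) :
    tval (appO n k l U (f + g) s) x = tval (appO n k l U f s) x + tval (appO n k l U g s) x :=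
  tval_add _ _ _

lemma appO_id (s : OSec k U) : appO n k k U (𝟙 _) s = s := rfl

lemma tval_zsmul_id (m : ℤ) (s : OSec k U) :
    tval (appO n k k U (m • 𝟙 _) s) x = m * tval s x := by
  rw [map_zsmul, AddMonoidHom.zsmul_apply, appO_id]
  exact (map_zsmul (tvalHom n k U x) m s).trans (zsmul_eq_mul _ _)

lemma tval_thetaO (i : Fin (n + 1)) (s : OSec k U) (hx : x ∈ U) :
    tval (appO n k k U (thetaO n k i) s) x = coord i * ratDeriv i (tval s x) := by
  rw [thetaO, appO_comp, tval_mulO _ _ _ hx, tval_derivO _ _ _ hx, coord]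

end Values

lemma thetaO_comm (i j : Fin (n + 1)) :
    thetaO n k i ≫ thetaO n k j = thetaO n k j ≫ thetaO n k i := by
  refine hom_O_ext' fun U s x hx ↦ ?_
  rw [appO_comp, appO_comp, tval_thetaO _ _ hx, tval_thetaO _ _ hx, tval_thetaO _ _ hx,
    tval_thetaO _ _ hx, ratDeriv_mul, ratDeriv_mul, ratDeriv_comm, coord, coord,
    ratDeriv_algebraMap, ratDeriv_algebraMap]
  rcases eq_or_ne i j with rfl | hij
  · ring
  · rw [MvPolynomial.pderiv_X_of_ne hij, MvPolynomial.pderiv_X_of_ne hij.symm]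
    simp only [map_zero]
    ring

lemma ratDeriv_coord_mul (i : Fin (n + 1)) (q : RatField n) :
    ratDeriv i (coord i * q) = q + coord i * ratDeriv i q := by
  rw [ratDeriv_mul, coord, ratDeriv_algebraMap, MvPolynomial.pderiv_X_self, map_one]
  ring

lemma mulO_comp_derivO (i : Fin (n + 1)) (h : l = k + (1 : ℕ)) (h' : l = k + 1) :
    mulO (MvPolynomial.isHomogeneous_X ℂ i) h ≫ derivO i h' = thetaO n k i + 𝟙 _ := by
  refine hom_O_ext' fun U s x hx ↦ ?_
  rw [appO_comp, tval_derivO _ _ _ hx, tval_mulO _ _ _ hx, tval_add_hom, tval_thetaO _ _ hx,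
    appO_id, ← coord, ratDeriv_coord_mul, add_comm]

lemma mulO_comp_thetaO (i : Fin (n + 1)) (h : l = k + (1 : ℕ)) :
    mulO (MvPolynomial.isHomogeneous_X ℂ i) h ≫ thetaO n l i =
      (thetaO n k i + 𝟙 _) ≫ mulO (MvPolynomial.isHomogeneous_X ℂ i) h := by
  refine hom_O_ext' fun U s x hx ↦ ?_
  rw [appO_comp, appO_comp, tval_thetaO _ _ hx, tval_mulO _ _ _ hx, tval_mulO _ _ _ hx,
    tval_add_hom, tval_thetaO _ _ hx, appO_id, ← coord, ratDeriv_coord_mul]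
  ring

lemma mulO_comp_mulO {d e f : ℕ} {m : ℤ} {a b c : CoordRing n} (ha : a.IsHomogeneous d)
    (hb : b.IsHomogeneous e) (hc : c.IsHomogeneous f) (habc : a * b = c) (h : l = k + d)
    (h' : m = l + e) (h'' : m = k + f) :
    mulO ha h ≫ mulO hb h' = mulO hc h'' := by
  subst habc
  refine hom_O_ext' fun U s x hx ↦ ?_
  rw [appO_comp, tval_mulO _ _ _ hx, tval_mulO _ _ _ hx, tval_mulO _ _ _ hx, map_mul]
  ring

/-- Euler's identity: `∑ xᵢ ∂/∂xᵢ` is multiplication by `k` on `𝒪(k)`. -/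
lemma sum_thetaO (n : ℕ) (k : ℤ) : ∑ i, thetaO n k i = k • 𝟙 (O n k) := by
  have hsum (J : Finset (Fin (n + 1))) {U : (ProjSp n).Opens} (s : OSec k U) (x : ProjSp n) :
      tval (appO n k k U (∑ i ∈ J, thetaO n k i) s) x =
        ∑ i ∈ J, tval (appO n k k U (thetaO n k i) s) x := by
    rw [map_sum, AddMonoidHom.finsetSum_apply]
    exact map_sum (tvalHom n k U x) _ J
  refine hom_O_ext' fun U s x hx ↦ ?_
  rw [hsum]
  rw [tval_zsmul_id]
  obtain ⟨V, d, e, a, b, hV, hxV, ha, hb, hde, hy⟩ := isSec_tval s x hx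
  have hb0 : b ≠ 0 := by
    rintro rfl
    exact (hy x hxV).1 (zero_mem _)
  have hb' : algebraMap _ (RatField n) b ≠ 0 := by simpa using hb0
  simp only [tval_thetaO _ _ hx, (hy x hxV).2, ratDeriv_div _ a b hb0]
  have hE (c : CoordRing n) (m : ℕ) (hc : c.IsHomogeneous m) :
      ∑ i, coord i * algebraMap _ (RatField n) (MvPolynomial.pderiv i c) =
        m * algebraMap _ (RatField n) c := by
    have := congrArg (algebraMap _ (RatField n)) hc.sum_X_mul_pderiv
    simpa [coord] using this
  have h3 (i : Fin (n + 1)) : coord i * (algebraMap _ (RatField n)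
      (MvPolynomial.pderiv i a * b - a * MvPolynomial.pderiv i b) / algebraMap _ _ (b ^ 2)) =
      coord i * algebraMap _ (RatField n) (MvPolynomial.pderiv i a) * (algebraMap _ _ b)⁻¹ -
      coord i * algebraMap _ (RatField n) (MvPolynomial.pderiv i b) *
        (algebraMap _ _ a * (algebraMap _ _ b ^ 2)⁻¹) := by
    simp only [map_sub, map_mul, map_pow]
    field_simp
  simp only [h3]
  rw [Finset.sum_sub_distrib, ← Finset.sum_mul, ← Finset.sum_mul, hE a d ha, hE b e hb]
  have hk : (k : RatField n) = d - e := by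
    have : k = d - e := by omega
    rw [this]
    push_cast
    ring
  rw [hk]
  field_simp

lemma scalarO_natCast (N : ℕ) : scalarO n k N = (N : ℤ) • 𝟙 (O n k) := by
  refine hom_O_ext' fun U s x hx ↦ ?_
  rw [tval_zsmul_id, scalarO, tval_mulO _ _ _ hx]
  simp

lemma scalarO_comp (c d : ℂ) : scalarO n k c ≫ scalarO n k d = scalarO n k (c * d) :=
  mulO_comp_mulO _ _ _ (by simp) _ _ _

end Operators

end ProjSp

/-! ### Trivializations of `𝒪(k)` and vanishing in degrees above `n` -/

namespace ProjSp
open OpenCohomology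
variable {n : ℕ}

section Generic

/-- The generic point of projective space. -/
def genPt (n : ℕ) : ProjSp n where
  asHomogeneousIdeal := ⊥
  isPrime := by
    rw [HomogeneousIdeal.toIdeal_bot]
    exact Ideal.isPrime_bot
  not_irrelevant_le := fun h ↦ by
    have : (MvPolynomial.X 0 : CoordRing n) ∈ HomogeneousIdeal.irrelevant (grading n) := by
      rw [HomogeneousIdeal.mem_irrelevant_iff, GradedRing.proj_apply,
        DirectSum.decompose_of_mem_ne (grading n) (MvPolynomial.isHomogeneous_X ℂ 0) one_ne_zero]
    exact MvPolynomial.X_ne_zero 0 (show (MvPolynomial.X 0 : CoordRing n) = 0 from h this)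

lemma genPt_mem {U : (ProjSp n).Opens} {x : ProjSp n} (hx : x ∈ U) : genPt n ∈ U := by
  obtain ⟨_, ⟨f, rfl⟩, hxf, hf⟩ := Opens.isBasis_iff_nbhd.1 (Proj.isBasis_basicOpen (grading n)) hx
  refine hf fun h ↦ hxf ?_
  rw [show f = 0 from h]
  exact zero_mem _

variable {k l : ℤ} {U V : (ProjSp n).Opens} {σ : ProjSp n → RatField n}

/-- Projective space is irreducible, so sections of `𝒪(k)` have constant values in
`ℂ(x₀, …, xₙ)`. -/
lemma IsSec.eq_genPt (h : IsSec k U σ) {x : ProjSp n} (hx : x ∈ U) : σ x = σ (genPt n) := by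
  obtain ⟨V, d, e, a, b, hV, hxV, ha, hb, hde, hy⟩ := h x hx
  rw [(hy x hxV).2, (hy _ (genPt_mem hxV)).2]

lemma tval_eq_genPt (s : OSec k U) {x : ProjSp n} (hx : x ∈ U) : tval s x = tval s (genPt n) :=
  (isSec_tval s).eq_genPt hx

lemma basicOpen_formRatio (j : Fin (n + 1)) {d : ℕ} {a : CoordRing n} (ha : a.IsHomogeneous d) :
    (ProjSp n).basicOpen (formRatio j ha) = chart j ⊓ Proj.basicOpen (grading n) a := by
  have hle := (ProjSp n).basicOpen_le (formRatio j ha)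
  refine le_antisymm (le_inf hle fun x hx ↦ ?_) ?_
  · obtain ⟨h, hh⟩ : ∃ h : Γ(ProjSp n, (ProjSp n).basicOpen (formRatio j ha)),
        (ProjSp n).presheaf.map (homOfLE hle).op (formRatio j ha) * h = 1 :=
      ((ProjSp n).toRingedSpace.isUnit_res_basicOpen (formRatio j ha)).exists_right_inv
    classical
    let σ : ProjSp n → RatField n := fun y ↦
      if hy : y ∈ (ProjSp n).basicOpen (formRatio j ha) then ev y hy h else 0
    have hσ (y) (hy : y ∈ (ProjSp n).basicOpen (formRatio j ha)) : σ y = ev y hy h := dif_pos hy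
    obtain ⟨V, d', e, a', b, hV, hxV, ha', hb, hde, hy⟩ := isSec_ev h hσ x hx
    have hyx : ev x hx h = _ := (hσ x hx).symm.trans (hy x hxV).2
    have h2 := congrArg (ev x hx) hh
    rw [map_mul, map_one, hyx] at h2
    have h3 : ev x hx ((ProjSp n).presheaf.map (homOfLE hle).op (formRatio j ha)) =
      algebraMap _ _ a / coord j ^ d := ev_formRatio ha _ _
    have h4 := (congrArg (· * _) h3).symm.trans h2
    have hb0 := ne_zero_of_notMem (hy x hxV).1
    have hj := coord_ne_zero j
    rw [div_mul_div_comm, div_eq_one_iff_eq (mul_ne_zero (pow_ne_zero _ hj) hb0), coord,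
      ← map_pow, ← map_mul, ← map_mul,
      (FaithfulSMul.algebraMap_injective _ (RatField n)).eq_iff] at h4
    intro hi
    have h5 : a * a' ∈ x.asHomogeneousIdeal.toIdeal := Ideal.mul_mem_right _ _ hi
    rw [h4] at h5
    exact (x.isPrime.mem_or_mem h5).elim (fun h ↦ hle hx (x.isPrime.mem_of_pow_mem _ h))
      (hy x hxV).1
  · have hsec : IsSec 0 (chart j ⊓ Proj.basicOpen (grading n) a)
        fun _ ↦ algebraMap _ (RatField n) (MvPolynomial.X j ^ d) / algebraMap _ _ a :=
      fun x hx ↦ ⟨_, d, d, _, _, le_rfl, hx,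
        by simpa using (MvPolynomial.isHomogeneous_X ℂ j).pow d, ha, by simp,
        fun y hy ↦ ⟨hy.2, rfl⟩⟩
    obtain ⟨g, hg⟩ := exists_ev_eq hsec
    have h : IsUnit ((ProjSp n).presheaf.map
        (homOfLE (inf_le_left : chart j ⊓ Proj.basicOpen (grading n) a ≤ _)).op
        (formRatio j ha)) := by
      refine IsUnit.of_mul_eq_one g (ev_ext fun x hx ↦ ?_)
      rw [map_mul, ev_map, ev_formRatio, hg, map_one, map_pow, ← coord]
      have := coord_ne_zero j
      have : algebraMap _ (RatField n) a ≠ 0 := ne_zero_of_notMem hx.2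
      field_simp
    have := (ProjSp n).basicOpen_of_isUnit h
    rw [Scheme.basicOpen_res] at this
    exact inf_eq_left.1 this

lemma basicOpen_ratio (i j : Fin (n + 1)) :
    (ProjSp n).basicOpen (ratio j i) = chart j ⊓ chart i :=
  basicOpen_formRatio j (MvPolynomial.isHomogeneous_X ℂ i)

end Generic

section Affine

variable {k : ℤ}

/-- The trivialization of `𝒪(k)` on an open subset of a chart. -/
def trivO (j : Fin (n + 1)) (k : ℤ) {V : (ProjSp n).Opens} (hV : V ≤ chart j) :
    OSec k V ≃+ Γ(ProjSp n, V) :=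
  let f : OSec k V →+ Γ(ProjSp n, V) :=
    { toFun := fun s ↦ (ProjSp n).presheaf.map (homOfLE (le_inf le_rfl hV)).op (s.1 j)
      map_zero' := map_zero _
      map_add' := fun s t ↦ map_add _ _ _ }
  have hf (s : OSec k V) (x) (hx : x ∈ V) : ev x hx (f s) = coord j ^ (-k) * tval s x :=
    ev_eq_tval s (show x ∈ V ⊓ chart j from ⟨hx, hV hx⟩)
  AddEquiv.ofBijective f ⟨fun s t hst ↦ tval_ext fun x hx ↦ by
    have := congrArg (ev x hx) hst
    rw [hf, hf] at this
    exact mul_left_cancel₀ (zpow_ne_zero _ (coord_ne_zero j)) this, fun g ↦ by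
    classical
    have h := (isSec_coord_zpow hV k).mul (isSec_ev g (σ := fun x ↦
      if hx : x ∈ V then ev x hx g else 0) fun x hx ↦ dif_pos hx)
    rw [add_zero] at h
    refine ⟨mkOSec _ h, ev_ext fun x hx ↦ ?_⟩
    rw [hf, tval_mkOSec _ hx, Pi.mul_apply, dif_pos hx, ← mul_assoc,
      ← zpow_add₀ (coord_ne_zero j), neg_add_cancel, zpow_zero, one_mul]⟩

lemma ev_trivO (j : Fin (n + 1)) {V : (ProjSp n).Opens} (hV : V ≤ chart j) (s : OSec k V)
    {x : ProjSp n} (hx : x ∈ V) : ev x hx (trivO j k hV s) = coord j ^ (-k) * tval s x :=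
  ev_eq_tval s (show x ∈ V ⊓ chart j from ⟨hx, hV hx⟩)

/-- Affine open sets contained in a chart. -/
def SmallAffine (V : (ProjSp n).Opens) : Prop := IsAffineOpen V ∧ ∃ j, V ≤ chart j

lemma isAffineOpen_chart (i : Fin (n + 1)) : IsAffineOpen (chart i) :=
  Proj.isAffineOpen_basicOpen (grading n) _ (MvPolynomial.isHomogeneous_X ℂ i) one_pos

lemma smallAffine_chart (i : Fin (n + 1)) : SmallAffine (chart i) :=
  ⟨isAffineOpen_chart i, i, le_rfl⟩

lemma SmallAffine.inf {V W : (ProjSp n).Opens} (hV : SmallAffine V) (hW : SmallAffine W) :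
    SmallAffine (V ⊓ W) :=
  ⟨hV.1.inf hW.1, hV.2.imp fun _ h ↦ inf_le_left.trans h⟩

lemma SmallAffine.eq_zero {V : (ProjSp n).Opens} (hV : SmallAffine V) {p : ℕ}
    (a : HU (O n k) (p + 1) V) : a = 0 := by
  obtain ⟨j, hj⟩ := hV.2
  refine eq_zero_of_isAffineOpen (Y := ProjSp n) (F := O n k) (V₀ := chart j)
    (fun V hV ↦ trivO j k hV) (fun V W h hV s ↦ ?_) p V hV.1 hj a
  rfl

lemma sup_map_inf {α : Type*} [DistribLattice α] [OrderBot α] (V : α) (l : List α) :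
    (l.map (V ⊓ ·)).foldr (· ⊔ ·) ⊥ = V ⊓ l.foldr (· ⊔ ·) ⊥ := by
  induction l with
  | nil => simp
  | cons W l ih => rw [List.map_cons, List.foldr_cons, ih, List.foldr_cons, inf_sup_left]

/-- The union of `m` affine open sets has no cohomology in degrees `p ≥ m`. The union is written as a
`List.foldr` so that Mayer–Vietoris applies with the head and the tail of the list. -/
lemma eq_zero_of_length_le (m : ℕ) : ∀ (l : List (ProjSp n).Opens) (p : ℕ), l.length = m → m ≤ p →
    (∀ V ∈ l, SmallAffine V) → ∀ a : HU (O n k) p (l.foldr (· ⊔ ·) ⊥), a = 0 := by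
  induction m with
  | zero =>
    rintro l p hl - - a
    obtain rfl := List.length_eq_zero_iff.1 hl
    exact HU_bot a
  | succ m ih =>
    rintro (_ | ⟨V, l⟩) p hl hp hV a
    · simp at hl
    obtain ⟨p, rfl⟩ := Nat.exists_eq_add_of_le' (Nat.one_le_of_lt (Nat.lt_of_succ_le hp))
    have hl' : ∀ W ∈ l, SmallAffine W := fun W hW ↦ hV W (List.mem_cons_of_mem _ hW)
    replace hV := hV V List.mem_cons_self
    rw [List.length_cons, Nat.add_right_cancel_iff] at hl
    refine eq_zero_of_mayerVietoris (U := V) (V := l.foldr (· ⊔ ·) ⊥) rfl le_sup_left le_sup_right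
      a (hV.eq_zero _) (ih l (p + 1) hl (by omega) hl' _) fun b ↦ ⟨0, 0, ?_⟩
    rw [map_zero, map_zero, add_zero]
    refine eq_zero_of_res_eq (sup_map_inf V l).symm
      (ih _ p (by simpa using hl) (by omega) ?_ _)
    simp only [List.mem_map]
    rintro _ ⟨W, hW, rfl⟩
    exact hV.inf (hl' W hW)

lemma foldr_chart (n : ℕ) :
    ((List.finRange (n + 1)).map chart).foldr (· ⊔ ·) (⊥ : (ProjSp n).Opens) = ⊤ := by
  refine top_le_iff.1 fun x _ ↦ ?_
  obtain ⟨i, hi⟩ := exists_mem_chart x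
  have key (l : List (ProjSp n).Opens) (hl : chart i ∈ l) : chart i ≤ l.foldr (· ⊔ ·) ⊥ := by
    induction l with
    | nil => simp at hl
    | cons V l ih =>
      rcases List.mem_cons.1 hl with rfl | h
      · exact le_sup_left
      · exact (ih h).trans le_sup_right
  exact key _ (List.mem_map.2 ⟨i, by simp, rfl⟩) hi

/-- The cohomology of `𝒪(k)` on `ℙⁿ` vanishes in degrees `> n`. -/
lemma eq_zero_of_lt {p : ℕ} (hp : n < p) (a : HU (O n k) p ⊤) : a = 0 := by
  refine eq_zero_of_res_eq (foldr_chart n).symm ?_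
  refine eq_zero_of_length_le (n + 1) _ p (by simp) hp ?_ _
  simp only [List.mem_map]
  rintro _ ⟨i, -, rfl⟩
  exact smallAffine_chart i

end Affine

/-! ### Vanishing of the cohomology of `𝒪(k)` for `k ≥ -n` -/

section Torsion

/-- Multiplication by `xᵢ ^ N`. -/
abbrev powO (n : ℕ) (k : ℤ) (i : Fin (n + 1)) (N : ℕ) : O n k ⟶ O n (k + N) :=
  mulO (d := N) (a := MvPolynomial.X i ^ N)
    (by simpa using (MvPolynomial.isHomogeneous_X ℂ i).pow N) rfl

lemma map_powO_eq_zero {k : ℤ} {i : Fin (n + 1)} {M N : ℕ} {p : ℕ} {U : (ProjSp n).Opens}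
    {a : HU (O n k) p U}
    (h : HU.map (powO n (k + M) i N) p U (HU.map (powO n k i M) p U a) = 0) :
    HU.map (powO n k i (M + N)) p U a = 0 := by
  have key (l : ℤ) (hl : l = k + M + N) (hl' : l = k + (M + N : ℕ)) :
      HU.map (mulO (l := l) (d := M + N) (a := MvPolynomial.X i ^ (M + N))
        (by simpa using (MvPolynomial.isHomogeneous_X ℂ i).pow (M + N)) hl') p U a = 0 := by
    subst hl
    rw [← mulO_comp_mulO _ _ _ (pow_add _ M N).symm rfl rfl, HU.map_comp]
    exact h
  exact key _ (by push_cast; ring) rfl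

/-- A section of `𝒪(k)` over `V ∩ D₊(xᵢ)` extends to `V` after multiplication by a power of
`xᵢ`. -/
lemma exists_extend {k : ℤ} {V : (ProjSp n).Opens} (hV : SmallAffine V) (i : Fin (n + 1))
    (s : OSec k (V ⊓ chart i)) : ∃ (N : ℕ) (y : OSec (k + N) V), ∀ x ∈ V ⊓ chart i,
      tval y x = coord i ^ N * tval s x := by
  obtain ⟨hV, j, hj⟩ := hV
  let g : Γ(ProjSp n, V) := (ProjSp n).presheaf.map (homOfLE hj).op (ratio j i)
  have hg : V ⊓ chart i = (ProjSp n).basicOpen g := by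
    rw [Scheme.basicOpen_res, basicOpen_ratio, ← inf_assoc, inf_eq_left.2 hj]
  obtain ⟨N, y, hy⟩ := exists_map_basicOpen hV g hg inf_le_left
    (trivO j k (inf_le_left.trans hj) s)
  refine ⟨N, (trivO j (k + N) hj).symm y, fun x hx ↦ ?_⟩
  have h1 := ev_trivO j hj ((trivO j (k + N) hj).symm y) hx.1
  rw [AddEquiv.apply_symm_apply] at h1
  have h2 := congrArg (ev x hx) hy
  rw [ev_map, h1, map_mul, map_pow, ev_map, ev_map, ev_ratio, ev_trivO, div_pow, neg_add,
    zpow_add₀ (coord_ne_zero j), zpow_neg, zpow_neg, zpow_natCast] at h2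
  have := coord_ne_zero j
  have := zpow_ne_zero k (coord_ne_zero j)
  field_simp at h2
  exact h2

/-- `H⁰(U, 𝒪(k))` is the group of sections of `𝒪(k)` over `U`. -/
def H0O (k : ℤ) (U : (ProjSp n).Opens) : HU (O n k) 0 U ≃+ OSec k U := H0 (O n k) U

lemma H0O_map {k l : ℤ} {U : (ProjSp n).Opens} (f : O n k ⟶ O n l) (a : HU (O n k) 0 U) :
    H0O l U (HU.map f 0 U a) = appO n k l U f (H0O k U a) := H0_map f a

lemma H0O_res {k : ℤ} {U V : (ProjSp n).Opens} (h : V ≤ U) (a : HU (O n k) 0 U) :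
    H0O k V (res (O n k) 0 h a) = twistedIdealRestrict _ k h (H0O k U a) := H0_res h a

/-- A class of positive degree on a union of `V₀ ⊆ D₊(xᵢ)` and of open sets meeting `D₊(xᵢ)` inside
`V₀` is killed by a power of `xᵢ`. -/
lemma exists_map_powO_eq_zero (i : Fin (n + 1)) (m : ℕ) : ∀ (p : ℕ) (k : ℤ)
    (V₀ : (ProjSp n).Opens) (l : List (ProjSp n).Opens), SmallAffine V₀ →
    l.length = m → (∀ V ∈ l, SmallAffine V ∧ V ⊓ chart i ≤ V₀) →
    ∀ a : HU (O n k) (p + 1) (V₀ ⊔ l.foldr (· ⊔ ·) ⊥),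
      ∃ N, HU.map (powO n k i N) (p + 1) _ a = 0 := by
  induction m with
  | zero =>
    rintro p k V₀ l hV₀ hl - a
    obtain rfl := List.length_eq_zero_iff.1 hl
    have H (a : HU (O n k) (p + 1) (V₀ ⊔ ⊥)) : a = 0 :=
      eq_zero_of_res_eq (sup_bot_eq V₀) (hV₀.eq_zero _)
    exact ⟨0, (congrArg _ (H a)).trans (map_zero _)⟩
  | succ m ih =>
    rintro p k V₀ (_ | ⟨V, l⟩) hV₀ hl hV a
    · simp at hl
    have hl' : ∀ W ∈ l, SmallAffine W ∧ W ⊓ chart i ≤ V₀ :=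
      fun W hW ↦ hV W (List.mem_cons_of_mem _ hW)
    replace hV := hV V List.mem_cons_self
    rw [List.length_cons, Nat.add_right_cancel_iff] at hl
    set W := V₀ ⊔ l.foldr (· ⊔ ·) ⊥ with hW
    have hVW : W ⊓ V = (V ⊓ V₀) ⊔ (l.map (V ⊓ ·)).foldr (· ⊔ ·) ⊥ := by
      rw [sup_map_inf, ← inf_sup_left, inf_comm]
    have hsup : V₀ ⊔ (V :: l).foldr (· ⊔ ·) ⊥ = W ⊔ V := by
      rw [List.foldr_cons, hW, sup_comm V, sup_assoc]
    suffices H : ∀ a : HU (O n k) (p + 1) (W ⊔ V), ∃ N, HU.map (powO n k i N) (p + 1) _ a = 0 by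
      obtain ⟨N, hN⟩ := H (res _ _ hsup.ge a)
      rw [map_res] at hN
      exact ⟨N, eq_zero_of_res_eq hsup hN⟩
    intro a
    obtain ⟨N₁, hN₁⟩ := ih p k V₀ l hV₀ hl hl' (res _ _ le_sup_left a)
    rw [map_res] at hN₁
    obtain ⟨b, hb⟩ := exists_mvδ_eq (HU.map (powO n k i N₁) (p + 1) _ a) hN₁ (hV.1.eq_zero _)
    suffices H : ∃ N, mvδ _ p W V (HU.map (powO n (k + N₁) i N) p _ b) = 0 by
      obtain ⟨N, hN⟩ := H
      refine ⟨N₁ + N, map_powO_eq_zero ?_⟩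
      rw [← hb, mvδ_map, hN]
    -- in degree zero extend sections from `V ∩ D₊(xᵢ)` to `V`; in higher degrees use induction
    rcases p with _ | p
    · have hle : V ⊓ chart i ≤ W ⊓ V := le_inf (hV.2.trans le_sup_left) inf_le_left
      obtain ⟨N, y, hy⟩ := exists_extend hV.1 i (twistedIdealRestrict _ _ hle (H0O _ _ b))
      refine ⟨N, ?_⟩
      have : HU.map (powO n (k + N₁) i N) 0 _ b = res _ 0 inf_le_right ((H0O _ V).symm y) := by
        apply (H0O _ _).injective
        rw [H0O_map, H0O_res, AddEquiv.apply_symm_apply]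
        refine tval_ext fun x hx ↦ ?_
        have hgi : genPt n ∈ V ⊓ chart i :=
          ⟨genPt_mem hx.2, fun h ↦ MvPolynomial.X_ne_zero (R := ℂ) i h⟩
        rw [tval_mulO _ _ _ hx, tval_restrict inf_le_right y hx,
          tval_eq_genPt _ hx, tval_eq_genPt _ hx.2, hy _ hgi, tval_restrict hle _ hgi, coord,
          map_pow]
      rw [this, mvδ_res_right]
    · obtain ⟨N, hN⟩ := ih p (k + N₁) (V ⊓ V₀) (l.map (V ⊓ ·)) (hV.1.inf hV₀) (by simpa using hl)
        (by
          simp only [List.mem_map]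
          rintro _ ⟨W', hW', rfl⟩
          refine ⟨hV.1.inf (hl' W' hW').1, ?_⟩
          rw [inf_assoc]
          exact inf_le_inf_left _ (hl' W' hW').2) (res _ _ hVW.ge b)
      rw [map_res] at hN
      exact ⟨N, by rw [eq_zero_of_res_eq hVW hN, map_zero]⟩

lemma exists_map_powO_eq_zero_top {k : ℤ} {p : ℕ} (i : Fin (n + 1)) (a : HU (O n k) (p + 1) ⊤) :
    ∃ N, HU.map (powO n k i N) (p + 1) _ a = 0 := by
  have htop : (⊤ : (ProjSp n).Opens) =
      chart i ⊔ ((List.finRange (n + 1)).map chart).foldr (· ⊔ ·) ⊥ := by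
    rw [foldr_chart, sup_top_eq]
  obtain ⟨N, hN⟩ := exists_map_powO_eq_zero i (n + 1) p k (chart i)
    ((List.finRange (n + 1)).map chart) (smallAffine_chart i) (by simp) (by
      simp only [List.mem_map]
      rintro _ ⟨j, -, rfl⟩
      exact ⟨smallAffine_chart j, inf_le_right⟩) (res _ _ htop.ge a)
  rw [map_res] at hN
  exact ⟨N, eq_zero_of_res_eq htop hN⟩

/-- `HU.map` as a homomorphism in the morphism of sheaves. -/
def _root_.OpenCohomology.HU.mapHom {X : TopCat.{0}} {F G : AbSheaf X} {p : ℕ} {U : Opens X}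
    (a : HU F p U) : (F ⟶ G) →+ HU G p U where
  toFun f := HU.map f p U a
  map_zero' := by simp [HU.map_apply]
  map_add' f g := HU.map_add f g a

/-- The endomorphism of cohomology induced by `xᵢ ∂/∂xᵢ`. -/
def thetaH (n : ℕ) (k : ℤ) (p : ℕ) (U : (ProjSp n).Opens) (i : Fin (n + 1)) :
    AddMonoid.End (HU (O n k) p U) := HU.map (thetaO n k i) p U

lemma thetaH_add_apply {k : ℤ} {p : ℕ} {U : (ProjSp n).Opens} (i : Fin (n + 1)) (j : ℕ)
    (a : HU (O n k) p U) :
    (thetaH n k p U i + (j : AddMonoid.End (HU (O n k) p U))) a =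
      HU.map (thetaO n k i) p U a + j • a := rfl

/-- A class killed by `xᵢ ^ N` is killed by a product of operators `xᵢ ∂/∂xᵢ + j` with `j > 0`. -/
lemma exists_prod_thetaH_eq_zero {p : ℕ} {U : (ProjSp n).Opens} (i : Fin (n + 1)) (N : ℕ) :
    ∀ (k : ℤ) (a : HU (O n k) p U), HU.map (powO n k i N) p U a = 0 →
      ∃ A : List ℕ, (A.map fun j ↦ thetaH n k p U i +
        ((j + 1 : ℕ) : AddMonoid.End (HU (O n k) p U))).prod a = 0 := by
  induction N with
  | zero =>
    intro k a ha
    refine ⟨[], ?_⟩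
    -- the degrees `k` and `k + 0` of source and target agree only propositionally
    have key (l : ℤ) (hl : l = k) (hl' : l = k + (0 : ℕ))
        (h : HU.map (mulO (l := l) (d := 0) (a := MvPolynomial.X i ^ 0)
          (by simpa using (MvPolynomial.isHomogeneous_X ℂ i).pow 0) hl') p U a = 0) : a = 0 := by
      subst hl
      rw [← h]
      refine (HU.map_id a).symm.trans (congrArg (fun f ↦ HU.map f p U a) ?_)
      refine hom_O_ext' fun V s x hx ↦ ?_
      rw [tval_mulO _ _ _ hx, appO_id]
      simp
    exact key _ (by simp) rfl ha
  | succ N ih =>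
    intro k a ha
    let T : O n k ⟶ O n (k + (1 : ℕ)) := mulO (MvPolynomial.isHomogeneous_X ℂ i) rfl
    obtain ⟨A, hA⟩ := ih (k + (1 : ℕ)) (HU.map T p U a) (by
      have key (l : ℤ) (hl : l = k + (1 : ℕ) + N) (hl' : l = k + (N + 1 : ℕ))
          (h : HU.map (mulO (l := l) (d := N + 1) (a := MvPolynomial.X i ^ (N + 1))
            (by simpa using (MvPolynomial.isHomogeneous_X ℂ i).pow (N + 1)) hl') p U a = 0) :
          HU.map (powO n (k + (1 : ℕ)) i N) p U (HU.map T p U a) = 0 := by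
        subst hl
        rw [← h, ← HU.map_comp]
        congr 2
        exact mulO_comp_mulO _ _ _ (pow_succ' _ N).symm _ _ _
      exact key _ (by push_cast; ring) rfl ha)
    have hT (j : ℕ) (b : HU (O n k) p U) :
        (thetaH n (k + (1 : ℕ)) p U i + ((j + 1 : ℕ) : AddMonoid.End (HU (O n _) p U)) :
          AddMonoid.End _) (HU.map T p U b) =
          HU.map T p U ((thetaH n k p U i + ((j + 1 + 1 : ℕ) : AddMonoid.End (HU (O n k) p U)) :
            AddMonoid.End _) b) := by
      rw [thetaH_add_apply, thetaH_add_apply, ← HU.map_comp, mulO_comp_thetaO, HU.map_comp,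
        HU.map_add, HU.map_id, ← map_nsmul, ← map_add, add_assoc, ← succ_nsmul']
    have hprod : HU.map T p U (((A.map (· + 1)).map fun j ↦ thetaH n k p U i +
        ((j + 1 : ℕ) : AddMonoid.End (HU (O n k) p U))).prod a) = 0 := by
      rw [← hA]
      clear hA
      induction A with
      | nil => rfl
      | cons j A ihA =>
        simp only [List.map_cons, List.prod_cons, AddMonoid.End.coe_mul, Function.comp_apply]
        rw [← hT, ihA]
    refine ⟨0 :: A.map (· + 1), ?_⟩
    rw [List.map_cons, List.prod_cons, AddMonoid.End.coe_mul, Function.comp_apply,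
      thetaH_add_apply, zero_add, one_nsmul]
    -- `b` is killed by `xᵢ`, hence by `∂/∂xᵢ ∘ xᵢ = xᵢ ∂/∂xᵢ + 1`
    set b := ((A.map (· + 1)).map fun j ↦ thetaH n k p U i +
        ((j + 1 : ℕ) : AddMonoid.End (HU (O n k) p U))).prod a
    have h := HU.map_comp T (derivO i (by push_cast; rfl)) b
    rw [mulO_comp_derivO, HU.map_add, HU.map_id, hprod, map_zero] at h
    exact h

/-- The cohomology of `𝒪(k)` on `ℙⁿ` vanishes in positive degrees if `k ≥ -n`. A class is killed by
a power of each `xᵢ`, so that it is a generalized eigenvector of the operators `xᵢ ∂/∂xᵢ` with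
negative eigenvalues; but the sum of these `n + 1` operators is `k > -(n + 1)`. -/
theorem eq_zero_of_neg_le {k : ℤ} (hk : -(n : ℤ) ≤ k) {p : ℕ} (a : HU (O n k) (p + 1) ⊤) :
    a = 0 := by
  obtain ⟨N, hN, h⟩ := exists_nsmul_eq_zero (thetaH n k (p + 1) ⊤) (fun i j ↦
      AddMonoidHom.ext fun b ↦ by
        change HU.map _ _ _ (HU.map _ _ _ b) = HU.map _ _ _ (HU.map _ _ _ b)
        rw [← HU.map_comp, ← HU.map_comp, thetaO_comm])
    (k := k) (by push_cast; omega) (fun b ↦ by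
      have h1 : ∑ i, thetaH n k (p + 1) ⊤ i b = HU.mapHom b (∑ i, thetaO n k i) :=
        (map_sum (HU.mapHom b) _ _).symm
      rw [h1, sum_thetaO, map_zsmul]
      exact congrArg _ (HU.map_id b)) a fun i ↦ by
        obtain ⟨N, hN⟩ := exists_map_powO_eq_zero_top i a
        exact exists_prod_thetaH_eq_zero i N k a hN
  have h1 : HU.map (scalarO n k N) (p + 1) ⊤ a = 0 := by
    change HU.mapHom a _ = 0
    rw [scalarO_natCast, map_zsmul, natCast_zsmul, ← h]
    exact congrArg _ (HU.map_id a)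
  rw [← HU.map_id a]
  have h2 : 𝟙 (O n k) = scalarO n k N ≫ scalarO n k (N : ℂ)⁻¹ := by
    rw [scalarO_comp, mul_inv_cancel₀ (by exact_mod_cast hN)]
    simpa using (scalarO_natCast (n := n) (k := k) 1).symm
  rw [h2, HU.map_comp, h1, map_zero]

end Torsion

end ProjSp

/-! ### Skyscraper sheaves and the long exact sequence -/

namespace OpenCohomology
open Abelian Limits

section PointSheaf

variable {T : TopCat.{0}} {J : Type} (y : J → T) (A : J → Type) [∀ j, AddCommGroup (A j)]

/-- The group `∏_{yⱼ ∈ U} Aⱼ`. -/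
abbrev PointSec (U : Opens T) : Type := ∀ j : {j // y j ∈ U}, A j.1

/-- The presheaf `U ↦ ∏_{yⱼ ∈ U} Aⱼ`. -/
def pointPresheaf : TopCat.Presheaf AddCommGrpCat.{0} T where
  obj U := AddCommGrpCat.of (PointSec y A U.unop)
  map f := AddCommGrpCat.ofHom
    { toFun := fun s j ↦ s ⟨j.1, f.unop.le j.2⟩
      map_zero' := rfl
      map_add' := fun _ _ ↦ rfl }

lemma pointPresheaf_isSheaf : (pointPresheaf y A).IsSheaf := by
  rw [TopCat.Presheaf.isSheaf_iff_isSheafUniqueGluing]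
  intro α U sf hsf
  have h (j : {j // y j ∈ iSup U}) : ∃ a, y j.1 ∈ U a := Opens.mem_iSup.1 j.2
  choose a ha using h
  have key (j : {j // y j ∈ iSup U}) (b) (hb : y j.1 ∈ U b) :
      (sf (a j) : PointSec y A (U (a j))) ⟨j.1, ha j⟩ =
        (sf b : PointSec y A (U b)) ⟨j.1, hb⟩ :=
    congrFun (hsf (a j) b) (⟨j.1, ha j, hb⟩ : {i // y i ∈ U (a j) ⊓ U b})
  refine ⟨fun j ↦ (sf (a j) : PointSec y A (U (a j))) ⟨j.1, ha j⟩, fun b ↦ ?_,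
    fun t ht ↦ ?_⟩
  · funext j
    exact key ⟨j.1, _⟩ b j.2
  · funext j
    exact congrFun (ht (a j)) ⟨j.1, ha j⟩

/-- The direct sum of the skyscraper sheaves `Aⱼ` at the points `yⱼ`. -/
def pointSheaf : AbSheaf T := ⟨pointPresheaf y A, pointPresheaf_isSheaf y A⟩

/-- A sum of skyscraper sheaves of injective groups is injective: a map into it is the same as a
family of maps from stalks. -/
instance injective_pointSheaf [∀ j, DivisibleBy (A j) ℤ] : Injective (pointSheaf y A) where
  factors {F G} g f hf := by
    let c' (j : J) : Cocone (((Functor.whiskeringLeft _ _ AddCommGrpCat).obj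
        (OpenNhds.inclusion (y j)).op).obj F.obj) := ⟨AddCommGrpCat.of (A j),
        { app := fun U ↦ g.hom.app (op U.unop.1) ≫ AddCommGrpCat.ofHom
            (Pi.evalAddMonoidHom (fun j : {j // y j ∈ U.unop.1} ↦ A j.1) ⟨j, U.unop.2⟩)
          naturality := fun U V f ↦ by
            refine AddCommGrpCat.hom_ext (AddMonoidHom.ext fun s ↦ ?_)
            have := congr($(g.hom.naturality ((OpenNhds.inclusion (y j)).map f.unop).op) s)
            exact congrFun this ⟨j, V.unop.2⟩ }⟩
    let c (j : J) : TopCat.Presheaf.stalk F.obj (y j) ⟶ AddCommGrpCat.of (A j) :=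
      colimit.desc _ (c' j)
    have hc (j : J) (U : Opens T) (hj : y j ∈ U) (s : F.obj.obj (op U)) :
        c j (TopCat.Presheaf.germ F.obj U (y j) hj s) =
          (g.hom.app (op U) s : PointSec y A U) ⟨j, hj⟩ :=
      congr($(colimit.ι_desc (c' j) (op ⟨U, hj⟩)) s)
    have hm (j : J) : Mono ((TopCat.Presheaf.stalkFunctor AddCommGrpCat (y j)).map f.hom) :=
      have : Mono (C := TopCat.Sheaf AddCommGrpCat.{0} T) (X := F) (Y := G) f := hf
      TopCat.Presheaf.stalk_mono_of_mono (C := AddCommGrpCat.{0}) (F := F) (G := G) f (y j)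
    have hd (j : J) : ∃ d : TopCat.Presheaf.stalk G.obj (y j) ⟶ AddCommGrpCat.of (A j),
        (TopCat.Presheaf.stalkFunctor AddCommGrpCat (y j)).map f.hom ≫ d = c j :=
      @Injective.factors _ _ (AddCommGrpCat.of (A j)) _ _ _ (c j) _ (hm j)
    choose d hd using hd
    refine ⟨ObjectProperty.homMk
      { app := fun U ↦ AddCommGrpCat.ofHom
          { toFun := fun s (j : {j // y j ∈ U.unop}) ↦
              d j.1 (TopCat.Presheaf.germ G.obj U.unop (y j.1) j.2 s)
            map_zero' := by
              funext j
              simp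
            map_add' := fun s t ↦ by
              funext j
              simp }
        naturality := fun U V f ↦ AddCommGrpCat.hom_ext (AddMonoidHom.ext fun s ↦ by
          funext j
          exact congrArg (d j.1) (TopCat.Presheaf.germ_res_apply G.obj f.unop (y j.1) j.2 s)) }, ?_⟩
    refine ObjectProperty.hom_ext _ (NatTrans.ext (funext fun U ↦ AddCommGrpCat.hom_ext
      (AddMonoidHom.ext fun s ↦ ?_)))
    funext j
    refine Eq.trans ?_ (hc j.1 U.unop j.2 s)
    refine Eq.trans ?_ congr($(hd j.1) (TopCat.Presheaf.germ F.obj _ _ j.2 s))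
    exact congrArg (d j.1) (TopCat.Presheaf.stalkFunctor_map_germ_apply U.unop (y j.1) j.2
      f.hom s).symm

end PointSheaf

section LongExactSequence

variable {T : TopCat.{0}} {S : ShortComplex (AbSheaf T)} (hS : S.ShortExact) {U : Opens T}

include hS

/-- A class which dies in the middle term is zero if classes one degree below lift. -/
lemma eq_zero_of_map_eq_zero {p : ℕ} (a : HU S.X₁ (p + 1) U) (ha : HU.map S.f (p + 1) U a = 0)
    (h : ∀ c : HU S.X₃ p U, ∃ b, HU.map S.g p U b = c) : a = 0 := by
  obtain ⟨c, rfl⟩ := Ext.covariant_sequence_exact₁ _ hS a ha rfl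
  obtain ⟨b, rfl⟩ := h c
  rw [HU.map_apply, Ext.comp_assoc_of_second_deg_zero, hS.comp_extClass, Ext.comp_zero]

lemma exists_map_eq {p : ℕ} (h : ∀ a : HU S.X₁ (p + 1) U, a = 0) (c : HU S.X₃ p U) :
    ∃ b, HU.map S.g p U b = c :=
  Ext.covariant_sequence_exact₃ _ hS c rfl (h _)

end LongExactSequence
end OpenCohomology

/-! ### The sequence `0 → ℐ_X(k) → 𝒪(k) → 𝒪_X → 0` -/

namespace ProjSp
open OpenCohomology Abelian Limits
variable {n : ℕ}

/-- The constant functions on a chart. -/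
def cst (c : Fin (n + 1)) : ℂ →+* Γ(ProjSp n, chart c) :=
  (Proj.awayToSection (grading n) (MvPolynomial.X c)).hom.comp
    ((HomogeneousLocalization.fromZeroRingHom (grading n)
      (Submonoid.powers (MvPolynomial.X c : CoordRing n))).comp (algebraMap ℂ (grading n 0)))

section Germs

variable {X : Scheme.{0}} (ι : X ⟶ ProjSp n)

/-- The germ at `x` of the pullback of a regular function. -/
def pullGerm (x : X) {V : (ProjSp n).Opens} (hx : ι x ∈ V) :
    Γ(ProjSp n, V) →+* X.presheaf.stalk x :=
  (X.presheaf.germ (ι ⁻¹ᵁ V) x hx).hom.comp (ι.app V).hom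

lemma pullGerm_apply (x : X) {V : (ProjSp n).Opens} (hx : ι x ∈ V) (f : Γ(ProjSp n, V)) :
    pullGerm ι x hx f = X.presheaf.germ (ι ⁻¹ᵁ V) x hx (ι.app V f) := rfl

lemma pullGerm_map (x : X) {V W : (ProjSp n).Opens} (h : W ≤ V) (hx : ι x ∈ W)
    (f : Γ(ProjSp n, V)) :
    pullGerm ι x hx ((ProjSp n).presheaf.map (homOfLE h).op f) = pullGerm ι x (h hx) f := by
  rw [pullGerm_apply, app_map_apply]
  exact X.presheaf.germ_res_apply ((Opens.map ι.base).map (homOfLE h)) x hx _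

lemma app_eq_zero_iff {V : (ProjSp n).Opens} (f : Γ(ProjSp n, V)) :
    ι.app V f = 0 ↔ ∀ x (hx : ι x ∈ V), pullGerm ι x hx f = 0 := by
  refine ⟨fun h x hx ↦ by rw [pullGerm_apply, h, map_zero], fun h ↦ ?_⟩
  refine TopCat.Presheaf.section_ext X.sheaf (ι ⁻¹ᵁ V) _ _ fun x hx ↦ ?_
  exact (h x hx).trans (map_zero _).symm

lemma exists_pullGerm_eq [IsClosedImmersion ι] (x : X) (b : X.presheaf.stalk x) :
    ∃ (V : (ProjSp n).Opens) (hx : ι x ∈ V) (f : Γ(ProjSp n, V)), pullGerm ι x hx f = b := by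
  obtain ⟨b, rfl⟩ := ι.stalkMap_surjective x b
  obtain ⟨V, hx, f, rfl⟩ := (ProjSp n).presheaf.exists_germ_eq b
  exact ⟨V, hx, f, (ι.germ_stalkMap_apply V x hx f).symm⟩

variable (c : X → Fin (n + 1)) (hc : ∀ x, ι x ∈ chart (c x))

/-- The value at `x` of a section of `𝒪(k)` restricted to `X`; the line bundle `𝒪(k)` is trivialized
near `x` by means of the chart `D₊(x_{c(x)})`. -/
def germO (k : ℤ) (x : X) {U : (ProjSp n).Opens} (hx : ι x ∈ U) : OSec k U →+ X.presheaf.stalk x :=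
  (pullGerm ι x (V := U ⊓ chart (c x)) (Opens.mem_inf.2 ⟨hx, hc x⟩)).toAddMonoidHom.comp
    ((Pi.evalAddMonoidHom (fun i ↦ Γ(ProjSp n, U ⊓ chart i)) (c x)).comp (AddSubgroup.subtype _))

lemma germO_apply (k : ℤ) (x : X) {U : (ProjSp n).Opens} (hx : ι x ∈ U) (s : OSec k U) :
    germO ι c hc k x hx s =
      pullGerm ι x (V := U ⊓ chart (c x)) (Opens.mem_inf.2 ⟨hx, hc x⟩) (s.1 (c x)) := rfl

lemma germO_restrict (k : ℤ) (x : X) {U V : (ProjSp n).Opens} (h : V ≤ U) (hx : ι x ∈ V)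
    (s : OSec k U) :
    germO ι c hc k x hx (twistedIdealRestrict _ k h s) = germO ι c hc k x (h hx) s :=
  pullGerm_map ι x (inf_le_inf_right _ h) _ _

lemma germO_eq_zero_iff {k : ℤ} {U : (ProjSp n).Opens} (s : OSec k U) :
    (∀ x (hx : ι x ∈ U), germO ι c hc k x hx s = 0) ↔ ∀ j, ι.app (U ⊓ chart j) (s.1 j) = 0 := by
  simp only [app_eq_zero_iff, germO_apply]
  refine ⟨fun h j x hx ↦ ?_, fun h x hx ↦ h _ _ _⟩
  have h1 := congrArg (pullGerm ι x (V := U ⊓ chart j ⊓ chart (c x)) (Opens.mem_inf.2 ⟨hx, hc x⟩))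
    (s.2.2 j (c x))
  rwa [map_mul, pullGerm_map, pullGerm_map, h x hx.1, mul_zero] at h1

/-- The structure sheaf of a finite discrete `X`, pushed forward to `ℙⁿ`. -/
abbrev quotSheaf : AbSheaf (ProjSp n) :=
  pointSheaf (T := ProjSp n) (fun x : X ↦ ι x) fun x ↦ X.presheaf.stalk x

/-- Restriction of sections of `𝒪(k)` to `X`. -/
def evalO (k : ℤ) : O n k ⟶ quotSheaf ι := ObjectProperty.homMk
  { app := fun U ↦ AddCommGrpCat.ofHom
      { toFun := fun (s : OSec k U.unop) x ↦ germO ι c hc k x.1 x.2 s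
        map_zero' := funext fun _ ↦ map_zero _
        map_add' := fun _ _ ↦ funext fun _ ↦ map_add _ _ _ }
    naturality := fun _ _ f ↦ AddCommGrpCat.hom_ext (AddMonoidHom.ext fun s ↦
      funext fun x ↦ germO_restrict ι c hc k x.1 f.unop.le x.2 s) }

/-- The sheaf `ℐ_X(k)` as an object of the category of abelian sheaves. -/
abbrev idealSheaf (k : ℤ) : AbSheaf (ProjSp n) := twistedIdealSheaf ι k

/-- The inclusion `ℐ_X(k) ⟶ 𝒪(k)`. -/
def inclO (k : ℤ) : idealSheaf ι k ⟶ O n k := ObjectProperty.homMk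
  { app := fun U ↦ AddCommGrpCat.ofHom
      { toFun := fun (s : twistedIdealSections ι k U.unop) ↦ (⟨s.1, fun i ↦ by
          refine (app_eq_zero_iff _ _).2 fun x ↦ isEmptyElim x, s.2.2⟩ : OSec k U.unop)
        map_zero' := rfl
        map_add' := fun _ _ ↦ rfl }
    naturality := fun _ _ _ ↦ rfl }

lemma inclO_evalO (k : ℤ) : inclO ι k ≫ evalO ι c hc k = 0 := by
  refine ObjectProperty.hom_ext _ (NatTrans.ext (funext fun U ↦ AddCommGrpCat.hom_ext
    (AddMonoidHom.ext fun (s : twistedIdealSections ι k U.unop) ↦ funext fun x ↦ ?_)))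
  exact (germO_eq_zero_iff ι c hc (⟨s.1, _⟩ : OSec k U.unop)).2 s.2.1 x.1 x.2

/-- The sequence `0 → ℐ_X(k) → 𝒪(k) → 𝒪_X → 0`. -/
abbrev idealComplex (k : ℤ) : ShortComplex (AbSheaf (ProjSp n)) :=
  ShortComplex.mk (inclO ι k) (evalO ι c hc k) (inclO_evalO ι c hc k)

instance mono_inclO (k : ℤ) : Mono (inclO ι k) where
  right_cancellation {Z} f g h := by
    refine ObjectProperty.hom_ext _ (NatTrans.ext (funext fun U ↦ AddCommGrpCat.hom_ext
      (AddMonoidHom.ext fun z ↦ Subtype.ext ?_)))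
    have h1 : (f ≫ inclO ι k).hom.app U z = (g ≫ inclO ι k).hom.app U z := by rw [h]
    exact congrArg (fun s : OSec k U.unop ↦ s.1) h1

/-- The ideal sheaf is the kernel of restriction to `X`. -/
def isLimitIdealComplex (k : ℤ) :
    IsLimit (KernelFork.ofι (inclO ι k) (inclO_evalO ι c hc k)) :=
  KernelFork.IsLimit.ofι' _ _ fun {Z} f hf ↦ by
    have h (U : (Opens (ProjSp n))ᵒᵖ) (z : Z.obj.obj U) :
        ∀ j, ι.app (U.unop ⊓ chart j) ((f.hom.app U z : OSec k U.unop).1 j) = 0 := by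
      refine (germO_eq_zero_iff ι c hc (f.hom.app U z : OSec k U.unop)).1 fun x hx ↦ ?_
      have h1 : (f ≫ evalO ι c hc k).hom.app U z = 0 := by rw [hf]; rfl
      exact congrFun (h1 : _ = (0 : PointSec (T := ProjSp n) (fun x : X ↦ ι x)
        (fun x ↦ X.presheaf.stalk x) U.unop)) (⟨x, hx⟩ : {x : X // ι x ∈ U.unop})
    refine ⟨ObjectProperty.homMk
      { app := fun U ↦ AddCommGrpCat.ofHom
          { toFun := fun z ↦ (⟨(f.hom.app U z : OSec k U.unop).1, h U z,
              (f.hom.app U z : OSec k U.unop).2.2⟩ : twistedIdealSections ι k U.unop)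
            map_zero' := Subtype.ext (congrArg (fun s : OSec k U.unop ↦ s.1) (map_zero _))
            map_add' := fun a b ↦
              Subtype.ext (congrArg (fun s : OSec k U.unop ↦ s.1) (map_add _ a b)) }
        naturality := fun U V i ↦ AddCommGrpCat.hom_ext (AddMonoidHom.ext fun z ↦
          Subtype.ext (congrArg (fun s : OSec k V.unop ↦ s.1)
            congr($(f.hom.naturality i) z))) }, rfl⟩

include hc in
lemma isUnit_intCast (x : X) {m : ℤ} (hm : m ≠ 0) : IsUnit (m : X.presheaf.stalk x) := by
  have h : IsUnit (m : ℂ) := IsUnit.mk0 _ (by exact_mod_cast hm)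
  simpa using h.map ((pullGerm ι x (hc x)).comp (cst (c x)))

/-- The stalks of `X` are divisible, being modules over `ℂ`. -/
@[reducible] def divisibleStalk (x : X) : DivisibleBy (X.presheaf.stalk x) ℤ :=
  divisibleByOfSMulRightSurj _ _ fun {m} hm b ↦ by
    obtain ⟨u, hu⟩ := isUnit_intCast ι c hc x hm
    refine ⟨u⁻¹ * b, ?_⟩
    simp [← hu]

include c hc in
/-- `𝒪_X` has no cohomology in positive degrees: it is injective, since its stalks are divisible. -/
lemma quotSheaf_eq_zero {p : ℕ} (a : HU (quotSheaf ι) (p + 1) ⊤) : a = 0 := by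
  have := divisibleStalk ι c hc
  exact Ext.eq_zero_of_injective a

/-- Surjectivity of `𝒪(k) → 𝒪_X` on global sections, in terms of cohomology in degree zero and in
terms of sections. -/
lemma exists_map_evalO_eq_iff {k : ℤ} :
    (∀ d : HU (quotSheaf ι) 0 ⊤, ∃ b, HU.map (evalO ι c hc k) 0 ⊤ b = d) ↔
      ∀ b : ∀ x : X, X.presheaf.stalk x, ∃ s : OSec k ⊤, ∀ x,
        germO ι c hc k x (Opens.mem_top _) s = b x := by
  refine ⟨fun h b ↦ ?_, fun h d ↦ ?_⟩
  · obtain ⟨d, hd⟩ := h ((H0 (quotSheaf ι) ⊤).symm fun x ↦ b x.1)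
    have h1 := (H0_map (evalO ι c hc k) d).symm.trans
      ((congrArg _ hd).trans (AddEquiv.apply_symm_apply _ _))
    exact ⟨H0O k ⊤ d, fun x ↦ congrFun h1 (⟨x, Opens.mem_top _⟩ : {x // ι x ∈ _})⟩
  · obtain ⟨s, hs⟩ := h fun x ↦ (H0 (quotSheaf ι) ⊤ d : PointSec (T := ProjSp n) (fun x : X ↦ ι x)
      (fun x ↦ X.presheaf.stalk x) ⊤) ⟨x, Opens.mem_top _⟩
    refine ⟨(H0O k ⊤).symm s, (H0 (quotSheaf ι) ⊤).injective ((H0_map _ _).trans ?_)⟩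
    refine (congrArg _ ((H0O k ⊤).apply_symm_apply s)).trans (funext fun x ↦ hs x.1)

variable [IsClosedImmersion ι] [Finite X] [T1Space X]

/-- Near a point of `X` without other points of `X`, a germ on `X` lifts because `X` is a closed
subscheme; away from `X` there is nothing to lift. -/
lemma epi_evalO (k : ℤ) : Epi (evalO ι c hc k) := by
  refine (TopCat.Sheaf.isLocallySurjective_iff_epi (evalO ι c hc k)).1 ?_
  refine (TopCat.Presheaf.isLocallySurjective_iff _).2 fun U b y hy ↦ ?_
  let W : (ProjSp n).Opens := ⟨(ι '' {x | ι x ≠ y})ᶜ,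
    (ι.isClosedEmbedding.isClosedMap _ (Set.toFinite _).isClosed).isOpen_compl⟩
  have hyW : y ∈ W := by
    rintro ⟨x, hx, rfl⟩
    exact hx rfl
  have hW (x : X) (hx : ι x ∈ W) : ι x = y := by
    by_contra h
    exact hx ⟨x, h, rfl⟩
  by_cases hyX : ∃ x, ι x = y
  · obtain ⟨x, rfl⟩ := hyX
    obtain ⟨V₀, hx, f, hf⟩ := exists_pullGerm_eq ι x ((b : PointSec (T := ProjSp n)
      (fun x : X ↦ ι x) (fun x ↦ X.presheaf.stalk x) U) ⟨x, hy⟩)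
    let V := V₀ ⊓ chart (c x) ⊓ (U ⊓ W)
    have hV : V ≤ chart (c x) := inf_le_left.trans inf_le_right
    have hxV : ι x ∈ V := ⟨⟨hx, hc x⟩, hy, hyW⟩
    let s : OSec k V := (trivO (c x) k hV).symm
      ((ProjSp n).presheaf.map (homOfLE (inf_le_left.trans inf_le_left)).op f)
    have hs : trivO (c x) k hV s = _ := AddEquiv.apply_symm_apply _ _
    refine ⟨V, inf_le_right.trans inf_le_left, ⟨s, funext fun x' ↦ ?_⟩, hxV⟩
    obtain ⟨x', hx'⟩ := x'
    obtain rfl : x' = x := ι.isClosedEmbedding.injective (hW x' hx'.2.2)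
    refine Eq.trans ?_ hf
    have h1 := congrArg (pullGerm ι x' hx') hs
    rw [pullGerm_map] at h1
    refine Eq.trans ?_ h1
    exact (pullGerm_map ι x' (le_inf le_rfl hV) hx' (s.1 (c x'))).symm
  · refine ⟨U ⊓ W, inf_le_left, ⟨(0 : OSec k _), funext fun x' ↦ ?_⟩, hy, hyW⟩
    exact absurd ⟨x'.1, hW _ x'.2.2⟩ hyX

lemma idealComplex_shortExact (k : ℤ) : (idealComplex ι c hc k).ShortExact where
  exact := ShortComplex.exact_of_f_is_kernel _ (isLimitIdealComplex ι c hc k)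
  mono_f := mono_inclO ι k
  epi_g := epi_evalO ι c hc k

include c hc in
/-- In degrees `≥ 2` the cohomology of `ℐ_X(k)` is that of `𝒪(k)`. -/
lemma ideal_eq_zero_of_two_le {k : ℤ} {p : ℕ} (h : ∀ a : HU (O n k) (p + 2) ⊤, a = 0)
    (a : HU (idealSheaf ι k) (p + 2) ⊤) : a = 0 :=
  eq_zero_of_map_eq_zero (idealComplex_shortExact ι c hc k) a (h _) fun d ↦
    ⟨0, by rw [map_zero]; exact (quotSheaf_eq_zero ι c hc d).symm⟩

/-- `H¹(ℐ_X(k))` vanishes if `H¹(𝒪(k))` does and forms of degree `k` interpolate all functions on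
`X`. -/
lemma ideal_one_eq_zero {k : ℤ} (hk : ∀ a : HU (O n k) 1 ⊤, a = 0)
    (h : ∀ b : ∀ x : X, X.presheaf.stalk x, ∃ s : OSec k ⊤, ∀ x,
      germO ι c hc k x (Opens.mem_top _) s = b x)
    (a : HU (idealSheaf ι k) 1 ⊤) : a = 0 :=
  eq_zero_of_map_eq_zero (idealComplex_shortExact ι c hc k) a (hk _)
    ((exists_map_evalO_eq_iff ι c hc).2 h)

/-- Conversely, if `H¹(ℐ_X(k)) = 0`, then every function on `X` is the restriction of a section of
`𝒪(k)`. -/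
lemma exists_germO_eq {k : ℤ} (h : ∀ a : HU (idealSheaf ι k) 1 ⊤, a = 0)
    (b : ∀ x : X, X.presheaf.stalk x) :
    ∃ s : OSec k ⊤, ∀ x, germO ι c hc k x (Opens.mem_top _) s = b x :=
  (exists_map_evalO_eq_iff ι c hc).1 (exists_map_eq (idealComplex_shortExact ι c hc k) h) b

end Germs
end ProjSp

/-! ### Local quotients of polynomial rings -/

section LocalAlgebra

variable {A : Type*} [CommRing A] [IsLocalRing A]

lemma maximalIdeal_pow_loewyLength_add_one (h : IsNilpotent (IsLocalRing.maximalIdeal A)) :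
    IsLocalRing.maximalIdeal A ^ (loewyLength A + 1) = ⊥ := by
  obtain ⟨N, hN⟩ := h
  by_contra hne
  have hbdd : BddAbove {i : ℕ | IsLocalRing.maximalIdeal A ^ i ≠ ⊥} := by
    refine ⟨N, fun i hi ↦ ?_⟩
    by_contra hlt
    exact hi (pow_eq_zero_of_le (not_le.1 hlt).le hN)
  exact absurd (le_csSup hbdd hne) (by rw [← loewyLength]; omega)

variable {σ : Type*} [Finite σ] (ψ : MvPolynomial σ ℂ →+* A) (hψ : Function.Surjective ψ)

include hψ

/-- By the Nullstellensatz, a local quotient of `ℂ[X]` is supported at a point of affine space. -/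
lemma exists_point : ∃ b : σ → ℂ, ∀ P, ψ P ∈ IsLocalRing.maximalIdeal A ↔
    MvPolynomial.eval b P = 0 := by
  have h : ((IsLocalRing.maximalIdeal A).comap ψ).IsMaximal :=
    Ideal.comap_isMaximal_of_surjective ψ hψ
  obtain ⟨b, hb⟩ := MvPolynomial.isMaximal_iff_eq_vanishingIdeal_singleton.1 h
  refine ⟨b, fun P ↦ ?_⟩
  rw [← Ideal.mem_comap, hb, MvPolynomial.mem_vanishingIdeal_singleton_iff,
    MvPolynomial.aeval_eq_eval]

/-- If `𝔪 ^ (m + 1) = 0`, then every element of a local quotient of `ℂ[X]` in which `X_c = 1` is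
represented by a form of any degree `e ≥ m`. Indeed the linear forms `Xⱼ - bⱼ X_c` vanishing at the
support lie in `𝔪`, and an element is a polynomial of degree `≤ m` in them. -/
lemma exists_isHomogeneous_eq {c : σ} (hc : ψ (MvPolynomial.X c) = 1) {m : ℕ}
    (hm : IsLocalRing.maximalIdeal A ^ (m + 1) = ⊥) {e : ℕ} (he : m ≤ e) (a : A) :
    ∃ F : MvPolynomial σ ℂ, F.IsHomogeneous e ∧ ψ F = a := by
  obtain ⟨b, hb⟩ := exists_point ψ hψ
  obtain ⟨P, rfl⟩ := hψ a
  let Y (j : σ) : MvPolynomial σ ℂ :=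
    MvPolynomial.X j - MvPolynomial.C (b j) * MvPolynomial.X c
  have hY (j : σ) : (Y j).IsHomogeneous 1 :=
    (MvPolynomial.isHomogeneous_X ℂ j).sub (MvPolynomial.isHomogeneous_C_mul_X _ _)
  have hbc : b c = 1 := by
    have := (hb (MvPolynomial.X c - 1)).1 (by rw [map_sub, hc, map_one, sub_self]; exact zero_mem _)
    simpa [sub_eq_zero] using this
  have hYm (j : σ) : ψ (Y j) ∈ IsLocalRing.maximalIdeal A := by
    rw [hb]
    simp [Y, hbc]
  -- `Q` is the expansion of `P` at the point `b`; homogenize it by substituting `Yⱼ` for `Xⱼ - bⱼ`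
  let Φ : MvPolynomial σ ℂ →ₐ[ℂ] MvPolynomial σ ℂ := MvPolynomial.aeval Y
  let Q : MvPolynomial σ ℂ :=
    MvPolynomial.aeval (fun j ↦ MvPolynomial.X j + MvPolynomial.C (b j)) P
  have hQ : ψ (Φ Q) = ψ P := by
    have : (ψ.comp (Φ.toRingHom.comp (MvPolynomial.aeval (R := ℂ)
        (fun j ↦ (MvPolynomial.X j + MvPolynomial.C (b j) : MvPolynomial σ ℂ))).toRingHom)) = ψ := by
      refine MvPolynomial.ringHom_ext (fun r ↦ ?_) fun j ↦ ?_
      · simp [Φ]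
      · simp [Φ, Y, hc]
    exact congr($this P)
  -- the terms of degree `> m` of the expansion vanish
  have hd (d : ℕ) (hd : m < d) : ψ (Φ (MvPolynomial.homogeneousComponent d Q)) = 0 := by
    have h1 : ψ (Φ (MvPolynomial.homogeneousComponent d Q)) ∈
        (Ideal.span (Set.range fun j ↦ ψ (Y j))) ^ d := by
      rw [Ideal.mem_span_pow_iff_exists_isHomogeneous]
      refine ⟨MvPolynomial.map (ψ.comp MvPolynomial.C)
        (MvPolynomial.homogeneousComponent d Q),
        (MvPolynomial.homogeneousComponent_isHomogeneous d Q).map _, ?_⟩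
      rw [MvPolynomial.eval_map]
      have : MvPolynomial.eval₂Hom (ψ.comp MvPolynomial.C) (fun j ↦ ψ (Y j)) =
          ψ.comp Φ.toRingHom := by
        refine MvPolynomial.ringHom_ext (fun r ↦ ?_) fun j ↦ ?_
        · simp [Φ]
        · simp [Φ]
      exact congr($this _)
    have h2 := Ideal.pow_right_mono (Ideal.span_le.2 (by rintro _ ⟨j, rfl⟩; exact hYm j)) d h1
    have h3 := Ideal.pow_le_pow_right (Nat.succ_le_of_lt hd) h2
    rw [Nat.succ_eq_add_one, hm] at h3
    exact h3
  refine ⟨∑ d ∈ Finset.range (e + 1), Φ (MvPolynomial.homogeneousComponent d Q) *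
    MvPolynomial.X c ^ (e - d), MvPolynomial.IsHomogeneous.sum _ _ _ fun d hd ↦ ?_, ?_⟩
  · have h1 := ((MvPolynomial.homogeneousComponent_isHomogeneous d Q).aeval Y hY).mul
      ((MvPolynomial.isHomogeneous_X ℂ c).pow (e - d))
    convert h1 using 1
    have := Finset.mem_range.1 hd
    omega
  · rw [← hQ]
    conv_rhs => rw [← MvPolynomial.sum_homogeneousComponent Q, map_sum, map_sum]
    rw [map_sum]
    simp only [map_mul, map_pow, hc, one_pow, mul_one]
    have key (N : ℕ) (hN : m + 1 ≤ N) :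
        ∑ d ∈ Finset.range N, ψ (Φ (MvPolynomial.homogeneousComponent d Q)) =
          ∑ d ∈ Finset.range (m + 1), ψ (Φ (MvPolynomial.homogeneousComponent d Q)) := by
      refine (Finset.sum_subset (Finset.range_mono hN) fun d _ h ↦ hd d ?_).symm
      simpa using h
    rw [key (e + 1) (by omega)]
    rcases le_total (m + 1) (Q.totalDegree + 1) with h | h
    · rw [key _ h]
    · refine (Finset.sum_subset (Finset.range_mono h) fun d _ h ↦ ?_).symm
      rw [MvPolynomial.homogeneousComponent_eq_zero _ _ (by simpa using h), map_zero, map_zero]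

end LocalAlgebra

/-! ### The local rings of a finite subscheme -/

namespace ProjSp
open OpenCohomology
variable {n : ℕ}

/-- Dehomogenization: the homomorphism `xⱼ ↦ xⱼ / x_c` from polynomials to regular functions on
`D₊(x_c)`. -/
def dehom (c : Fin (n + 1)) : CoordRing n →+* Γ(ProjSp n, chart c) :=
  MvPolynomial.eval₂Hom (cst c) (ratio c)

lemma ev_cst (c : Fin (n + 1)) (z : ℂ) (x : ProjSp n) (hx : x ∈ chart c) :
    ev x hx (cst c z) = algebraMap _ (RatField n) (MvPolynomial.C z : CoordRing n) := by
  refine (localToRatField_mk x 0 ⟨MvPolynomial.C z, MvPolynomial.isHomogeneous_C _ _⟩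
    ⟨1, MvPolynomial.isHomogeneous_one _ _⟩ (one_notMem_point x)).trans ?_
  simp

lemma sum_eq_of_mem_support {d : ℕ} {F : CoordRing n} (hF : F.IsHomogeneous d)
    {s : Fin (n + 1) →₀ ℕ} (hs : s ∈ F.support) : ∑ j, s j = d := by
  rw [hF.degree_eq_sum_deg_support hs]
  exact (Finset.sum_subset (Finset.subset_univ _) (by simp)).symm

lemma dehom_eq_formRatio (c : Fin (n + 1)) {d : ℕ} {F : CoordRing n} (hF : F.IsHomogeneous d) :
    dehom c F = formRatio c hF := by
  refine ev_ext fun x hx ↦ ?_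
  rw [ev_formRatio]
  have h (G : CoordRing n) : ev x hx (dehom c G) = MvPolynomial.eval₂ (algebraMap ℂ (RatField n))
      (fun j ↦ coord j / coord c) G := by
    have : (ev x hx).comp (dehom c) = MvPolynomial.eval₂Hom (algebraMap ℂ (RatField n))
        (fun j ↦ coord j / coord c) := by
      refine MvPolynomial.ringHom_ext (fun r ↦ ?_) fun j ↦ ?_
      · simp only [dehom, RingHom.comp_apply, MvPolynomial.coe_eval₂Hom, MvPolynomial.eval₂_C,
          ev_cst]
        rfl
      · simp [dehom, ev_ratio]
    exact congr($this G)
  have h' (G : CoordRing n) : algebraMap _ (RatField n) G =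
      MvPolynomial.eval₂ (algebraMap ℂ (RatField n)) (fun j ↦ coord j) G := by
    have : algebraMap _ (RatField n) =
        MvPolynomial.eval₂Hom (algebraMap ℂ (RatField n)) (fun j ↦ coord j) := by
      refine MvPolynomial.ringHom_ext (fun r ↦ ?_) fun j ↦ ?_
      · simp
        rfl
      · simp [coord]
    exact congr($this G)
  rw [h, h', MvPolynomial.eval₂_eq', MvPolynomial.eval₂_eq', Finset.sum_div]
  refine Finset.sum_congr rfl fun s hs ↦ ?_
  have hs' := sum_eq_of_mem_support hF hs
  simp only [div_pow]
  rw [Finset.prod_div_distrib, Finset.prod_pow_eq_pow_sum, hs', mul_div_assoc]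

lemma exists_formRatio_eq (c : Fin (n + 1)) (f : Γ(ProjSp n, chart c)) :
    ∃ (d : ℕ) (F : CoordRing n) (hF : F.IsHomogeneous d), formRatio c hF = f := by
  have hX := MvPolynomial.isHomogeneous_X ℂ c
  let e := Proj.basicOpenIsoAway (grading n) (MvPolynomial.X c) hX one_pos
  obtain ⟨d, F, hF, h⟩ := HomogeneousLocalization.Away.mk_surjective (grading n) hX (e.inv f)
  refine ⟨d, F, by simpa using hF, ?_⟩
  refine Eq.trans ?_ congr($(e.inv_hom_id) f)
  exact congrArg e.hom h

lemma dehom_surjective (c : Fin (n + 1)) : Function.Surjective (dehom c) := by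
  intro f
  obtain ⟨d, F, hF, rfl⟩ := exists_formRatio_eq c f
  exact ⟨F, dehom_eq_formRatio c hF⟩

lemma dehom_X_self (c : Fin (n + 1)) : dehom c (MvPolynomial.X c) = 1 := by
  refine ev_ext fun x hx ↦ ?_
  rw [dehom, MvPolynomial.coe_eval₂Hom, MvPolynomial.eval₂_X, ev_ratio, map_one,
    div_self (coord_ne_zero c)]

section Stalks

variable {X : Scheme.{0}}

/-- On a discrete scheme germs extend by zero. -/
lemma germ_surjective_of_discrete [DiscreteTopology X] (U : X.Opens) (x : X) (hx : x ∈ U) :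
    Function.Surjective (X.presheaf.germ U x hx) := by
  classical
  intro b
  obtain ⟨V, hxV, t, rfl⟩ := X.presheaf.exists_germ_eq b
  let S (y : U) : X.Opens := ⟨{y.1}, isOpen_discrete _⟩
  have hS (y : U) (h : y.1 = x) : S y ≤ V := fun z hz ↦ by
    rw [show z = y.1 from hz, h]
    exact hxV
  let sf (y : U) : Γ(X, S y) :=
    if h : y.1 = x then X.presheaf.map (homOfLE (hS y h)).op t else 0
  have hcomp : TopCat.Presheaf.IsCompatible X.sheaf.1 S sf := by
    intro y z
    rcases eq_or_ne y z with rfl | hyz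
    · rfl
    · have hbot : S y ⊓ S z = ⊥ := by
        refine le_bot_iff.1 fun w hw ↦ hyz (Subtype.ext ?_)
        exact (show w = y.1 from hw.1).symm.trans hw.2
      have : Subsingleton Γ(X, S y ⊓ S z) := by
        rw [hbot]
        infer_instance
      exact Subsingleton.elim (α := Γ(X, S y ⊓ S z)) _ _
  obtain ⟨s, hs, -⟩ := X.sheaf.existsUnique_gluing' S U (fun y ↦ homOfLE fun z hz ↦ by
    rw [show z = y.1 from hz]; exact y.2) (fun z hz ↦ Opens.mem_iSup.2 ⟨⟨z, hz⟩, rfl⟩) sf hcomp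
  refine ⟨s, ?_⟩
  have h1 := hs ⟨x, hx⟩
  have h2 : sf ⟨x, hx⟩ = X.presheaf.map (homOfLE (hS ⟨x, hx⟩ rfl)).op t := dif_pos rfl
  have h3 := congrArg (X.presheaf.germ (S ⟨x, hx⟩) x rfl) (h1.trans h2)
  exact ((X.presheaf.germ_res_apply _ x rfl s).symm.trans h3).trans
    (X.presheaf.germ_res_apply _ x rfl t)

lemma isNilpotent_of_mem_maximalIdeal [DiscreteTopology X] (x : X) (a : X.presheaf.stalk x)
    (ha : a ∈ IsLocalRing.maximalIdeal (X.presheaf.stalk x)) : IsNilpotent a := by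
  let S : X.Opens := ⟨{x}, isOpen_discrete _⟩
  have hx : x ∈ S := rfl
  obtain ⟨f, rfl⟩ := germ_surjective_of_discrete S x hx a
  have hf : X.basicOpen f = ⊥ := by
    refine le_bot_iff.1 fun y hy ↦ ?_
    obtain rfl : y = x := X.basicOpen_le f hy
    exact ha ((X.mem_basicOpen f y hx).1 hy)
  have := (Scheme.isNilpotent_iff_basicOpen_eq_bot_of_isCompact (U := S)
    isCompact_singleton f).2 hf
  exact this.map (X.presheaf.germ S x hx).hom

variable (ι : X ⟶ ProjSp n)

lemma isUnit_pullGerm_iff (x : X) {V : (ProjSp n).Opens} (hx : ι x ∈ V) (f : Γ(ProjSp n, V)) :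
    IsUnit (pullGerm ι x hx f) ↔ ι x ∈ (ProjSp n).basicOpen f := by
  rw [Scheme.mem_basicOpen _ _ _ hx, pullGerm_apply, ← ι.germ_stalkMap_apply]
  exact isUnit_map_iff (ι.stalkMap x).hom _

/-- The homomorphism from the coordinate ring to the local ring of `X` at a point `x` in the chart
`D₊(x_c)`. -/
def toStalk {c : Fin (n + 1)} (x : X) (hx : ι x ∈ chart c) : CoordRing n →+* X.presheaf.stalk x :=
  (pullGerm ι x hx).comp (dehom c)

variable {c : Fin (n + 1)} (x : X) (hx : ι x ∈ chart c)

lemma toStalk_X_self : toStalk ι x hx (MvPolynomial.X c) = 1 := by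
  rw [toStalk, RingHom.comp_apply, dehom_X_self, map_one]

lemma toStalk_mem_maximalIdeal_iff {d : ℕ} {F : CoordRing n} (hF : F.IsHomogeneous d) :
    toStalk ι x hx F ∈ IsLocalRing.maximalIdeal (X.presheaf.stalk x) ↔
      F ∈ (ι x).asHomogeneousIdeal := by
  rw [IsLocalRing.mem_maximalIdeal, mem_nonunits_iff, toStalk, RingHom.comp_apply,
    dehom_eq_formRatio c hF, isUnit_pullGerm_iff, basicOpen_formRatio, not_iff_comm]
  exact ⟨fun h ↦ ⟨hx, h⟩, fun h ↦ h.2⟩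

variable [IsClosedImmersion ι] [DiscreteTopology X]

lemma toStalk_surjective : Function.Surjective (toStalk ι x hx) := by
  rw [toStalk, pullGerm]
  exact ((germ_surjective_of_discrete _ x hx).comp
    (ι.app_surjective (chart c) (isAffineOpen_chart c))).comp (dehom_surjective c)

include hx in
/-- The local rings of a finite subscheme are Noetherian with nil maximal ideal. -/
lemma isNilpotent_maximalIdeal : IsNilpotent (IsLocalRing.maximalIdeal (X.presheaf.stalk x)) := by
  have : IsNoetherianRing (X.presheaf.stalk x) :=
    isNoetherianRing_of_surjective _ _ _ (toStalk_surjective ι x hx)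
  obtain ⟨N, hN⟩ := IsNoetherianRing.isNilpotent_nilradical (X.presheaf.stalk x)
  refine ⟨N, le_bot_iff.1 ((Ideal.pow_right_mono ?_ N).trans hN.le)⟩
  exact fun a ha ↦ isNilpotent_of_mem_maximalIdeal x a ha

/-- A linear form vanishing at one point of `X` and not at another. -/
lemma exists_linearForm {x x' : X} (hxx' : x ≠ x') : ∃ L : CoordRing n, L.IsHomogeneous 1 ∧
    L ∈ (ι x').asHomogeneousIdeal ∧ L ∉ (ι x).asHomogeneousIdeal := by
  obtain ⟨c, hx⟩ := exists_mem_chart (ι x)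
  obtain ⟨c', hx'⟩ := exists_mem_chart (ι x')
  obtain ⟨b, hb⟩ := exists_point _ (toStalk_surjective ι x hx)
  obtain ⟨b', hb'⟩ := exists_point _ (toStalk_surjective ι x' hx')
  have h {d : ℕ} {F : CoordRing n} (hF : F.IsHomogeneous d) :
      F ∈ (ι x).asHomogeneousIdeal ↔ MvPolynomial.eval b F = 0 := by
    rw [← hb, toStalk_mem_maximalIdeal_iff ι x hx hF]
  have h' {d : ℕ} {F : CoordRing n} (hF : F.IsHomogeneous d) :
      F ∈ (ι x').asHomogeneousIdeal ↔ MvPolynomial.eval b' F = 0 := by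
    rw [← hb', toStalk_mem_maximalIdeal_iff ι x' hx' hF]
  have hb'c : b' c' ≠ 0 := fun h0 ↦ hx' ((h' (MvPolynomial.isHomogeneous_X ℂ c')).2 (by simpa))
  have hbc : b c ≠ 0 := fun h0 ↦ hx ((h (MvPolynomial.isHomogeneous_X ℂ c)).2 (by simpa))
  -- otherwise all `bⱼ b'_{c'} - b'ⱼ b_{c'}` vanish, so that `b` and `b'` are proportional
  by_contra! H
  have key (j : Fin (n + 1)) : b j = b c' / b' c' * b' j := by
    have hL : (MvPolynomial.C (b' c') * MvPolynomial.X j - MvPolynomial.C (b' j) *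
        MvPolynomial.X c' : CoordRing n).IsHomogeneous 1 :=
      (MvPolynomial.isHomogeneous_C_mul_X _ _).sub (MvPolynomial.isHomogeneous_C_mul_X _ _)
    have := (h hL).1 (H _ hL ((h' hL).2 (by simp; ring)))
    simp only [map_sub, map_mul, MvPolynomial.eval_C, MvPolynomial.eval_X] at this
    field_simp
    linear_combination this
  set r := b c' / b' c'
  have hr : r ≠ 0 := by
    rintro hr
    exact hbc (by rw [key c, hr, zero_mul])
  have heval {d : ℕ} {F : CoordRing n} (hF : F.IsHomogeneous d) :
      MvPolynomial.eval b F = r ^ d * MvPolynomial.eval b' F := by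
    rw [MvPolynomial.eval_eq', MvPolynomial.eval_eq', Finset.mul_sum]
    refine Finset.sum_congr rfl fun s hs ↦ ?_
    have hs' := sum_eq_of_mem_support hF hs
    simp only [key]
    simp only [mul_pow]
    rw [Finset.prod_mul_distrib, Finset.prod_pow_eq_pow_sum, hs']
    ring
  refine hxx' (ι.isClosedEmbedding.injective (ProjectiveSpectrum.ext (HomogeneousIdeal.ext' ?_)))
  intro d F hF
  rw [h hF, h' hF, heval hF, mul_eq_zero, or_iff_right (pow_ne_zero _ hr)]

end Stalks

end ProjSp

/-! ### Interpolation by forms and the bound on the regularity -/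

namespace ProjSp
open OpenCohomology
variable {n : ℕ}

/-- The global section of `𝒪(k)` given by a form of degree `k`. -/
def formO {d : ℕ} {k : ℤ} {F : CoordRing n} (hF : F.IsHomogeneous d) (hk : k = d) :
    OSec k (⊤ : (ProjSp n).Opens) :=
  mkOSec (fun _ ↦ algebraMap _ (RatField n) F) (hk ▸ isSec_form hF)

section

variable {X : Scheme.{0}} (ι : X ⟶ ProjSp n) (c : X → Fin (n + 1)) (hc : ∀ x, ι x ∈ chart (c x))

lemma germO_formO {d : ℕ} {k : ℤ} {F : CoordRing n} (hF : F.IsHomogeneous d) (hk : k = d) (x : X) :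
    germO ι c hc k x (Opens.mem_top _) (formO hF hk) = toStalk ι x (hc x) F := by
  have h : (formO hF hk).1 (c x) = (ProjSp n).presheaf.map
      (homOfLE (inf_le_right : ⊤ ⊓ chart (c x) ≤ _)).op (formRatio (c x) hF) := by
    refine ev_ext fun y hy ↦ ?_
    rw [ev_map, ev_formRatio, ev_eq_tval, formO, tval_mkOSec _ hy.1, hk, zpow_neg, zpow_natCast,
      inv_mul_eq_div]
  rw [germO_apply, h, pullGerm_map, toStalk, RingHom.comp_apply, dehom_eq_formRatio _ hF]

variable [IsClosedImmersion ι] [DiscreteTopology X] [Fintype X]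

/-- If `k ≥ ∑ (μₓ + 1) - 1`, then every function on `X` is given by a form of degree `k`. For a
function supported at `x` take a multiple of a product of powers of linear forms which vanish at the
other points but not at `x`. -/
lemma exists_germO_eq_of_le {k : ℤ}
    (hk : (∑ x : X, (loewyLength (X.presheaf.stalk x) + 1 : ℤ)) - 1 ≤ k)
    (b : ∀ x : X, X.presheaf.stalk x) :
    ∃ s : OSec k (⊤ : (ProjSp n).Opens), ∀ x, germO ι c hc k x (Opens.mem_top _) s = b x := by
  classical
  let μ (x : X) : ℕ := loewyLength (X.presheaf.stalk x)
  have hμ (x : X) := maximalIdeal_pow_loewyLength_add_one (isNilpotent_maximalIdeal ι x (hc x))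
  suffices H : ∀ x, ∃ s : OSec k (⊤ : (ProjSp n).Opens), ∀ y,
      germO ι c hc k y (Opens.mem_top _) s = if y = x then b y else 0 by
    choose s hs using H
    refine ⟨∑ x, s x, fun y ↦ ?_⟩
    rw [map_sum, Finset.sum_congr rfl fun x _ ↦ hs x y]
    simp
  intro x
  have hL (y : X) : ∃ L : CoordRing n, L.IsHomogeneous 1 ∧
      (y ≠ x → L ∈ (ι y).asHomogeneousIdeal ∧ L ∉ (ι x).asHomogeneousIdeal) := by
    by_cases h : y = x
    · exact ⟨0, MvPolynomial.isHomogeneous_zero _ _ _, fun h' ↦ absurd h h'⟩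
    · obtain ⟨L, h1, h2, h3⟩ := exists_linearForm ι (Ne.symm h)
      exact ⟨L, h1, fun _ ↦ ⟨h2, h3⟩⟩
  choose L hL1 hL2 using hL
  -- `G` vanishes on the components of `X` other than the one at `x`, where it is a unit
  let G : CoordRing n := ∏ y ∈ Finset.univ.erase x, L y ^ (μ y + 1)
  have hG : G.IsHomogeneous (∑ y ∈ Finset.univ.erase x, (μ y + 1)) :=
    MvPolynomial.IsHomogeneous.prod _ _ _ fun y _ ↦ by simpa using (hL1 y).pow (μ y + 1)
  have hGx : IsUnit (toStalk ι x (hc x) G) := by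
    by_contra h
    have h1 := (toStalk_mem_maximalIdeal_iff ι x (hc x) hG).1 h
    obtain ⟨y, hy, hy'⟩ := ((ι x).isPrime.prod_mem_iff).1 h1
    exact (hL2 y (Finset.ne_of_mem_erase hy)).2 ((ι x).isPrime.mem_of_pow_mem _ hy')
  have hGy (y : X) (hy : y ≠ x) : toStalk ι y (hc y) G = 0 := by
    have h1 : toStalk ι y (hc y) (L y ^ (μ y + 1)) = 0 := by
      rw [map_pow]
      have := Ideal.pow_mem_pow ((toStalk_mem_maximalIdeal_iff ι y (hc y) (hL1 y)).2
        (hL2 y hy).1) (μ y + 1)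
      rwa [hμ y] at this
    rw [map_prod]
    exact Finset.prod_eq_zero (Finset.mem_erase.2 ⟨hy, Finset.mem_univ y⟩) h1
  have hsum : (∑ x : X, (loewyLength (X.presheaf.stalk x) + 1 : ℤ)) =
      (∑ y ∈ Finset.univ.erase x, (μ y + 1) : ℕ) + (μ x + 1 : ℕ) := by
    rw [← Finset.sum_erase_add _ _ (Finset.mem_univ x)]
    push_cast
    rfl
  obtain ⟨e, he⟩ : ∃ e : ℕ, k = ((e + ∑ y ∈ Finset.univ.erase x, (μ y + 1) : ℕ) : ℤ) ∧ μ x ≤ e := by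
    refine ⟨(k - (∑ y ∈ Finset.univ.erase x, (μ y + 1) : ℕ)).toNat, ?_, ?_⟩
    · push_cast at hsum ⊢
      omega
    · push_cast at hsum ⊢
      omega
  obtain ⟨F, hF, hFx⟩ := exists_isHomogeneous_eq _ (toStalk_surjective ι x (hc x))
    (toStalk_X_self ι x (hc x)) (hμ x) he.2 (↑hGx.unit⁻¹ * b x)
  refine ⟨formO (hF.mul hG) he.1, fun y ↦ ?_⟩
  rw [germO_formO, map_mul]
  split_ifs with h
  · subst h
    rw [hFx, mul_right_comm, IsUnit.val_inv_mul, one_mul]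
  · rw [hGy y h, mul_zero]

end

section Vanishing

variable {X : Scheme.{0}} (ι : X ⟶ ProjSp n) [IsClosedImmersion ι] [Fintype X] [T1Space X]

/-- For `n = 0` this holds for dimension reasons, as `-1 ≤ k` does not imply `-n ≤ k`. -/
lemma O_one_eq_zero {k : ℤ} (hk : -1 ≤ k) (a : HU (O n k) 1 ⊤) : a = 0 := by
  rcases n.eq_zero_or_pos with rfl | hn
  · exact eq_zero_of_lt one_pos a
  · exact eq_zero_of_neg_le (by omega) a

theorem subsingleton_idealCohomology_one {k : ℤ}
    (hk : (∑ x : X, (loewyLength (X.presheaf.stalk x) + 1 : ℤ)) - 1 ≤ k) :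
    Subsingleton (idealCohomology ι 1 k) := by
  choose c hc using fun x : X ↦ exists_mem_chart (ι x)
  have h0 : 0 ≤ ∑ x : X, (loewyLength (X.presheaf.stalk x) + 1 : ℤ) :=
    Finset.sum_nonneg fun _ _ ↦ by positivity
  refine subsingleton_H_iff.2 fun a ↦ ?_
  exact ideal_one_eq_zero ι c hc (O_one_eq_zero (by omega)) (exists_germO_eq_of_le ι c hc hk) a

theorem isRegular_of_le {m : ℤ}
    (hm : (∑ x : X, (loewyLength (X.presheaf.stalk x) + 1 : ℤ)) ≤ m) : IsRegular ι m := by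
  intro i hi
  obtain ⟨i, rfl⟩ := Nat.exists_eq_add_of_le' hi
  rcases i with _ | i
  · exact subsingleton_idealCohomology_one ι (by push_cast; omega)
  choose c hc using fun x : X ↦ exists_mem_chart (ι x)
  have h0 : 0 ≤ ∑ x : X, (loewyLength (X.presheaf.stalk x) + 1 : ℤ) :=
    Finset.sum_nonneg fun _ _ ↦ by positivity
  refine subsingleton_H_iff.2 fun a ↦ ideal_eq_zero_of_two_le ι c hc (fun a ↦ ?_) a
  rcases lt_or_ge n (i + 2) with h | h
  · exact eq_zero_of_lt h a
  · exact eq_zero_of_neg_le (by push_cast; omega) a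

end Vanishing

end ProjSp

/-! ### Multiple points on the affine line -/

section FatPoints

/-- The Loewy length of a localization at a principal prime `(z)` is the last exponent `m` for which
`z ^ m` survives. -/
lemma loewyLength_eq_of_isLocalization {R A : Type*} [CommRing R] [CommRing A] [IsLocalRing A]
    [Algebra R A] (P : Ideal R) [P.IsPrime] [IsLocalization.AtPrime A P] {z : R}
    (hP : P = Ideal.span {z}) {m : ℕ} {s : R} (hs : s ∉ P) (hsz : s * z ^ (m + 1) = 0)
    (hz : ∀ s ∉ P, s * z ^ m ≠ 0) : loewyLength A = m := by
  have hM : IsLocalRing.maximalIdeal A = Ideal.span {algebraMap R A z} := by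
    rw [← IsLocalization.AtPrime.map_eq_maximalIdeal P A, hP, Ideal.map_span, Set.image_singleton]
  have key (i : ℕ) : IsLocalRing.maximalIdeal A ^ i ≠ ⊥ ↔ i ≤ m := by
    rw [hM, Ideal.span_singleton_pow, Ne, Ideal.span_singleton_eq_bot, ← map_pow,
      IsLocalization.map_eq_zero_iff P.primeCompl]
    refine ⟨fun h ↦ ?_, fun h ⟨t, ht⟩ ↦ hz t t.2 ?_⟩
    · by_contra hlt
      refine h ⟨⟨s, hs⟩, ?_⟩
      rw [← Nat.sub_add_cancel (Nat.succ_le_of_lt (not_le.1 hlt)), Nat.succ_eq_add_one,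
        pow_add, mul_left_comm, hsz, mul_zero]
    · rw [← Nat.sub_add_cancel h, pow_add, mul_left_comm, ht, mul_zero]
  have : {i : ℕ | IsLocalRing.maximalIdeal A ^ i ≠ ⊥} = Set.Iic m := Set.ext key
  rw [loewyLength, this, csSup_Iic]

open Polynomial

variable {t : ℕ} (a : Fin t → ℂ) (μ : Fin t → ℕ)

/-- The polynomial `∏ᵢ (X - aᵢ) ^ (μᵢ + 1)`, whose zero scheme consists of the points `aᵢ` of the
affine line with multiplicities `μᵢ + 1`. -/
def fatPoly : ℂ[X] := ∏ i, (X - C (a i)) ^ (μ i + 1)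

lemma fatPoly_monic : (fatPoly a μ).Monic :=
  monic_prod_of_monic _ _ fun i _ ↦ (monic_X_sub_C (a i)).pow _

lemma natDegree_fatPoly : (fatPoly a μ).natDegree = ∑ i, (μ i + 1) := by
  rw [fatPoly, natDegree_prod_of_monic _ _ fun i _ ↦ (monic_X_sub_C (a i)).pow _]
  simp

lemma fatPoly_eq (i : Fin t) : fatPoly a μ =
    (∏ j ∈ Finset.univ.erase i, (X - C (a j)) ^ (μ j + 1)) * (X - C (a i)) ^ (μ i + 1) :=
  (Finset.prod_erase_mul _ _ (Finset.mem_univ i)).symm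

/-- Evaluation at the point `aᵢ`. -/
def fatEval (i : Fin t) : AdjoinRoot (fatPoly a μ) →+* ℂ :=
  AdjoinRoot.lift (RingHom.id ℂ) (a i) (by simp [fatPoly_eq a μ i])

lemma fatEval_mk (i : Fin t) (p : ℂ[X]) :
    fatEval a μ i (AdjoinRoot.mk _ p) = p.eval (a i) := by
  rw [fatEval, AdjoinRoot.lift_mk, eval₂_id]

/-- The point `aᵢ` of the spectrum of `ℂ[X] / ∏ᵢ (X - aᵢ) ^ (μᵢ + 1)`. -/
def fatPoint (i : Fin t) : PrimeSpectrum (AdjoinRoot (fatPoly a μ)) :=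
  ⟨RingHom.ker (fatEval a μ i), RingHom.ker_isPrime _⟩

lemma mk_mem_fatPoint (i : Fin t) (p : ℂ[X]) :
    AdjoinRoot.mk _ p ∈ (fatPoint a μ i).asIdeal ↔ p.eval (a i) = 0 := by
  rw [← fatEval_mk a μ]
  rfl

lemma fatPoint_eq_span (i : Fin t) :
    (fatPoint a μ i).asIdeal = Ideal.span {AdjoinRoot.mk _ (X - C (a i))} := by
  refine le_antisymm (fun f hf ↦ ?_) ?_
  · obtain ⟨p, rfl⟩ := AdjoinRoot.mk_surjective f
    rw [mk_mem_fatPoint, ← IsRoot, ← dvd_iff_isRoot] at hf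
    exact Ideal.mem_span_singleton.2 (map_dvd _ hf)
  · rw [Ideal.span_le, Set.singleton_subset_iff, SetLike.mem_coe, mk_mem_fatPoint]
    simp

lemma isMaximal_fatPoint (i : Fin t) : (fatPoint a μ i).asIdeal.IsMaximal :=
  RingHom.ker_isMaximal_of_surjective _ fun z ↦ ⟨AdjoinRoot.mk _ (C z), by rw [fatEval_mk, eval_C]⟩

variable {a}

lemma fatPoint_bijective (ha : Function.Injective a) : Function.Bijective (fatPoint a μ) := by
  refine ⟨fun i j h ↦ ha ?_, fun q ↦ ?_⟩
  · have h1 := (mk_mem_fatPoint a μ i (X - C (a i))).2 (by simp)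
    rw [h, mk_mem_fatPoint] at h1
    simpa [sub_eq_zero, eq_comm] using h1
  · have h0 : AdjoinRoot.mk (fatPoly a μ) (∏ i, (X - C (a i)) ^ (μ i + 1)) ∈ q.asIdeal := by
      rw [← fatPoly, AdjoinRoot.mk_self]
      exact zero_mem _
    rw [map_prod, q.isPrime.prod_mem_iff] at h0
    obtain ⟨i, -, hi⟩ := h0
    rw [map_pow] at hi
    refine ⟨i, PrimeSpectrum.ext ((isMaximal_fatPoint a μ i).eq_of_le q.isPrime.ne_top ?_)⟩
    rw [fatPoint_eq_span, Ideal.span_le, Set.singleton_subset_iff]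
    exact q.isPrime.mem_of_pow_mem _ hi

lemma loewyLength_fatPoint (ha : Function.Injective a) (i : Fin t) {A : Type*} [CommRing A]
    [IsLocalRing A] [Algebra (AdjoinRoot (fatPoly a μ)) A]
    [IsLocalization.AtPrime A (fatPoint a μ i).asIdeal] : loewyLength A = μ i := by
  refine loewyLength_eq_of_isLocalization (s := AdjoinRoot.mk _
    (∏ j ∈ Finset.univ.erase i, (X - C (a j)) ^ (μ j + 1))) _ (fatPoint_eq_span a μ i) ?_ ?_ ?_
  · rw [mk_mem_fatPoint, eval_prod, Finset.prod_eq_zero_iff]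
    rintro ⟨j, hj, h⟩
    have := eq_zero_of_pow_eq_zero (by simpa using h : (a i - a j) ^ (μ j + 1) = 0)
    exact Finset.ne_of_mem_erase hj (ha (sub_eq_zero.1 this)).symm
  · rw [← map_pow, ← map_mul, ← fatPoly_eq, AdjoinRoot.mk_self]
  · intro s hs h
    obtain ⟨p, rfl⟩ := AdjoinRoot.mk_surjective s
    rw [mk_mem_fatPoint] at hs
    rw [← map_pow, ← map_mul, AdjoinRoot.mk_eq_zero] at h
    have h1 := (Dvd.intro_left _ (fatPoly_eq a μ i).symm).trans h
    rw [pow_succ', mul_dvd_mul_iff_right (pow_ne_zero _ (X_sub_C_ne_zero _))] at h1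
    exact hs (dvd_iff_isRoot.1 h1)

end FatPoints

/-! ### Closed subschemes of a chart -/

namespace ProjSp
open OpenCohomology
variable {n : ℕ}

section AffineChart

variable {c : Fin (n + 1)}

/-- The morphism to projective space defined by a homomorphism from the ring of functions on a
chart. -/
def ofChart {R : CommRingCat.{0}} (φ : Γ(ProjSp n, chart c) ⟶ R) : Spec R ⟶ ProjSp n :=
  Spec.map φ ≫ (isAffineOpen_chart c).fromSpec

variable {R : CommRingCat.{0}} (φ : Γ(ProjSp n, chart c) ⟶ R)

lemma ofChart_mem_chart (x : Spec R) : ofChart φ x ∈ chart c := by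
  have h : (isAffineOpen_chart c).fromSpec (Spec.map φ x) ∈
      Set.range (isAffineOpen_chart c).fromSpec := ⟨_, rfl⟩
  rw [IsAffineOpen.range_fromSpec] at h
  exact h

lemma pullGerm_ofChart (x : Spec R) (f : Γ(ProjSp n, chart c)) :
    pullGerm (ofChart φ) x (ofChart_mem_chart φ x) f =
      (Spec R).presheaf.germ ⊤ x trivial ((Scheme.ΓSpecIso R).inv (φ f)) := by
  have h : (ofChart φ).app (chart c) = φ ≫ (Scheme.ΓSpecIso R).inv ≫
      (Spec R).presheaf.map (homOfLE le_top).op := by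
    rw [ofChart, Scheme.Hom.comp_app, (isAffineOpen_chart c).fromSpec_app_of_le _ le_rfl]
    have h1 := Scheme.ΓSpecIso_inv_naturality φ
    rw [reassoc_of% h1]
    simp [Scheme.Hom.appTop]
  rw [pullGerm_apply, h]
  exact (Spec R).presheaf.germ_res_apply (homOfLE le_top) x (ofChart_mem_chart φ x) _

lemma X_mem_grading (c : Fin (n + 1)) : (MvPolynomial.X c : CoordRing n) ∈ grading n 1 :=
  MvPolynomial.isHomogeneous_X ℂ c

/-- The identification of the degree zero part of `ℂ[x₀, …, xₙ]` localized at `x_c` with the ring of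
functions on `D₊(x_c)`. -/
def awayIso (c : Fin (n + 1)) :
    CommRingCat.of (HomogeneousLocalization.Away (grading n) (MvPolynomial.X c)) ≅
      Γ(ProjSp n, chart c) :=
  Proj.basicOpenIsoAway (grading n) (MvPolynomial.X c) (X_mem_grading c) one_pos

lemma fromSpec_chart (c : Fin (n + 1)) : (isAffineOpen_chart c).fromSpec =
    Spec.map (awayIso c).hom ≫
      Proj.awayι (grading n) (MvPolynomial.X c) (X_mem_grading c) one_pos := by
  have h1 : (isAffineOpen_chart c).isoSpec.hom ≫ Spec.map (awayIso c).hom =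
      (Proj.basicOpenIsoSpec (grading n) (MvPolynomial.X c) (X_mem_grading c) one_pos).hom := rfl
  have h2 : (Proj.basicOpenIsoSpec (grading n) (MvPolynomial.X c) (X_mem_grading c) one_pos).hom ≫
      Proj.awayι (grading n) (MvPolynomial.X c) (X_mem_grading c) one_pos = (chart c).ι :=
    Iso.hom_inv_id_assoc _ _
  refine (Iso.inv_comp_eq _).2 (Eq.symm ?_)
  rw [← Category.assoc, h1]
  exact h2

/-- A closed subscheme of an affine chart which is finite over `ℂ` is closed in projective space,
since it is proper. -/
lemma isClosedImmersion_ofChart (hφ : Function.Surjective φ)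
    (hfin : (φ.hom.comp (cst c)).Finite) : IsClosedImmersion (ofChart φ) := by
  have h1 : IsClosedImmersion (Spec.map φ) := IsClosedImmersion.spec_of_surjective φ hφ
  have h2 : IsPreimmersion (ofChart φ) := by
    rw [ofChart]
    infer_instance
  have h3 : IsFinite (ofChart φ ≫ Proj.toSpecZero (grading n)) := by
    have h : ofChart φ ≫ Proj.toSpecZero (grading n) = Spec.map (CommRingCat.ofHom
        (HomogeneousLocalization.fromZeroRingHom (grading n)
          (Submonoid.powers (MvPolynomial.X c : CoordRing n))) ≫ (awayIso c).hom ≫ φ) := by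
      rw [ofChart, fromSpec_chart, Spec.map_comp, Spec.map_comp, Category.assoc, Category.assoc,
        Category.assoc, Proj.awayι_toSpecZero]
    rw [h, IsFinite.SpecMap_iff]
    exact RingHom.Finite.of_comp_finite (f := algebraMap ℂ (grading n 0)) hfin
  have h4 : IsProper (ofChart φ) := IsProper.of_comp _ (Proj.toSpecZero (grading n))
  exact .of_isPreimmersion _ (ofChart φ).isClosedMap.isClosed_range

end AffineChart

/-! ### Restriction to a line -/

open Polynomial

section Line

variable {c d : Fin (n + 1)}

/-- Restriction of a form to the line with coordinates `x_c = 1`, `x_d = X` and other coordinates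
zero. -/
def subst (c d : Fin (n + 1)) : CoordRing n →ₐ[ℂ] ℂ[X] :=
  MvPolynomial.aeval fun j ↦ if j = c then 1 else if j = d then X else 0

lemma subst_X_left : subst c d (MvPolynomial.X c) = 1 := by simp [subst]

lemma subst_X_right (h : d ≠ c) : subst c d (MvPolynomial.X d) = X := by simp [subst, h]

lemma natDegree_subst_le {e : ℕ} {F : CoordRing n} (hF : F.IsHomogeneous e) :
    (subst c d F).natDegree ≤ e := by
  refine (MvPolynomial.aeval_natDegree_le F hF.totalDegree_le _ (n := 1) fun j ↦ ?_).trans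
    (mul_one e).le
  split_ifs <;> simp

variable (c d)

/-- The extension of `subst` to the localization at `x_c`. -/
def substAway : Localization.Away (MvPolynomial.X c : CoordRing n) →+* ℂ[X] :=
  IsLocalization.Away.lift (MvPolynomial.X c : CoordRing n) (g := (subst c d).toRingHom)
    ((subst_X_left (c := c) (d := d)) ▸ isUnit_one)

lemma substAway_algebraMap (F : CoordRing n) :
    substAway c d (algebraMap _ _ F) = subst c d F :=
  IsLocalization.Away.lift_eq _ _ F

/-- Restriction of functions on the chart `D₊(x_c)` to the line with coordinate `x_d / x_c`. -/
def lineHom : Γ(ProjSp n, chart c) →+* ℂ[X] :=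
  ((substAway c d).comp
    (algebraMap (HomogeneousLocalization.Away (grading n) (MvPolynomial.X c)) _)).comp
    (awayIso c).inv.hom

lemma lineHom_awayIso (y : HomogeneousLocalization.Away (grading n) (MvPolynomial.X c)) :
    lineHom c d ((awayIso c).hom y) = substAway c d y.val := by
  have h := congr($((awayIso c).hom_inv_id) y)
  exact congrArg (fun z : HomogeneousLocalization.Away (grading n) (MvPolynomial.X c) ↦
    substAway c d z.val) h

lemma lineHom_cst (z : ℂ) : lineHom c d (cst c z) = C z := by
  refine (lineHom_awayIso c d _).trans ?_
  refine (substAway_algebraMap c d (MvPolynomial.C z)).trans ?_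
  exact MvPolynomial.aeval_C _ z

lemma lineHom_formRatio {e : ℕ} {F : CoordRing n} (hF : F.IsHomogeneous e) :
    lineHom c d (formRatio c hF) = subst c d F := by
  refine (lineHom_awayIso c d _).trans ?_
  let u : Submonoid.powers (MvPolynomial.X c : CoordRing n) := ⟨MvPolynomial.X c ^ e, e, rfl⟩
  change substAway c d (Localization.mk F u) = _
  have h := congrArg (substAway c d) (IsLocalization.mk'_spec
    (Localization.Away (MvPolynomial.X c : CoordRing n)) F u)
  rw [map_mul, substAway_algebraMap, substAway_algebraMap] at h
  rw [Localization.mk_eq_mk']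
  simpa [u, subst_X_left] using h

lemma lineHom_surjective (h : d ≠ c) : Function.Surjective (lineHom c d) := by
  intro p
  induction p using Polynomial.induction_on' with
  | add p q hp hq =>
    obtain ⟨f, rfl⟩ := hp
    obtain ⟨g, rfl⟩ := hq
    exact ⟨f + g, map_add _ _ _⟩
  | monomial k z =>
    refine ⟨cst c z * formRatio c (MvPolynomial.isHomogeneous_X ℂ d) ^ k, ?_⟩
    rw [map_mul, map_pow, lineHom_cst, lineHom_formRatio, subst_X_right h, C_mul_X_pow_eq_monomial]

/-- A global section of `𝒪(k)` restricts to a polynomial of degree `≤ k` on the line. Compare the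
expressions in the two charts which cover the line. -/
lemma lineHom_eq_zero_or_natDegree_le (h : d ≠ c) {k : ℤ} (s : OSec k (⊤ : (ProjSp n).Opens))
    {f : Γ(ProjSp n, chart c)}
    (hf : (ProjSp n).presheaf.map (homOfLE (inf_le_right : ⊤ ⊓ chart c ≤ _)).op f = s.1 c) :
    lineHom c d f = 0 ∨ ((lineHom c d f).natDegree : ℤ) ≤ k := by
  obtain ⟨e, F, hF, rfl⟩ := exists_formRatio_eq c f
  obtain ⟨e', F', hF', hf'⟩ := exists_formRatio_eq d
    ((ProjSp n).presheaf.map (homOfLE (le_inf le_top le_rfl : chart d ≤ ⊤ ⊓ chart d)).op (s.1 d))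
  have hg (j : Fin (n + 1)) : genPt n ∈ chart j := fun h ↦ MvPolynomial.X_ne_zero (R := ℂ) j h
  have h1 := congrArg (ev (genPt n) (show genPt n ∈ ⊤ ⊓ chart c from ⟨trivial, hg c⟩)) hf
  have h2 := congrArg (ev (genPt n) (hg d)) hf'
  rw [ev_map, ev_formRatio, ev_eq_tval, div_eq_iff (pow_ne_zero _ (coord_ne_zero c))] at h1
  rw [ev_map, ev_formRatio, ev_eq_tval, div_eq_iff (pow_ne_zero _ (coord_ne_zero d))] at h2
  have hk : k = k.toNat - (-k).toNat := by omega
  have hcoord (j : Fin (n + 1)) :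
      coord j ^ (-k) * coord j ^ k.toNat = (coord j ^ (-k).toNat : RatField n) := by
    rw [← zpow_natCast, ← zpow_natCast, ← zpow_add₀ (coord_ne_zero j)]
    congr 1
    omega
  -- `F / x_c ^ e` and `F' / x_d ^ e'` agree up to the transition function `(x_d / x_c) ^ k`
  have h3 : F * MvPolynomial.X c ^ k.toNat *
      (MvPolynomial.X d ^ (-k).toNat * MvPolynomial.X d ^ e') =
      F' * MvPolynomial.X d ^ k.toNat *
      (MvPolynomial.X c ^ (-k).toNat * MvPolynomial.X c ^ e) := by
    apply IsFractionRing.injective (CoordRing n) (RatField n)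
    simp only [map_mul, map_pow, h1, h2]
    change _ * coord c ^ k.toNat * (coord d ^ (-k).toNat * coord d ^ e') =
      _ * coord d ^ k.toNat * (coord c ^ (-k).toNat * coord c ^ e)
    rw [← hcoord c, ← hcoord d]
    ring
  have h4 := congrArg (subst c d) h3
  simp only [map_mul, map_pow, subst_X_left, subst_X_right h, one_pow, mul_one] at h4
  rw [lineHom_formRatio]
  rcases eq_or_ne (subst c d F) 0 with h0 | h0
  · exact Or.inl h0
  · right
    have h5 := congrArg natDegree h4
    rw [← pow_add, natDegree_mul_X_pow _ h0] at h5
    have h6 := (natDegree_mul_le (p := subst c d F') (q := X ^ k.toNat)).trans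
      (add_le_add_left (natDegree_subst_le hF') _)
    rw [natDegree_X_pow] at h6
    omega

end Line

end ProjSp

/-! ### Multiple points on a line in projective space -/

namespace ProjSp
open OpenCohomology Polynomial
variable {n : ℕ}

section FatPoints

variable (c d : Fin (n + 1)) {t : ℕ} (a : Fin t → ℂ) (μ : Fin t → ℕ)

/-- The restriction of functions on `D₊(x_c)` to the points `aᵢ` of a line, taken with
multiplicities `μᵢ + 1`. -/
def fatHom : Γ(ProjSp n, chart c) ⟶ CommRingCat.of (AdjoinRoot (fatPoly a μ)) :=
  ConcreteCategory.ofHom (C := CommRingCat) (X := Γ(ProjSp n, chart c))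
    (Y := CommRingCat.of (AdjoinRoot (fatPoly a μ)))
    ((AdjoinRoot.mk (fatPoly a μ)).comp (lineHom c d))

/-- The points `aᵢ` of a line in projective space, taken with multiplicities `μᵢ + 1`. -/
def fatLine : Spec (CommRingCat.of (AdjoinRoot (fatPoly a μ))) ⟶ ProjSp n :=
  ofChart (fatHom c d a μ)

variable {c d}

lemma isClosedImmersion_fatLine (h : d ≠ c) : IsClosedImmersion (fatLine c d a μ) := by
  refine isClosedImmersion_ofChart _
    (AdjoinRoot.mk_surjective.comp (lineHom_surjective c d h)) ?_
  have h1 : (fatHom c d a μ).hom.comp (cst c) = algebraMap ℂ (AdjoinRoot (fatPoly a μ)) :=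
    RingHom.ext fun z ↦ congrArg (AdjoinRoot.mk (fatPoly a μ)) (lineHom_cst c d z)
  rw [h1, RingHom.finite_algebraMap]
  exact (fatPoly_monic a μ).finite_adjoinRoot

variable {a}

/-- In degrees `k ≤ ∑ (μᵢ + 1) - 2`, the class of `X ^ (∑ (μᵢ + 1) - 1)` is not the restriction of a
section of `𝒪(k)`, since such sections restrict to polynomials of degree `≤ k`. -/
lemma not_subsingleton_idealCohomology_fatLine (h : d ≠ c) (ht : 1 ≤ t) (ha : Function.Injective a)
    {k : ℤ} (hk : k ≤ (∑ i, (μ i + 1 : ℤ)) - 2) :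
    ¬ Subsingleton (idealCohomology (fatLine c d a μ) 1 k) := by
  intro hs
  have h0 : ∀ z : HU (idealSheaf (fatLine c d a μ) k) 1 ⊤, z = 0 := subsingleton_H_iff.1 hs
  have := isClosedImmersion_fatLine a μ h
  have hfin : Finite (Spec (CommRingCat.of (AdjoinRoot (fatPoly a μ)))) :=
    Finite.of_surjective _ (fatPoint_bijective μ ha).2
  have hT1 : T1Space (Spec (CommRingCat.of (AdjoinRoot (fatPoly a μ)))) := by
    refine ⟨fun x ↦ ?_⟩
    obtain ⟨i, rfl⟩ := (fatPoint_bijective μ ha).2 x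
    exact (PrimeSpectrum.isClosed_singleton_iff_isMaximal _).2 (isMaximal_fatPoint a μ i)
  let D : ℕ := ∑ i, (μ i + 1)
  have hD : ((D : ℕ) : ℤ) = ∑ i, (μ i + 1 : ℤ) := by simp [D]
  have hD1 : 1 ≤ D := (Nat.succ_le_succ (Nat.zero_le _)).trans
    (Finset.single_le_sum (f := fun i ↦ μ i + 1) (fun _ _ ↦ Nat.zero_le _)
      (Finset.mem_univ (⟨0, ht⟩ : Fin t)))
  obtain ⟨s, hs⟩ := exists_germO_eq (fatLine c d a μ) (fun _ ↦ c)
    (ofChart_mem_chart (fatHom c d a μ)) h0 fun x ↦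
      (Spec (CommRingCat.of (AdjoinRoot (fatPoly a μ)))).presheaf.germ ⊤ x trivial
        ((Scheme.ΓSpecIso (CommRingCat.of (AdjoinRoot (fatPoly a μ)))).inv
          (AdjoinRoot.mk (fatPoly a μ) (X ^ (D - 1))))
  obtain ⟨f, hf⟩ : ∃ f : Γ(ProjSp n, chart c),
      (ProjSp n).presheaf.map (homOfLE (inf_le_right : ⊤ ⊓ chart c ≤ _)).op f = s.1 c := by
    refine ⟨(ProjSp n).presheaf.map (homOfLE (le_inf le_top le_rfl)).op (s.1 c), ?_⟩
    rw [map_map_apply]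
    exact congr($((ProjSp n).presheaf.map_id (op (⊤ ⊓ chart c))) (s.1 c))
  have h1 : AdjoinRoot.mk (fatPoly a μ) (lineHom c d f) =
      AdjoinRoot.mk (fatPoly a μ) (X ^ (D - 1)) := by
    -- a function on `X` is determined by its germs
    apply (Scheme.ΓSpecIso
      (CommRingCat.of (AdjoinRoot (fatPoly a μ)))).symm.commRingCatIsoToRingEquiv.injective
    refine TopCat.Presheaf.section_ext (Spec (CommRingCat.of (AdjoinRoot (fatPoly a μ)))).sheaf
      ⊤ _ _ fun x hx ↦ ?_
    refine (pullGerm_ofChart (fatHom c d a μ) x f).symm.trans (Eq.trans ?_ (hs x))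
    have hx' : fatLine c d a μ x ∈ ⊤ ⊓ chart c := ⟨trivial, ofChart_mem_chart (fatHom c d a μ) x⟩
    exact (pullGerm_map (fatLine c d a μ) x inf_le_right hx' f).symm.trans
      (congrArg (pullGerm (fatLine c d a μ) x hx') hf)
  rw [AdjoinRoot.mk_eq_mk] at h1
  -- the difference has degree exactly `D - 1`, less than the degree `D` of `fatPoly`
  have hdeg : (lineHom c d f).natDegree < D - 1 ∨ lineHom c d f = 0 := by
    rcases lineHom_eq_zero_or_natDegree_le c d h s hf with h2 | h2
    · exact Or.inr h2
    · left
      omega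
  have h2 : (lineHom c d f).degree < (X ^ (D - 1) : ℂ[X]).degree := by
    rw [degree_X_pow]
    rcases hdeg with h2 | h2
    · exact degree_le_natDegree.trans_lt (by exact_mod_cast h2)
    · rw [h2, degree_zero]
      exact WithBot.bot_lt_coe _
  have h3 : (lineHom c d f - X ^ (D - 1)).degree = ((D - 1 : ℕ) : WithBot ℕ) := by
    rw [degree_sub_eq_right_of_degree_lt h2, degree_X_pow]
  refine (fatPoly_monic a μ).not_dvd_of_degree_lt ?_ ?_ h1
  · intro h4
    rw [h4, degree_zero] at h3
    exact WithBot.bot_ne_coe h3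
  · rw [h3, degree_eq_natDegree (fatPoly_monic a μ).ne_zero, natDegree_fatPoly]
    exact_mod_cast Nat.sub_lt hD1 one_pos

end FatPoints

end ProjSp

end

/-- Let `ι : X ⟶ ℙⁿ` be a closed subscheme whose points are exactly the distinct closed points
`p₁, …, p_t`, and let `μᵢ` be the Loewy length of `𝒪_{X, pᵢ}`. Then `H¹(ℙⁿ, ℐ_X(k)) = 0` for all
integers `k ≥ μ₁ + ⋯ + μ_t + t - 1`, and `X` is `(μ₁ + ⋯ + μ_t + t)`-regular. Moreover, for all
`n ≥ 1`, `t ≥ 1` and `μ₁, …, μ_t ≥ 0` there is such an `X` for which both bounds are optimal. -/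
theorem theorem1p1 :
    (∀ (n t : ℕ) (X : Scheme.{0}) (ι : X ⟶ ProjSp n) (_ : IsClosedImmersion ι) (p : Fin t → X),
      Function.Bijective p → (∀ i, IsClosed {p i}) →
        (∀ k : ℤ, (∑ i, (loewyLength (X.presheaf.stalk (p i)) : ℤ)) + t - 1 ≤ k →
          Subsingleton (ProjSp.idealCohomology ι 1 k)) ∧
        ProjSp.IsRegular ι ((∑ i, (loewyLength (X.presheaf.stalk (p i)) : ℤ)) + t)) ∧
    (∀ (n t : ℕ), 1 ≤ n → 1 ≤ t → ∀ μ : Fin t → ℕ,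
      ∃ (X : Scheme.{0}) (ι : X ⟶ ProjSp n) (_ : IsClosedImmersion ι) (p : Fin t → X),
        Function.Bijective p ∧ (∀ i, IsClosed {p i}) ∧
        (∀ i, loewyLength (X.presheaf.stalk (p i)) = μ i) ∧
        ¬ Subsingleton (ProjSp.idealCohomology ι 1 ((∑ i, (μ i : ℤ)) + t - 2)) ∧
        IsLeast {m : ℤ | ProjSp.IsRegular ι m} ((∑ i, (μ i : ℤ)) + t)) := by
  have upper (n t : ℕ) (X : Scheme.{0}) (ι : X ⟶ ProjSp n) (_ : IsClosedImmersion ι)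
      (p : Fin t → X) (hp : Function.Bijective p) (hcl : ∀ i, IsClosed {p i}) :
      (∀ k : ℤ, (∑ i, (loewyLength (X.presheaf.stalk (p i)) : ℤ)) + t - 1 ≤ k →
        Subsingleton (ProjSp.idealCohomology ι 1 k)) ∧
      ProjSp.IsRegular ι ((∑ i, (loewyLength (X.presheaf.stalk (p i)) : ℤ)) + t) := by
    classical
    let _ : Fintype X := Fintype.ofBijective p hp
    have : T1Space X := ⟨fun x ↦ by
      obtain ⟨i, rfl⟩ := hp.2 x
      exact hcl i⟩
    have hsum : (∑ i, (loewyLength (X.presheaf.stalk (p i)) : ℤ)) + t =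
        ∑ x : X, (loewyLength (X.presheaf.stalk x) + 1 : ℤ) := by
      rw [← hp.sum_comp fun x : X ↦ (loewyLength (X.presheaf.stalk x) + 1 : ℤ),
        Finset.sum_add_distrib]
      simp
    rw [hsum]
    exact ⟨fun k hk ↦ ProjSp.subsingleton_idealCohomology_one ι hk, ProjSp.isRegular_of_le ι le_rfl⟩
  refine ⟨upper, fun n t hn ht μ ↦ ?_⟩
  obtain ⟨n, rfl⟩ := Nat.exists_eq_add_of_le' hn
  have hne : (1 : Fin (n + 2)) ≠ 0 := one_ne_zero
  -- any `t` distinct points of a line do; take `0, …, t - 1`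
  let a : Fin t → ℂ := fun i ↦ ((i : ℕ) : ℂ)
  have ha : Function.Injective a := fun i j h ↦ Fin.ext (Nat.cast_injective h)
  have hcl (i : Fin t) : IsClosed {fatPoint a μ i} :=
    (PrimeSpectrum.isClosed_singleton_iff_isMaximal _).2 (isMaximal_fatPoint a μ i)
  have hι := ProjSp.isClosedImmersion_fatLine a μ hne
  let p : Fin t → Spec (CommRingCat.of (AdjoinRoot (fatPoly a μ))) := fatPoint a μ
  have hL (i : Fin t) : loewyLength ((Spec (CommRingCat.of
      (AdjoinRoot (fatPoly a μ)))).presheaf.stalk (p i)) = μ i :=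
    @loewyLength_fatPoint _ a μ ha i ((Spec (CommRingCat.of
      (AdjoinRoot (fatPoly a μ)))).presheaf.stalk (p i)) _ _
      (StructureSheaf.stalkAlgebra (AdjoinRoot (fatPoly a μ)) (fatPoint a μ i))
      (StructureSheaf.IsLocalization.to_stalk (AdjoinRoot (fatPoly a μ)) (fatPoint a μ i))
  have hsum : ∑ i, (μ i + 1 : ℤ) = (∑ i, (μ i : ℤ)) + t := by
    rw [Finset.sum_add_distrib]
    simp
  have hlow {k : ℤ} (hk : k ≤ (∑ i, (μ i : ℤ)) + t - 2) :
      ¬ Subsingleton (ProjSp.idealCohomology (ProjSp.fatLine 0 1 a μ) 1 k) :=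
    ProjSp.not_subsingleton_idealCohomology_fatLine μ hne ht ha (by rwa [hsum])
  refine ⟨_, ProjSp.fatLine 0 1 a μ, hι, p, fatPoint_bijective μ ha, hcl, hL, hlow le_rfl,
    ?_, fun m hm ↦ ?_⟩
  · have := (upper _ _ _ _ hι p (fatPoint_bijective μ ha) hcl).2
    simp only [hL] at this
    exact this
  · -- `m`-regularity includes `H¹(ℐ_X(m - 1)) = 0`
    by_contra hlt
    exact hlow (k := m - (1 : ℕ)) (by push_cast; omega) (hm 1 one_pos)
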